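/- Let $h\ge 1$ and $s>1$. There are constants $c_1,c_2>0$, depending only on $h$ and $s$, such that for every $\gamma\in(0,1)$ there are constants $c_0\ge 10240\,h^2/\gamma^2$, $C$ and $N$, depending only on $h,s,\gamma$, with the following property. Let $n\ge N$ and $k\ge 5$ be integers, let $p\in(0,1]$ satisfy $np\ge c_0\log n$, and let $\alpha\in(0,\infty)^n$ satisfy $\max_i\alpha_i\le h\min_i\alpha_i$. Put $\pi_i=\alpha_i/\sum_l\alpha_l$ and $p_{ij}=\alpha_j/(\alpha_i+\alpha_j)$. Let $q_{ij}=q_{ji}\in[p,1]$ for $i\ne j$ satisfy $$n\sum_{j\ne i}q_{ij}^2\le s\Big(\sum_{j\ne i}q_{ij}\Big)^2\qquad\text{for all } i\in\{1,\dots,n\}.$$ Let $\mathcal G=(\{1,\dots,n\},\mathcal E)$ be the random graph in which each pair $i<j$ is an edge independently with probability $q_{ij}$. Independently of $\mathcal G$ and of each other, let $Z_{ij}^{(1)},\dots,Z_{ij}^{(k)}\sim\mathrm{Bernoulli}(p_{ij})$ for $i<j$ (only those with $(i,j)\in\mathcal E$ are observed, and $Z_{ij}^{(m)}=1$ means that $j$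 beat $i$ in their $m$-th comparison). Put $\hat p_{ij}=\frac1k\sum_{m=1}^kZ_{ij}^{(m)}$ and $\hat p_{ji}=1-\hat p_{ij}$ for $i<j$. Let $d$ be the maximum degree of $\mathcal G$, and let $S$ be the matrix with $S_{ij}=p_{ij}/d$ if $(i,j)\in\mathcal E$, $S_{ii}=1-\frac1d\sum_{l:(i,l)\in\mathcal E}p_{il}$, and all other entries $0$ (with $S=I$ if $\mathcal G$ has no edges). Let $\hat S$ be defined in the same way with $\hat p$ in place of $p$. Let $\lambda_2(S)$ be the second largest eigenvalue of $S$ in absolute value, counted with multiplicity, and suppose that $$\mathbb P\big(1-|\lambda_2(S)|\le\gamma\big)\le n^{-5}.$$ Then, with probability at least $1-Cn^{-5}$, the matrix $\hat S$ has a unique stationary distribution $\hat\pi$, and $$\frac{\|\hat\pi-\pi\|_\infty}{\|\pi\|_\infty}\le\Big(\frac{c_1}{\gamma}+c_2\Big)\sqrt{\frac{\log n}{npk}}.$$ -/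

import Mathlib

open MeasureTheory ProbabilityTheory
open scoped Matrix

noncomputable section

/-- Unordered pairs of distinct items, represented as `(i, j)` with `i < j`. -/
abbrev ItemPair (n : ℕ) : Type := {e : Fin n × Fin n // e.1 < e.2}

/-- The Bradley-Terry-Luce probability `p_ij` that item `j` is preferred over item `i`. -/
def btlProb {n : ℕ} (α : Fin n → ℝ) (i j : Fin n) : ℝ := α j / (α i + α j)

/-- The normalized score vector `π`. -/
def normScore {n : ℕ} (α : Fin n → ℝ) : Fin n → ℝ := fun i => α i / ∑ j, α j

/-- The observation graph whose edges are the pairs `e` with `x e = true`. -/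
def obsGraph {n : ℕ} (x : ItemPair n → Bool) : SimpleGraph (Fin n) :=
  SimpleGraph.fromRel (fun i j => ∃ hij : i < j, x ⟨(i, j), hij⟩ = true)

/-- The empirical probability of `j` beating `i`. For `i < j`, `z ⟨(i, j), _⟩ m = true` means that
`j` beat `i` in the `m`-th of `k` comparisons, and `false` means that `i` beat `j`. -/
def empProb {n k : ℕ} (z : ItemPair n → Fin k → Bool) (i j : Fin n) : ℝ :=
  if hij : i < j then
    ((Finset.univ.filter (fun m : Fin k => z ⟨(i, j), hij⟩ m = true)).card : ℝ) / k
  else if hji : j < i then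
    ((Finset.univ.filter (fun m : Fin k => z ⟨(j, i), hji⟩ m = false)).card : ℝ) / k
  else 0

open Classical in
/-- The Markov matrix of rank centrality on the graph `G` with pairwise probabilities `P`; the
normalization `d` is the maximum degree of `G`. -/
def rankMatrix {n : ℕ} (G : SimpleGraph (Fin n)) (P : Fin n → Fin n → ℝ) :
    Matrix (Fin n) (Fin n) ℝ :=
  Matrix.of fun i j =>
    if i = j then 1 - (1 / (G.maxDegree : ℝ)) * ∑ l ∈ G.neighborFinset i, P i l
    else if G.Adj i j then P i j / (G.maxDegree : ℝ)
    else 0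

/-- `|λ_i(A)|`: the `i`-th largest (`i = 1, 2, …`) absolute value of an eigenvalue of `A`, where
the complex eigenvalues are counted with algebraic multiplicity. -/
def absEig {n : ℕ} (A : Matrix (Fin n) (Fin n) ℝ) (i : ℕ) : ℝ :=
  (((A.map (algebraMap ℝ ℂ)).charpoly.roots.map (fun z : ℂ => ‖z‖)).sort (· ≥ ·)).getD (i - 1) 0

/-- `v` is a stationary distribution of the matrix `M`. -/
def IsStationaryDist {n : ℕ} (M : Matrix (Fin n) (Fin n) ℝ) (v : Fin n → ℝ) : Prop :=
  v ∈ stdSimplex ℝ (Fin n) ∧ v ᵥ* M = v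

/-- The semi-random observation model with BTL comparisons: `X e` tells whether the pair `e` is an
edge, which has probability `q e`, and `Z e m` tells whether in the `m`-th comparison of the pair
`e = (i, j)`, `i < j`, item `j` beats item `i`, which has probability `p_ij`; all these Boolean
variables are mutually independent. (Only the outcomes `Z e m` on edges `e` are observed, and only
they enter `rankMatrix`.) -/
structure IsSemiRandomBTL {Ω : Type*} [MeasurableSpace Ω] (μ : Measure Ω) {n k : ℕ}
    (q : Fin n → Fin n → ℝ) (α : Fin n → ℝ)
    (X : ItemPair n → Ω → Bool) (Z : ItemPair n → Fin k → Ω → Bool) : Prop where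
  measurable_edge : ∀ e, Measurable (X e)
  measurable_outcome : ∀ e m, Measurable (Z e m)
  edge_law : ∀ e : ItemPair n, μ.real {ω | X e ω = true} = q e.1.1 e.1.2
  outcome_law : ∀ (e : ItemPair n) (m : Fin k),
    μ.real {ω | Z e m ω = true} = btlProb α e.1.1 e.1.2
  indep : iIndepFun
    (Sum.elim X (fun em : ItemPair n × Fin k => Z em.1 em.2) :
      ItemPair n ⊕ (ItemPair n × Fin k) → Ω → Bool) μ

end

/-! A stationary vector of Ŝ is a null vector of the net-outflow operator `flow` with rates x_ij
p̂_ij (x the edge indicators); the factor 1/d cancels. Split the rates as x p + η with noise η =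
x(p̂ − p), which is antisymmetric. The rates x p are reversible with respect to π, so the spectral
gap γ of S gives a Poincaré inequality with constant γd (`poincare_rankMatrix`). Tested against y =
u/π, the noise contributes a diagonal term governed by its row sums and the quadratic form of the
symmetric matrix η_ij(π_j − π_i)/√(π_i π_j). Both have size O(√(d log n)) for fixed h, hence cost at
most half the gap once np ≥ c₀ log n. This gives the stability estimate ‖u‖₂ ≤ 2h/(γd) · ‖flow u‖₂
for every u of total mass zero (`l2_le_l2_flow`). It yields existence and uniqueness of a null
vector v of mass one, and an ℓ² bound on v − π.

The sup norm needs a leave-one-out argument (`IsRealization.norm_sub_score_le`). For each m, replace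
the rates on pairs containing m by their means q p, and let π + e be the normalized null vector of
the new rates; e is independent of all variables at m. Write v − π = f + e. The entry e_m comes from
the deterministic balance equation at m, through Cauchy-Schwarz and the hypothesis on the q_ij²
(`abs_looScore_sub_le`): it is at most (1+h)√(s/n) ‖e‖₂. The vector f has mass zero, and its outflow
is the change of rates applied to π and to e. Independence makes scalar concentration available with
the random weights e, and stability bounds ‖f‖₂. The resulting inequality has ‖v − π‖∞ on both
sides, with a small coefficient on the right. Nonnegativity of v is not assumed; it follows because
the final error is below min π.

Probability is handled on a finite product space of Boolean variables, to which
`measureReal_eq_bernProb` transfers every event. Scalar sums are treated by exponential moments with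
coefficients frozen by independence (`bernProb_linear_tail`), and the skew noise matrix by a
recursion on the trace moments E tr M^(2r) (`bernExp_trace_pow_succ_le`). -/

noncomputable section

set_option linter.unusedSectionVars false

/-! ### Product Bernoulli measures and scalar concentration -/

section FiniteBernoulli

variable {I : Type*} [Fintype I] [DecidableEq I]

/-- The mass function of independent Bernoulli variables with success probabilities `w`. -/
def bernWeight (w : I → ℝ) (ω : I → Bool) : ℝ := ∏ i, if ω i = true then w i else 1 - w i

/-- Expectation with respect to independent Bernoulli variables. -/
def bernExp (w : I → ℝ) (f : (I → Bool) → ℝ) : ℝ := ∑ ω, bernWeight w ω * f ω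

open Classical in
/-- Probability with respect to independent Bernoulli variables. -/
def bernProb (w : I → ℝ) (p : (I → Bool) → Prop) : ℝ :=
  bernExp w (fun ω => if p ω then 1 else 0)

/-- The centred Bernoulli variable. -/
def centred (w : I → ℝ) (i : I) (ω : I → Bool) : ℝ := (if ω i = true then 1 else 0) - w i

lemma bernWeight_nonneg {w : I → ℝ} (h0 : ∀ i, 0 ≤ w i) (h1 : ∀ i, w i ≤ 1) (ω : I → Bool) :
    0 ≤ bernWeight w ω := by
  refine Finset.prod_nonneg fun i _ => ?_
  split_ifs
  · exact h0 i
  · linarith [h1 i]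

lemma bernExp_one (w : I → ℝ) : bernExp w (fun _ => 1) = 1 := by
  simp only [bernExp, mul_one, bernWeight]
  have := (Finset.prod_univ_sum (fun _ : I => (Finset.univ : Finset Bool))
    (fun i b => if b = true then w i else 1 - w i)).symm
  rw [Fintype.piFinset_univ] at this
  rw [this]
  simp

lemma bernExp_const (w : I → ℝ) (c : ℝ) : bernExp w (fun _ => c) = c := by
  have := bernExp_one w
  simp only [bernExp, mul_one] at this ⊢
  rw [← Finset.sum_mul, this, one_mul]

lemma bernExp_mono {w : I → ℝ} (h0 : ∀ i, 0 ≤ w i) (h1 : ∀ i, w i ≤ 1)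
    {f g : (I → Bool) → ℝ} (hfg : ∀ ω, f ω ≤ g ω) : bernExp w f ≤ bernExp w g :=
  Finset.sum_le_sum fun ω _ => mul_le_mul_of_nonneg_left (hfg ω) (bernWeight_nonneg h0 h1 ω)

lemma bernExp_add (w : I → ℝ) (f g : (I → Bool) → ℝ) :
    bernExp w (fun ω => f ω + g ω) = bernExp w f + bernExp w g := by
  simp only [bernExp, mul_add, Finset.sum_add_distrib]

lemma bernExp_mul_left (w : I → ℝ) (c : ℝ) (f : (I → Bool) → ℝ) :
    bernExp w (fun ω => c * f ω) = c * bernExp w f := by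
  simp only [bernExp, Finset.mul_sum]
  exact Finset.sum_congr rfl fun ω _ => by ring

lemma bernExp_sum {J : Type*} (w : I → ℝ) (s : Finset J) (f : J → (I → Bool) → ℝ) :
    bernExp w (fun ω => ∑ j ∈ s, f j ω) = ∑ j ∈ s, bernExp w (f j) := by
  simp only [bernExp, Finset.mul_sum]
  exact Finset.sum_comm

lemma bernWeight_update (w : I → ℝ) (ω : I → Bool) (i : I) (b : Bool) :
    bernWeight w (Function.update ω i b) = (if b = true then w i else 1 - w i) *
      ∏ j ∈ Finset.univ.erase i, if ω j = true then w j else 1 - w j := by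
  rw [bernWeight, ← Finset.mul_prod_erase _ _ (Finset.mem_univ i)]
  congr 1
  · simp
  · refine Finset.prod_congr rfl fun j hj => ?_
    rw [Function.update_of_ne (Finset.ne_of_mem_erase hj)]

lemma sum_flip (i : I) (g : (I → Bool) → ℝ) :
    ∑ ω, g (Function.update ω i (!ω i)) = ∑ ω, g ω := by
  have hinv : Function.Involutive (fun ω : I → Bool => Function.update ω i (!ω i)) := by
    intro ω
    simp
  exact Equiv.sum_comp (hinv.toPerm) g

/-- Averaging out a single coordinate. -/
lemma bernExp_resample (w : I → ℝ) (i : I) (f : (I → Bool) → ℝ) :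
    bernExp w f = bernExp w (fun ω => w i * f (Function.update ω i true) +
      (1 - w i) * f (Function.update ω i false)) := by
  -- Pairing ω with its flip at i removes the value of ω at i from the weight; each configuration of
  -- the other coordinates is counted twice, hence the factor 2.
  have key : ∀ g : (I → Bool) → ℝ, 2 * bernExp w g =
      ∑ ω : I → Bool, (∏ j ∈ Finset.univ.erase i, if ω j = true then w j else 1 - w j) *
        (w i * g (Function.update ω i true) + (1 - w i) * g (Function.update ω i false)) := by
    intro g
    have h2 := sum_flip i (fun ω => bernWeight w ω * g ω)
    have : 2 * bernExp w g = ∑ ω : I → Bool, (bernWeight w ω * g ω +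
        bernWeight w (Function.update ω i (!ω i)) * g (Function.update ω i (!ω i))) := by
      rw [Finset.sum_add_distrib, h2, bernExp, two_mul]
    rw [this]
    refine Finset.sum_congr rfl fun ω _ => ?_
    have hω : ω = Function.update ω i (ω i) := by simp
    have e1 : bernWeight w ω = bernWeight w (Function.update ω i (ω i)) := by rw [← hω]
    have e2 : g ω = g (Function.update ω i (ω i)) := by rw [← hω]
    rw [e1, e2, bernWeight_update, bernWeight_update]
    cases ω i <;> simp <;> ring
  have h1 := key f
  have h2 := key (fun ω => w i * f (Function.update ω i true) +
      (1 - w i) * f (Function.update ω i false))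
  simp only [Function.update_idem] at h2
  have : 2 * bernExp w f = 2 * bernExp w (fun ω => w i * f (Function.update ω i true) +
      (1 - w i) * f (Function.update ω i false)) := by
    rw [h1, h2]
    exact Finset.sum_congr rfl fun ω _ => by ring
  linarith

/-- `f` does not depend on the coordinates in `T`. -/
def Unaffected {β : Type*} (T : Set I) (f : (I → Bool) → β) : Prop :=
  ∀ ω, ∀ i ∈ T, ∀ b, f (Function.update ω i b) = f ω

lemma centred_update_self (w : I → ℝ) (i : I) (ω : I → Bool) (b : Bool) :
    centred w i (Function.update ω i b) = (if b = true then 1 else 0) - w i := by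
  simp [centred]

lemma centred_update_of_ne (w : I → ℝ) {i j : I} (h : j ≠ i) (ω : I → Bool) (b : Bool) :
    centred w j (Function.update ω i b) = centred w j ω := by
  simp [centred, Function.update_of_ne h]

/-- The coefficients a and compensators g may be random, but none reacts to the variables occurring
in the sum. Averaging out those variables one at a time therefore removes one factor of mean at most
1 each time. This replaces conditioning on the other variables. -/
lemma bernExp_exp_le_one {w : I → ℝ} (h0 : ∀ i, 0 ≤ w i) (h1 : ∀ i, w i ≤ 1)
    {J : Type*} (s : Finset J) (ι : J → I) (hι : Set.InjOn ι s)
    (a g : J → (I → Bool) → ℝ)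
    (ha : ∀ j ∈ s, Unaffected (ι '' s) (a j)) (hg : ∀ j ∈ s, Unaffected (ι '' s) (g j))
    (hmgf : ∀ j ∈ s, ∀ ω, w (ι j) * Real.exp (a j ω * (1 - w (ι j))) +
      (1 - w (ι j)) * Real.exp (a j ω * (0 - w (ι j))) ≤ Real.exp (g j ω)) :
    bernExp w (fun ω => Real.exp (∑ j ∈ s, (a j ω * centred w (ι j) ω - g j ω))) ≤ 1 := by
  classical
  suffices H : ∀ r : Finset J, r ⊆ s →
      bernExp w (fun ω => Real.exp (∑ j ∈ r, (a j ω * centred w (ι j) ω - g j ω))) ≤ 1 from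
    H s subset_rfl
  intro r
  induction r using Finset.induction_on with
  | empty => intro _; simp [bernExp_one]
  | insert j r hj ih =>
    intro hr
    have hjs : j ∈ s := hr (Finset.mem_insert_self _ _)
    have hrs : r ⊆ s := fun x hx => hr (Finset.mem_insert_of_mem hx)
    rw [bernExp_resample w (ι j)]
    refine le_trans (bernExp_mono h0 h1 fun ω => ?_) (ih hrs)
    have hmem : ι j ∈ ι '' (s : Set J) := ⟨j, hjs, rfl⟩
    have hval : ∀ b : Bool, Real.exp (∑ l ∈ insert j r, (a l (Function.update ω (ι j) b) *
        centred w (ι l) (Function.update ω (ι j) b) - g l (Function.update ω (ι j) b))) =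
        Real.exp (a j ω * ((if b = true then 1 else 0) - w (ι j))) * Real.exp (- g j ω) *
          Real.exp (∑ l ∈ r, (a l ω * centred w (ι l) ω - g l ω)) := by
      intro b
      rw [Finset.sum_insert hj, ← Real.exp_add, ← Real.exp_add, centred_update_self,
        ha j hjs ω _ hmem, hg j hjs ω _ hmem]
      congr 2
      refine Finset.sum_congr rfl fun l hl => ?_
      rw [ha l (hrs hl) ω _ hmem, hg l (hrs hl) ω _ hmem, centred_update_of_ne]
      intro h
      exact hj (hι (hrs hl) hjs h ▸ hl)
    rw [hval, hval]
    simp only [if_true, Bool.false_eq_true, if_false]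
    have h2 := hmgf j hjs ω
    have h3 : Real.exp (g j ω) * Real.exp (- g j ω) = 1 := by
      rw [← Real.exp_add]; simp
    have h4 := mul_le_mul_of_nonneg_right h2
      (mul_nonneg (Real.exp_pos (- g j ω)).le
        (Real.exp_pos (∑ l ∈ r, (a l ω * centred w (ι l) ω - g l ω))).le)
    calc _ = (w (ι j) * Real.exp (a j ω * (1 - w (ι j))) +
        (1 - w (ι j)) * Real.exp (a j ω * (0 - w (ι j)))) * (Real.exp (- g j ω) *
        Real.exp (∑ l ∈ r, (a l ω * centred w (ι l) ω - g l ω))) := by ring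
      _ ≤ _ := h4
      _ = _ := by rw [← mul_assoc, h3, one_mul]

lemma bernProb_mono {w : I → ℝ} (h0 : ∀ i, 0 ≤ w i) (h1 : ∀ i, w i ≤ 1)
    {p r : (I → Bool) → Prop} (h : ∀ ω, p ω → r ω) : bernProb w p ≤ bernProb w r := by
  refine bernExp_mono h0 h1 fun ω => ?_
  by_cases hp : p ω
  · simp [hp, h ω hp]
  · simp only [hp, if_false]; split_ifs <;> norm_num

lemma bernProb_markov {w : I → ℝ} (h0 : ∀ i, 0 ≤ w i) (h1 : ∀ i, w i ≤ 1)
    {p : (I → Bool) → Prop} {f : (I → Bool) → ℝ} (hf : ∀ ω, 0 ≤ f ω) {c : ℝ} (hc : 0 ≤ c)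
    (h : ∀ ω, p ω → 1 ≤ c * f ω) : bernProb w p ≤ c * bernExp w f := by
  rw [← bernExp_mul_left]
  refine bernExp_mono h0 h1 fun ω => ?_
  by_cases hp : p ω
  · simp [hp, h ω hp]
  · simpa [hp] using mul_nonneg hc (hf ω)

lemma bernProb_or {w : I → ℝ} (h0 : ∀ i, 0 ≤ w i) (h1 : ∀ i, w i ≤ 1)
    (p r : (I → Bool) → Prop) :
    bernProb w (fun ω => p ω ∨ r ω) ≤ bernProb w p + bernProb w r := by
  unfold bernProb
  rw [← bernExp_add]
  refine bernExp_mono h0 h1 fun ω => ?_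
  by_cases hp : p ω <;> by_cases hr : r ω <;> simp [hp, hr]

lemma bernProb_exists {J : Type*} [Fintype J] {w : I → ℝ} (h0 : ∀ i, 0 ≤ w i)
    (h1 : ∀ i, w i ≤ 1) (p : J → (I → Bool) → Prop) :
    bernProb w (fun ω => ∃ j, p j ω) ≤ ∑ j, bernProb w (p j) := by
  classical
  unfold bernProb
  rw [← bernExp_sum]
  refine bernExp_mono h0 h1 fun ω => ?_
  by_cases hp : ∃ j, p j ω
  · obtain ⟨j, hj⟩ := hp
    rw [if_pos ⟨j, hj⟩]
    have hle : (if p j ω then (1 : ℝ) else 0) = 1 := if_pos hj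
    refine hle.symm.le.trans ?_
    exact Finset.single_le_sum (f := fun j => if p j ω then (1 : ℝ) else 0)
      (fun l _ => by positivity) (Finset.mem_univ j)
  · rw [if_neg hp]
    exact Finset.sum_nonneg fun l _ => by positivity

lemma bernProb_not (w : I → ℝ) (p : (I → Bool) → Prop) :
    bernProb w (fun ω => ¬ p ω) = 1 - bernProb w p := by
  have : bernProb w (fun ω => ¬ p ω) + bernProb w p = 1 := by
    unfold bernProb
    rw [← bernExp_add]
    refine Eq.trans ?_ (bernExp_one w)
    congr 1
    ext ω
    by_cases hp : p ω <;> simp [hp]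
  linarith

/-- One-sided sub-Gaussian tail for a linear form whose coefficients do not depend on the
variables involved. -/
lemma bernProb_linear_tail {w : I → ℝ} (h0 : ∀ i, 0 ≤ w i) (h1 : ∀ i, w i ≤ 1)
    {J : Type*} (s : Finset J) (ι : J → I) (hι : Set.InjOn ι s)
    (c v : J → (I → Bool) → ℝ) (V : (I → Bool) → ℝ) {t : ℝ} (ht : 0 ≤ t)
    (hc : ∀ j ∈ s, Unaffected (ι '' s) (c j)) (hv : ∀ j ∈ s, Unaffected (ι '' s) (v j))
    (hV : Unaffected (ι '' s) V)
    (hV0 : ∀ ω, V ω = 0 → ∀ j ∈ s, c j ω = 0)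
    (hsum : ∀ ω, ∑ j ∈ s, v j ω ≤ V ω) (hVnn : ∀ ω, 0 ≤ V ω)
    (hmgf : ∀ j ∈ s, ∀ ω, w (ι j) * Real.exp (√(t / V ω) * c j ω * (1 - w (ι j))) +
      (1 - w (ι j)) * Real.exp (√(t / V ω) * c j ω * (0 - w (ι j))) ≤
        Real.exp (t / V ω * v j ω)) :
    bernProb w (fun ω => 2 * √(t * V ω) < ∑ j ∈ s, c j ω * centred w (ι j) ω) ≤
      Real.exp (-t) := by
  -- The tilt λ = √(t/V) gives λ · 2√(tV) − λ²V = t. It may depend on ω because V does not depend on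
  -- the variables being averaged.
  have hE := bernExp_exp_le_one h0 h1 s ι hι (fun j ω => √(t / V ω) * c j ω)
    (fun j ω => t / V ω * v j ω)
    (fun j hj ω i hi b => by simp only [hV ω i hi b, hc j hj ω i hi b])
    (fun j hj ω i hi b => by simp only [hV ω i hi b, hv j hj ω i hi b]) hmgf
  refine le_trans (bernProb_markov h0 h1 (f := fun ω => Real.exp (∑ j ∈ s,
    (√(t / V ω) * c j ω * centred w (ι j) ω - t / V ω * v j ω)))
    (fun ω => (Real.exp_pos _).le) (Real.exp_pos (-t)).le ?_)
    (mul_le_of_le_one_right (Real.exp_pos (-t)).le hE)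
  intro ω hω
  rw [← Real.exp_add]
  refine Real.one_le_exp ?_
  rcases eq_or_lt_of_le (hVnn ω) with hz | hpos
  · exfalso
    have : ∑ j ∈ s, c j ω * centred w (ι j) ω = 0 :=
      Finset.sum_eq_zero fun j hj => by rw [hV0 ω hz.symm j hj, zero_mul]
    rw [this] at hω
    exact absurd hω (not_lt.mpr (by positivity))
  · rw [Finset.sum_sub_distrib, ← Finset.mul_sum]
    have e1 : ∑ j ∈ s, √(t / V ω) * c j ω * centred w (ι j) ω =
        √(t / V ω) * ∑ j ∈ s, c j ω * centred w (ι j) ω := by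
      rw [Finset.mul_sum]; exact Finset.sum_congr rfl fun j _ => by ring
    rw [e1]
    have e2 : √(t / V ω) * (2 * √(t * V ω)) = 2 * t := by
      rw [mul_left_comm, ← Real.sqrt_mul (by positivity)]
      have : t / V ω * (t * V ω) = t ^ 2 := by field_simp
      rw [this, Real.sqrt_sq ht]
    have e3 := mul_le_mul_of_nonneg_left hω.le (Real.sqrt_nonneg (t / V ω))
    have e4 : t / V ω * ∑ j ∈ s, v j ω ≤ t := by
      calc t / V ω * ∑ j ∈ s, v j ω ≤ t / V ω * V ω :=
            mul_le_mul_of_nonneg_left (hsum ω) (by positivity)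
        _ = t := by field_simp
    linarith

/-- On [−1, 1] the chord of y ↦ exp(ay) is cosh a + y sinh a; a centred variable kills the second
term, and cosh a ≤ exp(a²/2). -/
lemma bernoulli_mgf_hoeffding {w : ℝ} (h0 : 0 ≤ w) (h1 : w ≤ 1) (a : ℝ) :
    w * Real.exp (a * (1 - w)) + (1 - w) * Real.exp (a * (0 - w)) ≤ Real.exp (a ^ 2 / 2) := by
  have hconv : ∀ y : ℝ, -1 ≤ y → y ≤ 1 →
      Real.exp (a * y) ≤ Real.cosh a + y * Real.sinh a := by
    intro y hy1 hy2
    have := convexOn_exp.2 (Set.mem_univ a) (Set.mem_univ (-a))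
      (show (0 : ℝ) ≤ (1 + y) / 2 by linarith) (show (0 : ℝ) ≤ (1 - y) / 2 by linarith) (by ring)
    simp only [smul_eq_mul] at this
    rw [Real.cosh_eq, Real.sinh_eq]
    have e : (1 + y) / 2 * a + (1 - y) / 2 * -a = a * y := by ring
    rw [e] at this
    linarith
  have ha := mul_le_mul_of_nonneg_left (hconv (1 - w) (by linarith) (by linarith)) h0
  have hb := mul_le_mul_of_nonneg_left (hconv (0 - w) (by linarith) (by linarith))
    (sub_nonneg.mpr h1)
  have hc := Real.cosh_le_exp_half_sq a
  nlinarith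

/-- The variance w(1 − w) enters through exp x ≤ 1 + x + x² on [−1, 1]. The factor w in the exponent
is what makes the bound useful for sparse graphs. -/
lemma bernoulli_mgf_bernstein {w : ℝ} (h0 : 0 ≤ w) (h1 : w ≤ 1) {a : ℝ} (ha : |a| ≤ 1) :
    w * Real.exp (a * (1 - w)) + (1 - w) * Real.exp (a * (0 - w)) ≤ Real.exp (a ^ 2 * w) := by
  have hq : ∀ x : ℝ, |x| ≤ 1 → Real.exp x ≤ 1 + x + x ^ 2 := by
    intro x hx
    have := Real.abs_exp_sub_one_sub_id_le hx
    linarith [(abs_le.mp this).2]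
  have hb1 : |a * (1 - w)| ≤ 1 := by
    rw [abs_mul, abs_of_nonneg (by linarith : 0 ≤ 1 - w)]
    nlinarith [abs_nonneg a]
  have hb2 : |a * (0 - w)| ≤ 1 := by
    rw [abs_mul, zero_sub, abs_neg, abs_of_nonneg h0]
    nlinarith [abs_nonneg a]
  have e1 := mul_le_mul_of_nonneg_left (hq _ hb1) h0
  have e2 := mul_le_mul_of_nonneg_left (hq _ hb2) (sub_nonneg.mpr h1)
  have e3 := Real.add_one_le_exp (a ^ 2 * w)
  have e4 : 0 ≤ a ^ 2 * w ^ 2 := by positivity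
  nlinarith

lemma bernProb_abs_le {w : I → ℝ} (h0 : ∀ i, 0 ≤ w i) (h1 : ∀ i, w i ≤ 1)
    (f g : (I → Bool) → ℝ) {ε : ℝ} (hp : bernProb w (fun ω => g ω < f ω) ≤ ε)
    (hm : bernProb w (fun ω => g ω < - f ω) ≤ ε) :
    bernProb w (fun ω => g ω < |f ω|) ≤ 2 * ε := by
  have := bernProb_or h0 h1 (fun ω => g ω < f ω) (fun ω => g ω < - f ω)
  have h2 := bernProb_mono h0 h1 (p := fun ω => g ω < |f ω|)
    (r := fun ω => g ω < f ω ∨ g ω < - f ω) (fun ω h => lt_abs.mp h)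
  linarith

lemma bernProb_hoeffding {w : I → ℝ} (h0 : ∀ i, 0 ≤ w i) (h1 : ∀ i, w i ≤ 1)
    {J : Type*} (s : Finset J) (ι : J → I) (hι : Set.InjOn ι s)
    (c : J → (I → Bool) → ℝ) {t : ℝ} (ht : 0 ≤ t)
    (hc : ∀ j ∈ s, Unaffected (ι '' s) (c j)) :
    bernProb w (fun ω => 2 * √(t * ((∑ j ∈ s, c j ω ^ 2) / 2)) <
      |∑ j ∈ s, c j ω * centred w (ι j) ω|) ≤ 2 * Real.exp (-t) := by
  have main : ∀ c : J → (I → Bool) → ℝ, (∀ j ∈ s, Unaffected (ι '' s) (c j)) →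
      bernProb w (fun ω => 2 * √(t * ((∑ j ∈ s, c j ω ^ 2) / 2)) <
      ∑ j ∈ s, c j ω * centred w (ι j) ω) ≤ Real.exp (-t) := by
    intro c hc
    refine bernProb_linear_tail h0 h1 s ι hι c (fun j ω => c j ω ^ 2 / 2)
      (fun ω => (∑ j ∈ s, c j ω ^ 2) / 2) ht hc
      (fun j hj ω i hi b => by simp only [hc j hj ω i hi b]) ?_ ?_ ?_ ?_ ?_
    · intro ω i hi b
      simp only
      congr 1
      exact Finset.sum_congr rfl fun j hj => by rw [hc j hj ω i hi b]
    · intro ω hω j hj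
      have : ∑ j ∈ s, c j ω ^ 2 = 0 := by linarith
      exact pow_eq_zero_iff (two_ne_zero) |>.mp
        ((Finset.sum_eq_zero_iff_of_nonneg fun j _ => sq_nonneg _).mp this j hj)
    · intro ω
      rw [Finset.sum_div]
    · intro ω
      have := Finset.sum_nonneg (s := s) fun j _ => sq_nonneg (c j ω)
      linarith
    · intro j hj ω
      refine le_trans (bernoulli_mgf_hoeffding (h0 _) (h1 _) _) (le_of_eq ?_)
      rw [mul_pow, Real.sq_sqrt]
      · congr 1; ring
      · have := Finset.sum_nonneg (s := s) fun j _ => sq_nonneg (c j ω)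
        positivity
  refine bernProb_abs_le h0 h1 _ _ (main c hc) ?_
  have := main (fun j ω => - c j ω) (fun j hj ω i hi b => by simp only [hc j hj ω i hi b])
  simpa only [neg_sq, neg_mul, Finset.sum_neg_distrib] using this

/-- The assumption t ≤ ∑ w keeps the tilted coefficients √(t/V) c_j inside [−1, 1], so only the
Gaussian regime of Bernstein's inequality occurs. -/
lemma bernProb_bernstein {w : I → ℝ} (h0 : ∀ i, 0 ≤ w i) (h1 : ∀ i, w i ≤ 1)
    {J : Type*} (s : Finset J) (ι : J → I) (hι : Set.InjOn ι s)
    (c : J → (I → Bool) → ℝ) (B : (I → Bool) → ℝ) {t : ℝ} (ht : 0 ≤ t)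
    (hc : ∀ j ∈ s, Unaffected (ι '' s) (c j)) (hB : Unaffected (ι '' s) B)
    (hcB : ∀ j ∈ s, ∀ ω, |c j ω| ≤ B ω) (hB0 : ∀ ω, 0 ≤ B ω)
    (htD : t ≤ ∑ j ∈ s, w (ι j)) (htpos : 0 < t) :
    bernProb w (fun ω => 2 * √(t * (B ω ^ 2 * ∑ j ∈ s, w (ι j))) <
      |∑ j ∈ s, c j ω * centred w (ι j) ω|) ≤ 2 * Real.exp (-t) := by
  have hD : 0 < ∑ j ∈ s, w (ι j) := lt_of_lt_of_le htpos htD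
  have main : ∀ c : J → (I → Bool) → ℝ, (∀ j ∈ s, Unaffected (ι '' s) (c j)) →
      (∀ j ∈ s, ∀ ω, |c j ω| ≤ B ω) →
      bernProb w (fun ω => 2 * √(t * (B ω ^ 2 * ∑ j ∈ s, w (ι j))) <
      ∑ j ∈ s, c j ω * centred w (ι j) ω) ≤ Real.exp (-t) := by
    intro c hc hcB
    refine bernProb_linear_tail h0 h1 s ι hι c (fun j ω => c j ω ^ 2 * w (ι j))
      (fun ω => B ω ^ 2 * ∑ j ∈ s, w (ι j)) ht hc
      (fun j hj ω i hi b => by simp only [hc j hj ω i hi b]) ?_ ?_ ?_ ?_ ?_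
    · intro ω i hi b
      simp only [hB ω i hi b]
    · intro ω hω j hj
      have hBz : B ω = 0 := by
        rcases mul_eq_zero.mp hω with h | h
        · exact pow_eq_zero_iff (two_ne_zero) |>.mp h
        · exact absurd h hD.ne'
      have := hcB j hj ω
      rw [hBz] at this
      exact abs_nonpos_iff.mp this
    · intro ω
      rw [Finset.mul_sum]
      refine Finset.sum_le_sum fun j hj => mul_le_mul_of_nonneg_right ?_ (h0 _)
      exact sq_le_sq.mpr ((hcB j hj ω).trans (le_abs_self _))
    · intro ω
      positivity
    · intro j hj ω
      refine le_trans (bernoulli_mgf_bernstein (h0 _) (h1 _) ?_) (le_of_eq ?_)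
      · rcases eq_or_lt_of_le (hB0 ω) with hz | hpos
        · simp [← hz]
        · rw [← abs_one, ← sq_le_sq, mul_pow, Real.sq_sqrt (by positivity), one_pow,
            div_mul_eq_mul_div, div_le_one (by positivity), mul_comm (B ω ^ 2)]
          exact mul_le_mul htD (sq_le_sq.mpr ((hcB j hj ω).trans (le_abs_self _)))
            (sq_nonneg _) hD.le
      · rw [mul_pow, Real.sq_sqrt (by positivity)]
        congr 1; ring
  refine bernProb_abs_le h0 h1 _ _ (main c hc hcB) ?_
  have := main (fun j ω => - c j ω) (fun j hj ω i hi b => by simp only [hc j hj ω i hi b])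
    (fun j hj ω => by rw [abs_neg]; exact hcB j hj ω)
  simpa only [neg_mul, Finset.sum_neg_distrib] using this

/-- Events of independent Boolean random variables have the probability that the product mass
function gives them. -/
lemma measureReal_eq_bernProb {Ω : Type*} [MeasurableSpace Ω] (μ : Measure Ω)
    [IsProbabilityMeasure μ] (Y : I → Ω → Bool) (hY : ∀ i, Measurable (Y i))
    (hind : iIndepFun Y μ) (w : I → ℝ) (hw : ∀ i, μ.real {ω | Y i ω = true} = w i)
    (p : (I → Bool) → Prop) :
    μ.real {ω | p (fun i => Y i ω)} = bernProb w p := by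
  classical
  have hmeas : Measurable (fun ω i => Y i ω) := measurable_pi_lambda _ hY
  have hsing : ∀ b : I → Bool, μ.real {ω | (fun i => Y i ω) = b} = bernWeight w b := by
    intro b
    have h := hind.measure_inter_preimage_eq_mul Finset.univ (sets := fun i => {b i})
      (fun i _ => measurableSet_singleton _)
    have hset : {ω | (fun i => Y i ω) = b} = ⋂ i ∈ Finset.univ, Y i ⁻¹' {b i} := by
      ext ω; simp [funext_iff]
    rw [hset, measureReal_def, h, ENNReal.toReal_prod, bernWeight]
    refine Finset.prod_congr rfl fun i _ => ?_
    cases hb : b i with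
    | true => rw [if_pos rfl, ← hw i]; rfl
    | false =>
      rw [if_neg (by simp), ← hw i]
      have hc : Y i ⁻¹' {false} = {ω | Y i ω = true}ᶜ := by
        ext ω; simp
      rw [hc, ← measureReal_def, probReal_compl_eq_one_sub]
      exact (hY i) (measurableSet_singleton true)
  have hset : {ω | p (fun i => Y i ω)} =
      ⋃ b ∈ Finset.univ.filter p, {ω | (fun i => Y i ω) = b} := by
    ext ω; simp
  rw [hset, measureReal_biUnion_finset]
  · simp only [bernProb, bernExp, mul_ite, mul_one, mul_zero]
    rw [Finset.sum_filter]
    exact Finset.sum_congr rfl fun b _ => by rw [hsing]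
  · intro b _ b' _ hbb
    refine Set.disjoint_left.mpr fun ω h h' => hbb ?_
    exact (h.symm.trans h' : b = b')
  · intro b _
    exact hmeas (measurableSet_singleton b)

end FiniteBernoulli

/-! ### Matrix concentration by trace moments -/

section TraceMoments

variable {n : Type*} [Fintype n] [DecidableEq n]

/-- Pair the term q with the term 2r − q. Each pair is at most μ^(2r) + ν^(2r), since |μ|^q − |ν|^q
and |μ|^(2r−q) − |ν|^(2r−q) have the same sign. -/
lemma sum_pow_mul_pow_le (μ ν : ℝ) (r : ℕ) :
    ∑ q ∈ Finset.range (2 * r + 1), μ ^ q * ν ^ (2 * r - q) ≤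
      (2 * r + 1) / 2 * (μ ^ (2 * r) + ν ^ (2 * r)) := by
  have hpt : ∀ q ∈ Finset.range (2 * r + 1),
      μ ^ q * ν ^ (2 * r - q) + μ ^ (2 * r - q) * ν ^ q ≤ μ ^ (2 * r) + ν ^ (2 * r) := by
    intro q hq
    have hq' : q + (2 * r - q) = 2 * r := by have := Finset.mem_range.mp hq; omega
    have e1 : μ ^ (2 * r) = |μ| ^ q * |μ| ^ (2 * r - q) := by
      rw [← pow_add, hq', (even_two_mul r).pow_abs]
    have e2 : ν ^ (2 * r) = |ν| ^ q * |ν| ^ (2 * r - q) := by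
      rw [← pow_add, hq', (even_two_mul r).pow_abs]
    have e3 : μ ^ q * ν ^ (2 * r - q) ≤ |μ| ^ q * |ν| ^ (2 * r - q) := by
      refine (le_abs_self _).trans (le_of_eq ?_); rw [abs_mul, abs_pow, abs_pow]
    have e4 : μ ^ (2 * r - q) * ν ^ q ≤ |μ| ^ (2 * r - q) * |ν| ^ q := by
      refine (le_abs_self _).trans (le_of_eq ?_); rw [abs_mul, abs_pow, abs_pow]
    have e5 : 0 ≤ (|μ| ^ q - |ν| ^ q) * (|μ| ^ (2 * r - q) - |ν| ^ (2 * r - q)) := by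
      rcases le_total |μ| |ν| with h | h
      · exact mul_nonneg_of_nonpos_of_nonpos
          (sub_nonpos.mpr (pow_le_pow_left₀ (abs_nonneg _) h _))
          (sub_nonpos.mpr (pow_le_pow_left₀ (abs_nonneg _) h _))
      · exact mul_nonneg (sub_nonneg.mpr (pow_le_pow_left₀ (abs_nonneg _) h _))
          (sub_nonneg.mpr (pow_le_pow_left₀ (abs_nonneg _) h _))
    rw [e1, e2]
    nlinarith
  have hsum := Finset.sum_le_sum hpt
  rw [Finset.sum_add_distrib, Finset.sum_const, Finset.card_range, nsmul_eq_mul] at hsum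
  have hrefl : ∑ q ∈ Finset.range (2 * r + 1), μ ^ (2 * r - q) * ν ^ q =
      ∑ q ∈ Finset.range (2 * r + 1), μ ^ q * ν ^ (2 * r - q) := by
    rw [← Finset.sum_range_reflect]
    refine Finset.sum_congr rfl fun q hq => ?_
    have := Finset.mem_range.mp hq
    congr 2; omega
  rw [hrefl] at hsum
  push_cast at hsum
  linarith

lemma exists_orthogonal_diag_eigenvalues {A : Matrix n n ℝ} (hH : A.IsHermitian) :
    ∃ U : Matrix n n ℝ, U * Uᵀ = 1 ∧ Uᵀ * U = 1 ∧
      ∀ k : ℕ, A ^ k = U * Matrix.diagonal (fun i => hH.eigenvalues i ^ k) * Uᵀ := by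
  have h1 : (hH.eigenvectorUnitary : Matrix n n ℝ) * (hH.eigenvectorUnitary : Matrix n n ℝ)ᵀ = 1 := by
    have := Unitary.coe_mul_star_self hH.eigenvectorUnitary
    rwa [Unitary.coe_star, Matrix.star_eq_conjTranspose,
      Matrix.conjTranspose_eq_transpose_of_trivial] at this
  have h2 : (hH.eigenvectorUnitary : Matrix n n ℝ)ᵀ * (hH.eigenvectorUnitary : Matrix n n ℝ) = 1 := by
    have := Unitary.coe_star_mul_self hH.eigenvectorUnitary
    rwa [Matrix.star_eq_conjTranspose,
      Matrix.conjTranspose_eq_transpose_of_trivial] at this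
  have hs : A = (hH.eigenvectorUnitary : Matrix n n ℝ) * Matrix.diagonal hH.eigenvalues *
      (hH.eigenvectorUnitary : Matrix n n ℝ)ᵀ := by
    have := hH.spectral_theorem
    rw [Unitary.conjStarAlgAut_apply, Matrix.star_eq_conjTranspose,
      Matrix.conjTranspose_eq_transpose_of_trivial] at this
    exact this
  refine ⟨hH.eigenvectorUnitary, h1, h2, fun k => ?_⟩
  generalize (hH.eigenvectorUnitary : Matrix n n ℝ) = U at *
  generalize hH.eigenvalues = D at *
  induction k with
  | zero => simp [h1]
  | succ k ih =>
    rw [pow_succ, ih]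
    conv_lhs => enter [2]; rw [hs]
    calc U * Matrix.diagonal (fun i => D i ^ k) * Uᵀ * (U * Matrix.diagonal D * Uᵀ)
        = U * Matrix.diagonal (fun i => D i ^ k) * (Uᵀ * U) * Matrix.diagonal D * Uᵀ := by
          simp only [Matrix.mul_assoc]
      _ = _ := by
          rw [h2, Matrix.mul_one, Matrix.mul_assoc U, Matrix.diagonal_mul_diagonal]
          simp only [pow_succ]

lemma exists_orthogonal_diag {A : Matrix n n ℝ} (hA : Aᵀ = A) :
    ∃ (U : Matrix n n ℝ) (D : n → ℝ), U * Uᵀ = 1 ∧ Uᵀ * U = 1 ∧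
      ∀ k : ℕ, A ^ k = U * Matrix.diagonal (fun i => D i ^ k) * Uᵀ := by
  have hH : A.IsHermitian := by
    rwa [Matrix.IsHermitian, Matrix.conjTranspose_eq_transpose_of_trivial]
  obtain ⟨U, h⟩ := exists_orthogonal_diag_eigenvalues hH
  exact ⟨U, hH.eigenvalues, h⟩

lemma dotProduct_mulVec_eq_sum {A U : Matrix n n ℝ} {D : n → ℝ}
    (hA : A = U * Matrix.diagonal D * Uᵀ) (z : n → ℝ) :
    z ⬝ᵥ (A *ᵥ z) = ∑ i, D i * (Uᵀ *ᵥ z) i ^ 2 := by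
  rw [hA, ← Matrix.mulVec_mulVec, ← Matrix.mulVec_mulVec, Matrix.dotProduct_mulVec,
    ← Matrix.mulVec_transpose]
  simp only [dotProduct, Matrix.mulVec_diagonal]
  exact Finset.sum_congr rfl fun i _ => by ring

lemma transpose_mulVec_dotProduct {U : Matrix n n ℝ} (hU : U * Uᵀ = 1) (z y : n → ℝ) :
    (Uᵀ *ᵥ z) ⬝ᵥ (Uᵀ *ᵥ y) = z ⬝ᵥ y := by
  rw [Matrix.dotProduct_mulVec, Matrix.vecMul_transpose, Matrix.mulVec_mulVec, hU,
    Matrix.one_mulVec]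

lemma trace_mul_diagonal_mul_diagonal (B : Matrix n n ℝ) (D E : n → ℝ) :
    (B * Matrix.diagonal D * Bᵀ * Matrix.diagonal E).trace =
      ∑ i, ∑ j, B i j ^ 2 * (D j * E i) := by
  simp only [Matrix.trace, Matrix.diag_apply]
  refine Finset.sum_congr rfl fun i _ => ?_
  rw [Matrix.mul_diagonal, Matrix.mul_apply, Finset.sum_mul]
  refine Finset.sum_congr rfl fun j _ => ?_
  rw [Matrix.mul_diagonal, Matrix.transpose_apply]
  ring

/-- Geometric-arithmetic mean inequality for traces. -/
lemma sum_trace_mul_pow_le {A W Y : Matrix n n ℝ} (hA : Aᵀ = A) (hW : Wᵀ = W) (hY : Yᵀ = Y)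
    (r : ℕ) :
    ∑ q ∈ Finset.range (2 * r + 1), (A * W ^ q * A * Y ^ (2 * r - q)).trace ≤
      (2 * r + 1) / 2 * ((A * A * W ^ (2 * r)).trace + (A * A * Y ^ (2 * r)).trace) := by
  obtain ⟨U, D, hU1, hU2, hD⟩ := exists_orthogonal_diag hW
  obtain ⟨V, E, hV1, hV2, hE⟩ := exists_orthogonal_diag hY
  set B := Vᵀ * A * U with hB
  have hBt : Bᵀ = Uᵀ * A * V := by
    rw [hB, Matrix.transpose_mul, Matrix.transpose_mul, Matrix.transpose_transpose, hA,
      Matrix.mul_assoc]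
  -- In eigenbases of W and Y the trace is a combination of the scalars D_j^a E_i^b with weights
  -- B_ij² ≥ 0, so the scalar inequality applies entry by entry.
  have key : ∀ a b : ℕ, (A * W ^ a * A * Y ^ b).trace =
      ∑ i, ∑ j, B i j ^ 2 * (D j ^ a * E i ^ b) := by
    intro a b
    rw [← trace_mul_diagonal_mul_diagonal B (fun j => D j ^ a) (fun i => E i ^ b), hBt, hD, hE, hB]
    have e : A * (U * Matrix.diagonal (fun i => D i ^ a) * Uᵀ) * A *
        (V * Matrix.diagonal (fun i => E i ^ b) * Vᵀ) =
        (A * U * Matrix.diagonal (fun i => D i ^ a) * (Uᵀ * A * V) *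
          Matrix.diagonal (fun i => E i ^ b)) * Vᵀ := by
      simp only [Matrix.mul_assoc]
    rw [e, Matrix.trace_mul_comm]
    simp only [Matrix.mul_assoc]
  have hl : (A * A * W ^ (2 * r)).trace = ∑ i, ∑ j, B i j ^ 2 * D j ^ (2 * r) := by
    have := key (2 * r) 0
    rw [pow_zero, Matrix.mul_one, Matrix.trace_mul_comm, ← Matrix.mul_assoc] at this
    rw [this]
    simp
  have hr : (A * A * Y ^ (2 * r)).trace = ∑ i, ∑ j, B i j ^ 2 * E i ^ (2 * r) := by
    have := key 0 (2 * r)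
    rw [pow_zero, Matrix.mul_one] at this
    rw [this]
    simp
  rw [hl, hr]
  simp_rw [key]
  rw [Finset.sum_comm, ← Finset.sum_add_distrib, Finset.mul_sum]
  refine Finset.sum_le_sum fun i _ => ?_
  rw [Finset.sum_comm, ← Finset.sum_add_distrib, Finset.mul_sum]
  refine Finset.sum_le_sum fun j _ => ?_
  rw [← Finset.mul_sum]
  have := mul_le_mul_of_nonneg_left (sum_pow_mul_pow_le (D j) (E i) r) (sq_nonneg (B i j))
  linarith

lemma pow_sub_pow_eq_sum (W Y : Matrix n n ℝ) (N : ℕ) :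
    W ^ (N + 1) - Y ^ (N + 1) =
      ∑ q ∈ Finset.range (N + 1), W ^ q * (W - Y) * Y ^ (N - q) := by
  induction N with
  | zero => simp
  | succ N ih =>
    rw [Finset.sum_range_succ']
    have : ∑ q ∈ Finset.range (N + 1), W ^ (q + 1) * (W - Y) * Y ^ (N + 1 - (q + 1)) =
        W * (W ^ (N + 1) - Y ^ (N + 1)) := by
      rw [ih, Finset.mul_sum]
      refine Finset.sum_congr rfl fun q _ => ?_
      rw [pow_succ' W q, Nat.add_sub_add_right]
      simp only [Matrix.mul_assoc]
    rw [this, pow_succ' W (N + 1), pow_succ' Y (N + 1)]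
    simp only [pow_zero, one_mul, Nat.sub_zero]
    noncomm_ring

/-- Here W and Y stand for the two values of the random matrix when one Bernoulli variable is
switched, so A is the coefficient matrix of that variable. This is a mean value inequality for the
odd power 2r + 1. -/
lemma trace_mul_pow_sub_le {A W Y : Matrix n n ℝ} (hA : Aᵀ = A) (hW : Wᵀ = W) (hY : Yᵀ = Y)
    (hWY : W - Y = A) (r : ℕ) :
    (A * W ^ (2 * r + 1)).trace - (A * Y ^ (2 * r + 1)).trace ≤
      (2 * r + 1) / 2 * ((A * A * W ^ (2 * r)).trace + (A * A * Y ^ (2 * r)).trace) := by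
  refine le_trans (le_of_eq ?_) (sum_trace_mul_pow_le hA hW hY r)
  rw [← Matrix.trace_sub, ← Matrix.mul_sub, pow_sub_pow_eq_sum, hWY, Finset.mul_sum,
    Matrix.trace_sum]
  refine Finset.sum_congr rfl fun q _ => ?_
  simp only [Matrix.mul_assoc]

lemma pow_two_mul_diag_nonneg {M : Matrix n n ℝ} (hM : Mᵀ = M) (r : ℕ) (i : n) :
    0 ≤ (M ^ (2 * r)) i i := by
  have hMr : (M ^ r)ᵀ = M ^ r := by rw [Matrix.transpose_pow, hM]
  rw [two_mul, pow_add, Matrix.mul_apply]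
  refine Finset.sum_nonneg fun j _ => ?_
  have : (M ^ r) j i = (M ^ r) i j := by
    conv_lhs => rw [← hMr]
    rfl
  rw [this]
  exact mul_self_nonneg _

/-- The trace of M^(2r) dominates the 2r-th power of each eigenvalue. -/
lemma abs_quadForm_pow_le {M : Matrix n n ℝ} (hM : Mᵀ = M) (r : ℕ) {τ : ℝ} (hτ : 0 ≤ τ)
    (h : (M ^ (2 * r)).trace ≤ τ ^ (2 * r)) (hr : r ≠ 0) (z : n → ℝ) :
    |∑ i, ∑ j, z i * M i j * z j| ≤ τ * ∑ i, z i ^ 2 := by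
  obtain ⟨U, D, hU1, hU2, hD⟩ := exists_orthogonal_diag hM
  have htr : (M ^ (2 * r)).trace = ∑ i, D i ^ (2 * r) := by
    rw [hD, Matrix.trace_mul_comm, ← Matrix.mul_assoc, hU2, Matrix.one_mul, Matrix.trace_diagonal]
  have hDτ : ∀ i, |D i| ≤ τ := by
    intro i
    have h1 : D i ^ (2 * r) ≤ τ ^ (2 * r) := by
      refine le_trans ?_ (htr ▸ h)
      exact Finset.single_le_sum (f := fun i => D i ^ (2 * r))
        (fun j _ => (even_two_mul r).pow_nonneg _) (Finset.mem_univ i)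
    rw [← (even_two_mul r).pow_abs] at h1
    exact le_of_pow_le_pow_left₀ (by omega) hτ h1
  set y := Uᵀ *ᵥ z with hy
  have hquad : ∑ i, ∑ j, z i * M i j * z j = ∑ i, D i * y i ^ 2 := by
    have e1 : ∑ i, ∑ j, z i * M i j * z j = z ⬝ᵥ (M *ᵥ z) := by
      simp only [dotProduct, Matrix.mulVec, Finset.mul_sum, mul_assoc]
    have e2 : M = U * Matrix.diagonal D * Uᵀ := by simpa using hD 1
    rw [e1, dotProduct_mulVec_eq_sum e2]
  have hnorm : ∑ i, y i ^ 2 = ∑ i, z i ^ 2 := by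
    have := transpose_mulVec_dotProduct hU1 z z
    simpa only [dotProduct, ← sq] using this
  rw [hquad, ← hnorm, Finset.mul_sum]
  refine (Finset.abs_sum_le_sum_abs _ _).trans (Finset.sum_le_sum fun i _ => ?_)
  rw [abs_mul, abs_of_nonneg (sq_nonneg (y i))]
  exact mul_le_mul_of_nonneg_right (hDτ i) (sq_nonneg _)

variable {I : Type*} [Fintype I] [DecidableEq I] {J : Type*}

/-- Split one factor M off M^(2r+2). Averaging over ξ_j turns E ξ_j tr(A_j M^(2r+1)) into w(1 − w)
times the difference between the two switched values, which `trace_mul_pow_sub_le` bounds by traces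
of A_j² M^(2r). As w(1 − w) is below both w and 1 − w, these recombine into an expectation, and ∑
A_j² ≤ v closes the recursion. -/
lemma bernExp_trace_pow_succ_le {w : I → ℝ} (h0 : ∀ i, 0 ≤ w i) (h1 : ∀ i, w i ≤ 1)
    (s : Finset J) (ι : J → I) (hι : Set.InjOn ι s) (A : J → (I → Bool) → Matrix n n ℝ)
    (hA : ∀ j ∈ s, Unaffected (ι '' s) (A j)) (hsymm : ∀ j ∈ s, ∀ ω, (A j ω)ᵀ = A j ω)
    (D : (I → Bool) → n → ℝ) {v : ℝ}
    (hD : ∀ ω, ∑ j ∈ s, A j ω * A j ω = Matrix.diagonal (D ω)) (hv : ∀ ω i, D ω i ≤ v) (r : ℕ) :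
    bernExp w (fun ω => ((∑ j ∈ s, centred w (ι j) ω • A j ω) ^ (2 * (r + 1))).trace) ≤
      (2 * r + 1) / 2 * v *
        bernExp w (fun ω => ((∑ j ∈ s, centred w (ι j) ω • A j ω) ^ (2 * r)).trace) := by
  classical
  set M : (I → Bool) → Matrix n n ℝ := fun ω => ∑ j ∈ s, centred w (ι j) ω • A j ω with hM
  have hMs : ∀ ω, (M ω)ᵀ = M ω := by
    intro ω
    rw [hM, Matrix.transpose_sum]
    exact Finset.sum_congr rfl fun j hj => by rw [Matrix.transpose_smul, hsymm j hj]
  have hdiff : ∀ j ∈ s, ∀ ω, M (Function.update ω (ι j) true) -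
      M (Function.update ω (ι j) false) = A j ω := by
    intro j hj ω
    have hmem : ι j ∈ ι '' (s : Set J) := ⟨j, hj, rfl⟩
    simp only [hM]
    rw [← Finset.sum_sub_distrib, Finset.sum_eq_single_of_mem j hj]
    · rw [hA j hj ω _ hmem, hA j hj ω _ hmem, centred_update_self, centred_update_self, ← sub_smul]
      simp
    · intro l hl hlj
      have hne : ι l ≠ ι j := fun h => hlj (hι hl hj h)
      rw [hA l hl ω _ hmem, hA l hl ω _ hmem, centred_update_of_ne w hne,
        centred_update_of_ne w hne, sub_self]
  have hterm : ∀ j ∈ s, bernExp w (fun ω => centred w (ι j) ω * (A j ω * M ω ^ (2 * r + 1)).trace) ≤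
      (2 * r + 1) / 2 * bernExp w (fun ω => (A j ω * A j ω * M ω ^ (2 * r)).trace) := by
    intro j hj
    have hmem : ι j ∈ ι '' (s : Set J) := ⟨j, hj, rfl⟩
    rw [bernExp_resample w (ι j), bernExp_resample w (ι j) (fun ω => (A j ω * A j ω * M ω ^ (2 * r)).trace),
      ← bernExp_mul_left]
    refine bernExp_mono h0 h1 fun ω => ?_
    simp only [centred_update_self, hA j hj ω _ hmem, if_true, Bool.false_eq_true, if_false]
    have hAW : ∀ b, (A j ω * A j ω * M (Function.update ω (ι j) b) ^ (2 * r)).trace ≥ 0 := by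
      intro b
      rw [Matrix.mul_assoc, Matrix.trace_mul_comm]
      set W := M (Function.update ω (ι j) b)
      have hW : Wᵀ = W := hMs _
      have e : A j ω * W ^ (2 * r) * A j ω = (A j ω * W ^ r) * (A j ω * W ^ r)ᵀ := by
        rw [Matrix.transpose_mul, Matrix.transpose_pow, hW, hsymm j hj, two_mul, pow_add]
        simp only [Matrix.mul_assoc]
      rw [e, Matrix.trace]
      refine Finset.sum_nonneg fun i _ => ?_
      rw [Matrix.diag_apply, Matrix.mul_apply]
      exact Finset.sum_nonneg fun l _ => mul_self_nonneg _
    have hkey := trace_mul_pow_sub_le (hsymm j hj ω) (hMs (Function.update ω (ι j) true))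
      (hMs (Function.update ω (ι j) false)) (hdiff j hj ω) r
    have ha := hAW true
    have hb := hAW false
    set a := (A j ω * A j ω * M (Function.update ω (ι j) true) ^ (2 * r)).trace
    set b := (A j ω * A j ω * M (Function.update ω (ι j) false) ^ (2 * r)).trace
    have hw0 := h0 (ι j)
    have hw1 : 0 ≤ 1 - w (ι j) := sub_nonneg.mpr (h1 (ι j))
    have h3 := mul_le_mul_of_nonneg_left hkey (mul_nonneg hw0 hw1)
    have hr0 : (0 : ℝ) ≤ (2 * r + 1) / 2 := by positivity
    have h4 : w (ι j) * (1 - w (ι j)) * (a + b) ≤ w (ι j) * a + (1 - w (ι j)) * b := by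
      nlinarith [mul_nonneg (mul_nonneg hw0 hw0) ha, mul_nonneg (mul_nonneg hw1 hw1) hb]
    have h5 := mul_le_mul_of_nonneg_left h4 hr0
    nlinarith
  have hlhs : ∀ ω, (M ω ^ (2 * (r + 1))).trace =
      ∑ j ∈ s, centred w (ι j) ω * (A j ω * M ω ^ (2 * r + 1)).trace := by
    intro ω
    have : M ω ^ (2 * (r + 1)) = M ω * M ω ^ (2 * r + 1) := by rw [← pow_succ']; ring_nf
    rw [this]
    conv_lhs => enter [1, 1]; rw [hM]
    simp only [Finset.sum_mul, Matrix.trace_sum, Matrix.smul_mul, Matrix.trace_smul, smul_eq_mul]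
  have hrhs : ∀ ω, ∑ j ∈ s, (A j ω * A j ω * M ω ^ (2 * r)).trace ≤ v * (M ω ^ (2 * r)).trace := by
    intro ω
    rw [← Matrix.trace_sum, ← Finset.sum_mul, hD, Matrix.trace, Matrix.trace, Finset.mul_sum]
    refine Finset.sum_le_sum fun i _ => ?_
    rw [Matrix.diag_apply, Matrix.diag_apply, Matrix.diagonal_mul]
    exact mul_le_mul_of_nonneg_right (hv ω i) (pow_two_mul_diag_nonneg (hMs ω) r i)
  calc bernExp w (fun ω => (M ω ^ (2 * (r + 1))).trace)
      = ∑ j ∈ s, bernExp w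
          (fun ω => centred w (ι j) ω * (A j ω * M ω ^ (2 * r + 1)).trace) := by
        rw [← bernExp_sum]; simp only [hlhs]
    _ ≤ ∑ j ∈ s, (2 * r + 1) / 2 * bernExp w (fun ω => (A j ω * A j ω * M ω ^ (2 * r)).trace) :=
        Finset.sum_le_sum hterm
    _ = (2 * r + 1) / 2 * bernExp w
          (fun ω => ∑ j ∈ s, (A j ω * A j ω * M ω ^ (2 * r)).trace) := by
        rw [bernExp_sum, Finset.mul_sum]
    _ ≤ (2 * r + 1) / 2 * (v * bernExp w (fun ω => (M ω ^ (2 * r)).trace)) := by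
        rw [← bernExp_mul_left w v]
        exact mul_le_mul_of_nonneg_left (bernExp_mono h0 h1 hrhs) (by positivity)
    _ = _ := by ring

/-- Tail bound for the quadratic form of a random symmetric matrix series. -/
lemma bernProb_quadForm_tail {w : I → ℝ} (h0 : ∀ i, 0 ≤ w i) (h1 : ∀ i, w i ≤ 1)
    (s : Finset J) (ι : J → I) (hι : Set.InjOn ι s) (A : J → (I → Bool) → Matrix n n ℝ)
    (hA : ∀ j ∈ s, Unaffected (ι '' s) (A j)) (hsymm : ∀ j ∈ s, ∀ ω, (A j ω)ᵀ = A j ω)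
    (D : (I → Bool) → n → ℝ) {v : ℝ} (hv0 : 0 < v)
    (hD : ∀ ω, ∑ j ∈ s, A j ω * A j ω = Matrix.diagonal (D ω)) (hv : ∀ ω i, D ω i ≤ v)
    {r : ℕ} (hr : r ≠ 0) :
    bernProb w (fun ω => ∃ z : n → ℝ, √(Real.exp 9 * (r * v)) * ∑ i, z i ^ 2 <
      |∑ i, ∑ l, z i * (∑ j ∈ s, centred w (ι j) ω • A j ω) i l * z l|) ≤
      Fintype.card n * Real.exp (-9 * r) := by
  set M : (I → Bool) → Matrix n n ℝ := fun ω => ∑ j ∈ s, centred w (ι j) ω • A j ω with hM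
  have hMs : ∀ ω, (M ω)ᵀ = M ω := by
    intro ω
    rw [hM, Matrix.transpose_sum]
    exact Finset.sum_congr rfl fun j hj => by rw [Matrix.transpose_smul, hsymm j hj]
  have hrpos : (0 : ℝ) < r := by exact_mod_cast Nat.pos_of_ne_zero hr
  have hnn : ∀ (m : ℕ) ω, 0 ≤ (M ω ^ (2 * m)).trace := fun m ω =>
    Finset.sum_nonneg fun i _ => pow_two_mul_diag_nonneg (hMs ω) m i
  have hmom : ∀ m : ℕ, m ≤ r →
      bernExp w (fun ω => (M ω ^ (2 * m)).trace) ≤ Fintype.card n * (r * v) ^ m := by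
    intro m
    induction m with
    | zero => intro _; simp [bernExp_const]
    | succ m ih =>
      intro hm
      refine (bernExp_trace_pow_succ_le h0 h1 s ι hι A hA hsymm D hD hv m).trans ?_
      have hmr : ((2 : ℝ) * m + 1) / 2 ≤ r := by
        have : (m : ℝ) + 1 ≤ r := by exact_mod_cast hm
        linarith
      have h2 : (2 * (m : ℝ) + 1) / 2 * v ≤ r * v := mul_le_mul_of_nonneg_right hmr hv0.le
      calc _ ≤ (r * v) * (Fintype.card n * (r * v) ^ m) :=
            mul_le_mul h2 (ih (by omega))
              (by rw [← bernExp_const w 0]; exact bernExp_mono h0 h1 (hnn m)) (by positivity)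
        _ = _ := by ring
  -- The 2r-th moment is at most card n · (rv)^r, so the factor e^9 in τ² leaves e^(−9r) after
  -- Markov's inequality.
  set τ := √(Real.exp 9 * (r * v)) with hτ
  have hτ2 : τ ^ (2 * r) = Real.exp (9 * r) * (r * v) ^ r := by
    rw [pow_mul, hτ, Real.sq_sqrt (by positivity), mul_pow, ← Real.exp_nat_mul]
    congr 2; ring
  refine (bernProb_markov h0 h1 (f := fun ω => (M ω ^ (2 * r)).trace) (hnn r)
    (c := (τ ^ (2 * r))⁻¹) (by positivity) ?_).trans ?_
  · rintro ω ⟨z, hz⟩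
    by_contra hlt
    rw [not_le, inv_mul_lt_iff₀ (by rw [hτ2]; positivity), mul_one] at hlt
    exact absurd (abs_quadForm_pow_le (hMs ω) r (Real.sqrt_nonneg _) hlt.le hr z) (not_le.mpr hz)
  · rw [inv_mul_le_iff₀ (by rw [hτ2]; positivity), hτ2]
    refine (hmom r le_rfl).trans (le_of_eq ?_)
    have : Real.exp (9 * r) * Real.exp (-9 * r) = 1 := by
      rw [← Real.exp_add]; simp
    calc (Fintype.card n : ℝ) * (r * v) ^ r
        = Fintype.card n * (r * v) ^ r * (Real.exp (9 * r) * Real.exp (-9 * r)) := by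
          rw [this, mul_one]
      _ = _ := by ring

end TraceMoments

/-! ### From the second eigenvalue to a Poincaré inequality -/

section SpectralGap

lemma absEig_eq_of_charpoly_eq {n : ℕ} {A B : Matrix (Fin n) (Fin n) ℝ}
    (h : A.charpoly = B.charpoly) (i : ℕ) : absEig A i = absEig B i := by
  unfold absEig
  rw [Matrix.charpoly_map, Matrix.charpoly_map, h]

lemma List.filter_length_le_one_of_pairwise {l : List ℝ} (hl : l.Pairwise (· ≥ ·)) {c : ℝ}
    (hlen : 2 ≤ l.length) (hc : l.getD 1 0 < c) : (l.filter (fun x => c ≤ x)).length ≤ 1 := by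
  match l, hlen with
  | a :: b :: t, _ =>
    simp only [List.getD_cons_succ, List.getD_cons_zero] at hc
    have hb : ∀ x ∈ b :: t, ¬ c ≤ x := by
      intro x hx
      have h2 := (List.pairwise_cons.mp hl).2
      rcases List.mem_cons.mp hx with rfl | hx
      · exact not_le.mpr hc
      · exact not_le.mpr (((List.pairwise_cons.mp h2).1 x hx).trans_lt hc)
    have : (b :: t).filter (fun x => c ≤ x) = [] := by
      rw [List.filter_eq_nil_iff]
      intro x hx
      simpa using hb x hx
    rw [List.filter_cons, this]
    split_ifs <;> simp

/-- For Hermitian H the complex roots of the characteristic polynomial are the real eigenvalues with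
multiplicity. The size condition n ≥ 2 ensures that `absEig H 2` reads an actual entry of the sorted
list and not the default 0. -/
lemma card_eigenvalues_le_one {n : ℕ} (hn : 2 ≤ n) {H : Matrix (Fin n) (Fin n) ℝ}
    (hH : H.IsHermitian) {c : ℝ} (hc : absEig H 2 < c) :
    (Finset.univ.filter (fun i => c ≤ |hH.eigenvalues i|)).card ≤ 1 := by
  have hroots : (((H.map (algebraMap ℝ ℂ)).charpoly.roots.map (fun z : ℂ => ‖z‖))) =
      (Finset.univ : Finset (Fin n)).val.map (fun i => |hH.eigenvalues i|) := by
    rw [Matrix.charpoly_map, hH.charpoly_eq, Polynomial.map_prod]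
    simp only [Polynomial.map_sub, Polynomial.map_X, Polynomial.map_C]
    rw [Polynomial.roots_prod]
    · simp [Multiset.bind_singleton, Function.comp_def]
    · exact Finset.prod_ne_zero_iff.mpr fun i _ => Polynomial.X_sub_C_ne_zero _
  unfold absEig at hc
  rw [hroots] at hc
  set m := (Finset.univ : Finset (Fin n)).val.map (fun i => |hH.eigenvalues i|) with hm
  have h1 := List.filter_length_le_one_of_pairwise (l := m.sort (· ≥ ·))
    (Multiset.pairwise_sort m (· ≥ ·)) (by simpa [hm] using hn) hc
  have h2 : (m.filter (fun x => c ≤ x)).card ≤ 1 := by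
    rw [← Multiset.sort_eq m (· ≥ ·), Multiset.filter_coe, Multiset.coe_card]
    exact h1
  rw [hm, Multiset.filter_map, Multiset.card_map] at h2
  exact h2

/-- At most one eigenvalue has absolute value at least 1 − γ, and the eigenvalue 1 of φ is one such.
Hence φ spans the corresponding eigenline, and a vector orthogonal to φ only sees eigenvalues below
1 − γ. -/
lemma quadForm_le_of_absEig {n : ℕ} (hn : 2 ≤ n) {H : Matrix (Fin n) (Fin n) ℝ} (hH : Hᵀ = H)
    {γ : ℝ} (hγ : 0 < γ) (hgap : γ < 1 - absEig H 2) {φ : Fin n → ℝ} (hφ0 : φ ≠ 0)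
    (hφ : H *ᵥ φ = φ) {z : Fin n → ℝ} (hz : φ ⬝ᵥ z = 0) :
    z ⬝ᵥ (H *ᵥ z) ≤ (1 - γ) * (z ⬝ᵥ z) := by
  have hHe : H.IsHermitian := by
    rwa [Matrix.IsHermitian, Matrix.conjTranspose_eq_transpose_of_trivial]
  obtain ⟨U, hU1, hU2, hD⟩ := exists_orthogonal_diag_eigenvalues hHe
  have hcard := card_eigenvalues_le_one hn hHe (c := 1 - γ) (by linarith)
  set D := hHe.eigenvalues
  have hH1 : H = U * Matrix.diagonal D * Uᵀ := by simpa using hD 1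
  set ψ := Uᵀ *ᵥ φ with hψ
  have hDψ : ∀ i, D i * ψ i = ψ i := by
    intro i
    have : Uᵀ *ᵥ (H *ᵥ φ) = Matrix.diagonal D *ᵥ ψ := by
      rw [hψ]
      conv_lhs => rw [hH1]
      rw [Matrix.mulVec_mulVec, Matrix.mulVec_mulVec, Matrix.mul_assoc U, ← Matrix.mul_assoc,
        hU2, Matrix.one_mul]
    rw [hφ] at this
    have h2 := congrFun this i
    rw [Matrix.mulVec_diagonal] at h2
    exact h2.symm
  have hψ0 : ψ ≠ 0 := by
    intro h
    apply hφ0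
    have : U *ᵥ ψ = φ := by rw [hψ, Matrix.mulVec_mulVec, hU1, Matrix.one_mulVec]
    rw [← this, h, Matrix.mulVec_zero]
  obtain ⟨i₀, hi₀⟩ := Function.ne_iff.mp hψ0
  have hD1 : ∀ i, ψ i ≠ 0 → D i = 1 := fun i hi => by
    have := hDψ i
    exact mul_right_cancel₀ hi (by rw [this, one_mul])
  have hbig : ∀ i, 1 - γ ≤ |D i| → i = i₀ := by
    intro i hi
    refine Finset.card_le_one.mp hcard i (by simpa using hi) i₀ ?_
    rw [Finset.mem_filter, hD1 i₀ hi₀]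
    refine ⟨Finset.mem_univ _, ?_⟩
    rw [abs_one]; linarith
  have hother : ∀ i, i ≠ i₀ → ψ i = 0 := by
    intro i hi
    by_contra h
    refine hi (hbig i ?_)
    rw [hD1 i h, abs_one]; linarith
  set y := Uᵀ *ᵥ z with hy
  have hy0 : y i₀ = 0 := by
    have h1 := transpose_mulVec_dotProduct hU1 φ z
    rw [hz, ← hψ, ← hy, dotProduct, Finset.sum_eq_single_of_mem i₀ (Finset.mem_univ _)
      (fun i _ hi => by rw [hother i hi, zero_mul])] at h1
    exact (mul_eq_zero.mp h1).resolve_left hi₀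
  rw [dotProduct_mulVec_eq_sum hH1, ← transpose_mulVec_dotProduct hU1 z z, ← hy, dotProduct,
    Finset.mul_sum]
  refine Finset.sum_le_sum fun i _ => ?_
  by_cases hi : i = i₀
  · rw [hi, hy0]; simp
  · rw [← sq]
    refine mul_le_mul_of_nonneg_right ?_ (sq_nonneg _)
    by_contra h
    exact hi (hbig i ((not_le.mp h).le.trans (le_abs_self _)))

/-- Poincaré inequality of a reversible stochastic matrix. -/
lemma poincare_of_absEig {n : ℕ} (hn : 2 ≤ n) {S : Matrix (Fin n) (Fin n) ℝ} {π : Fin n → ℝ}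
    (hπ : ∀ i, 0 < π i) (hrev : ∀ i j, π i * S i j = π j * S j i) (hrow : ∀ i, ∑ j, S i j = 1)
    {γ : ℝ} (hγ : 0 < γ) (hgap : γ < 1 - absEig S 2) {y : Fin n → ℝ} (hy : ∑ i, π i * y i = 0) :
    γ * ∑ i, π i * y i ^ 2 ≤ (∑ i, ∑ j, π i * S i j * (y i - y j) ^ 2) / 2 := by
  set r : Fin n → ℝ := fun i => √(π i) with hr
  have hr0 : ∀ i, 0 < r i := fun i => Real.sqrt_pos.mpr (hπ i)
  have hr2 : ∀ i, r i * r i = π i := fun i => Real.mul_self_sqrt (hπ i).le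
  -- Conjugation by √π makes the reversible matrix symmetric without changing the characteristic
  -- polynomial; the fixed vector becomes √π.
  set H : Matrix (Fin n) (Fin n) ℝ := Matrix.diagonal r * S * Matrix.diagonal (fun i => (r i)⁻¹)
    with hH
  have hHij : ∀ i j, H i j = r i * S i j * (r j)⁻¹ := by
    intro i j
    rw [hH, Matrix.mul_diagonal, Matrix.diagonal_mul]
  have hunit1 : Matrix.diagonal r * Matrix.diagonal (fun i => (r i)⁻¹) = 1 := by
    rw [Matrix.diagonal_mul_diagonal, ← Matrix.diagonal_one]
    congr 1; ext i; exact mul_inv_cancel₀ (hr0 i).ne'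
  have hunit2 : Matrix.diagonal (fun i => (r i)⁻¹) * Matrix.diagonal r = 1 := by
    rw [Matrix.diagonal_mul_diagonal, ← Matrix.diagonal_one]
    congr 1; ext i; exact inv_mul_cancel₀ (hr0 i).ne'
  have hchar : H.charpoly = S.charpoly := by
    rw [hH, Matrix.charpoly_mul_comm, ← Matrix.mul_assoc, hunit2, Matrix.one_mul]
  have hHs : Hᵀ = H := by
    ext i j
    rw [Matrix.transpose_apply, hHij, hHij, ← div_eq_mul_inv, ← div_eq_mul_inv,
      div_eq_div_iff (hr0 i).ne' (hr0 j).ne']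
    have := hrev i j
    rw [← hr2, ← hr2] at this
    linarith
  have hφ : H *ᵥ r = r := by
    ext i
    simp only [Matrix.mulVec, dotProduct, hHij]
    have : ∀ j, r i * S i j * (r j)⁻¹ * r j = r i * S i j := fun j => by
      rw [mul_assoc, inv_mul_cancel₀ (hr0 j).ne', mul_one]
    simp only [this]
    rw [← Finset.mul_sum, hrow, mul_one]
  have hr_ne : r ≠ 0 := by
    intro h
    exact (hr0 ⟨0, by omega⟩).ne' (congrFun h _)
  have hz : r ⬝ᵥ (fun i => r i * y i) = 0 := by
    simp only [dotProduct, ← mul_assoc, hr2, hy]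
  have hmain := quadForm_le_of_absEig hn hHs hγ
    (by rwa [absEig_eq_of_charpoly_eq hchar]) hr_ne hφ hz
  have e1 : (fun i => r i * y i) ⬝ᵥ (fun i => r i * y i) = ∑ i, π i * y i ^ 2 := by
    simp only [dotProduct]
    exact Finset.sum_congr rfl fun i _ => by rw [← hr2]; ring
  have e2 : (fun i => r i * y i) ⬝ᵥ (H *ᵥ (fun i => r i * y i)) =
      ∑ i, ∑ j, π i * S i j * (y i * y j) := by
    simp only [dotProduct, Matrix.mulVec, Finset.mul_sum, hHij]
    refine Finset.sum_congr rfl fun i _ => Finset.sum_congr rfl fun j _ => ?_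
    have := inv_mul_cancel₀ (hr0 j).ne'
    calc r i * y i * (r i * S i j * (r j)⁻¹ * (r j * y j))
        = (r i * r i) * S i j * (y i * y j) * ((r j)⁻¹ * r j) := by ring
      _ = _ := by rw [this, hr2, mul_one]
  rw [e1, e2] at hmain
  have e3 : ∑ i, ∑ j, π i * S i j * (y i - y j) ^ 2 =
      2 * ∑ i, π i * y i ^ 2 - 2 * ∑ i, ∑ j, π i * S i j * (y i * y j) := by
    have a1 : ∑ i, ∑ j, π i * S i j * y i ^ 2 = ∑ i, π i * y i ^ 2 := by
      refine Finset.sum_congr rfl fun i _ => ?_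
      rw [← Finset.sum_mul, ← Finset.mul_sum, hrow, mul_one]
    have a2 : ∑ i, ∑ j, π i * S i j * y j ^ 2 = ∑ i, π i * y i ^ 2 := by
      rw [Finset.sum_comm, ← a1]
      refine Finset.sum_congr rfl fun i _ => Finset.sum_congr rfl fun j _ => ?_
      rw [hrev]
    have a3 : ∀ i j, π i * S i j * (y i - y j) ^ 2 = π i * S i j * y i ^ 2 +
        π i * S i j * y j ^ 2 - 2 * (π i * S i j * (y i * y j)) := fun i j => by ring
    simp only [a3, Finset.sum_sub_distrib, Finset.sum_add_distrib, ← Finset.mul_sum]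
    rw [a1, a2]; ring
  rw [e3]
  linarith

end SpectralGap

/-! ### The net-outflow operator and its stability under noise -/

section Flow

variable {n : ℕ}

/-- The Euclidean norm on `Fin n → ℝ`. -/
def l2 (u : Fin n → ℝ) : ℝ := √(∑ i, u i ^ 2)

lemma l2_nonneg (u : Fin n → ℝ) : 0 ≤ l2 u := Real.sqrt_nonneg _

lemma l2_sq (u : Fin n → ℝ) : l2 u ^ 2 = ∑ i, u i ^ 2 :=
  Real.sq_sqrt (Finset.sum_nonneg fun _ _ => sq_nonneg _)

lemma l2_eq_norm (u : Fin n → ℝ) : l2 u = ‖WithLp.toLp 2 u‖ := by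
  rw [EuclideanSpace.norm_eq, l2]
  simp

lemma l2_add_le (u v : Fin n → ℝ) : l2 (u + v) ≤ l2 u + l2 v := by
  rw [l2_eq_norm, l2_eq_norm, l2_eq_norm, WithLp.toLp_add]
  exact norm_add_le _ _

lemma l2_neg (u : Fin n → ℝ) : l2 (-u) = l2 u := by
  simp [l2]

lemma abs_le_l2 (u : Fin n → ℝ) (i : Fin n) : |u i| ≤ l2 u := by
  rw [← Real.sqrt_sq_eq_abs, l2]
  exact Real.sqrt_le_sqrt
    (Finset.single_le_sum (f := fun i => u i ^ 2) (fun _ _ => sq_nonneg _) (Finset.mem_univ i))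

lemma l2_le_of_sq_le {u : Fin n → ℝ} {c : ℝ} (hc : 0 ≤ c) (h : ∑ i, u i ^ 2 ≤ c ^ 2) :
    l2 u ≤ c := by
  rw [l2]; exact Real.sqrt_le_iff.mpr ⟨hc, h⟩

lemma sum_mul_le_l2 (u v : Fin n → ℝ) : ∑ i, u i * v i ≤ l2 u * l2 v :=
  Real.sum_mul_le_sqrt_mul_sqrt _ _ _

/-- The net outflow at `j` of the mass `u` under the jump rates `A`. -/
def flow (A : Fin n → Fin n → ℝ) (u : Fin n → ℝ) (j : Fin n) : ℝ :=
  ∑ i, (u j * A j i - u i * A i j)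

lemma flow_add (A : Fin n → Fin n → ℝ) (u v : Fin n → ℝ) :
    flow A (u + v) = flow A u + flow A v := by
  ext j
  simp only [flow, Pi.add_apply, ← Finset.sum_add_distrib]
  exact Finset.sum_congr rfl fun i _ => by ring

lemma flow_smul (A : Fin n → Fin n → ℝ) (c : ℝ) (u : Fin n → ℝ) :
    flow A (c • u) = c • flow A u := by
  ext j
  simp only [flow, Pi.smul_apply, smul_eq_mul, Finset.mul_sum]
  exact Finset.sum_congr rfl fun i _ => by ring

lemma flow_sub (A : Fin n → Fin n → ℝ) (u v : Fin n → ℝ) :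
    flow A (u - v) = flow A u - flow A v := by
  ext j
  simp only [flow, Pi.sub_apply, ← Finset.sum_sub_distrib]
  exact Finset.sum_congr rfl fun i _ => by ring

lemma flow_sub_rates (A B : Fin n → Fin n → ℝ) (u : Fin n → ℝ) :
    flow (fun i j => A i j - B i j) u = flow A u - flow B u := by
  ext j
  simp only [flow, Pi.sub_apply, ← Finset.sum_sub_distrib]
  exact Finset.sum_congr rfl fun i _ => by ring

lemma flow_add_rates (A B : Fin n → Fin n → ℝ) (u : Fin n → ℝ) :
    flow (fun i j => A i j + B i j) u = flow A u + flow B u := by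
  ext j
  simp only [flow, Pi.add_apply, ← Finset.sum_add_distrib]
  exact Finset.sum_congr rfl fun i _ => by ring

lemma sum_flow (A : Fin n → Fin n → ℝ) (u : Fin n → ℝ) : ∑ j, flow A u j = 0 := by
  simp only [flow, Finset.sum_sub_distrib]
  rw [Finset.sum_comm, sub_self]

lemma flow_eq_zero_of_detailed_balance {A : Fin n → Fin n → ℝ} {u : Fin n → ℝ} {j : Fin n}
    (h : ∀ i, u j * A j i = u i * A i j) : flow A u j = 0 :=
  Finset.sum_eq_zero fun i _ => by rw [h, sub_self]

lemma exists_flow_eq_zero (hn : 0 < n) {A : Fin n → Fin n → ℝ}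
    (hA : ∀ u, ∑ i, u i = 0 → flow A u = 0 → u = 0) :
    ∃ u : Fin n → ℝ, ∑ i, u i = 1 ∧ flow A u = 0 := by
  have hn' : (n : ℝ) ≠ 0 := by exact_mod_cast hn.ne'
  -- Outflows sum to zero, so `flow A` is never surjective. Adding the total mass to each coordinate
  -- repairs this: the coordinates of T u sum to n times the mass of u, so T is injective, and the
  -- solution of T u = 1 has mass one and no outflow.
  let T : (Fin n → ℝ) →ₗ[ℝ] (Fin n → ℝ) :=
    { toFun := fun u j => flow A u j + ∑ i, u i
      map_add' := fun u v => by
        ext j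
        simp only [flow_add, Pi.add_apply, Finset.sum_add_distrib]; ring
      map_smul' := fun c u => by
        ext j
        simp only [flow_smul, Pi.smul_apply, smul_eq_mul, RingHom.id_apply, ← Finset.mul_sum]
        ring }
  have hT : ∀ u, ∑ j, T u j = n * ∑ i, u i := by
    intro u
    change ∑ j, (flow A u j + ∑ i, u i) = _
    rw [Finset.sum_add_distrib, sum_flow, zero_add, Finset.sum_const, Finset.card_univ,
      Fintype.card_fin, nsmul_eq_mul]
  have hinj : Function.Injective T := by
    rw [injective_iff_map_eq_zero]
    intro u hu
    have h1 := hT u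
    rw [hu] at h1
    have h2 : ∑ i, u i = 0 := by
      have : (n : ℝ) * ∑ i, u i = 0 := by rw [← h1]; simp
      exact (mul_eq_zero.mp this).resolve_left hn'
    refine hA u h2 ?_
    ext j
    have h3 : flow A u j + ∑ i, u i = 0 := congrFun hu j
    rw [h2, add_zero] at h3
    exact h3
  obtain ⟨u, hu⟩ := LinearMap.surjective_of_injective hinj (fun _ => 1)
  have h1 := hT u
  rw [hu] at h1
  have h2 : ∑ i, u i = 1 := by
    simp at h1
    exact mul_left_cancel₀ hn' (by rw [← h1, mul_one])
  refine ⟨u, h2, ?_⟩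
  ext j
  have h3 : flow A u j + ∑ i, u i = 1 := congrFun hu j
  rw [h2] at h3
  simpa using h3

/-- If the state `m` communicates directly with every other state, then no nonzero null vector has
total mass zero. -/
lemma eq_zero_of_flow_eq_zero_of_star {A : Fin n → Fin n → ℝ} (hA : ∀ i j, 0 ≤ A i j) (m : Fin n)
    (hstar : ∀ i, i ≠ m → 0 < A i m) {u : Fin n → ℝ} (hu : ∑ i, u i = 0)
    (hfl : flow A u = 0) : u = 0 := by
  -- By the triangle inequality |u| has nonpositive outflow everywhere; outflows sum to zero, so |u|
  -- is a null vector too. Comparing u with |u| at m forces all entries to share the sign of u m.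
  have habs : ∀ j, flow A (fun i => |u i|) j ≤ 0 := by
    intro j
    have h0 : (∑ i, u j * A j i) = ∑ i, u i * A i j := by
      have := congrFun hfl j
      simp only [flow, Finset.sum_sub_distrib, Pi.zero_apply] at this
      linarith
    simp only [flow, Finset.sum_sub_distrib]
    have h1 : ∑ i, |u j| * A j i = |∑ i, u j * A j i| := by
      rw [← Finset.mul_sum, ← Finset.mul_sum, abs_mul,
        abs_of_nonneg (Finset.sum_nonneg fun i _ => hA j i)]
    have h2 : |∑ i, u i * A i j| ≤ ∑ i, |u i| * A i j := by
      refine (Finset.abs_sum_le_sum_abs _ _).trans (Finset.sum_le_sum fun i _ => ?_)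
      rw [abs_mul, abs_of_nonneg (hA i j)]
    rw [h1, h0]; linarith
  have hm0 : flow A (fun i => |u i|) m = 0 := by
    have := (Finset.sum_eq_zero_iff_of_nonpos fun j _ => habs j).mp
      (sum_flow A (fun i => |u i|)) m (Finset.mem_univ m)
    exact this
  have pos_case : ∀ v : Fin n → ℝ, ∑ i, v i = 0 → flow A v = 0 →
      flow A (fun i => |v i|) m = 0 → 0 ≤ v m → v = 0 := by
    intro v hv hfv hav hvm
    have h1 : ∑ i, (|v i| - v i) * A i m = 0 := by
      have h2 := congrFun hfv m
      simp only [flow, Finset.sum_sub_distrib, Pi.zero_apply] at h2 hav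
      rw [abs_of_nonneg hvm] at hav
      simp only [sub_mul, Finset.sum_sub_distrib]
      linarith
    have h2 := (Finset.sum_eq_zero_iff_of_nonneg fun i _ =>
      mul_nonneg (sub_nonneg.mpr (le_abs_self (v i))) (hA i m)).mp h1
    have h3 : ∀ i, 0 ≤ v i := by
      intro i
      by_cases hi : i = m
      · rw [hi]; exact hvm
      · have := (mul_eq_zero.mp (h2 i (Finset.mem_univ i))).resolve_right (hstar i hi).ne'
        rw [← sub_eq_zero.mp this]
        exact abs_nonneg _
    ext i
    exact (Finset.sum_eq_zero_iff_of_nonneg fun i _ => h3 i).mp hv i (Finset.mem_univ i)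
  rcases le_total 0 (u m) with h | h
  · exact pos_case u hu hfl hm0 h
  · have := pos_case (-u) (by simp [hu])
      (by have := flow_smul A (-1) u; rw [neg_one_smul, neg_one_smul, hfl] at this; simpa using this)
      (by simpa using hm0) (by simpa using h)
    simpa using this

open Classical in
/-- A null vector of total mass one, if there is one. -/
def nullVec (A : Fin n → Fin n → ℝ) : Fin n → ℝ :=
  if h : ∃ u : Fin n → ℝ, ∑ i, u i = 1 ∧ flow A u = 0 then h.choose else 0

lemma nullVec_spec {A : Fin n → Fin n → ℝ} (h : ∃ u : Fin n → ℝ, ∑ i, u i = 1 ∧ flow A u = 0) :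
    ∑ i, nullVec A i = 1 ∧ flow A (nullVec A) = 0 := by
  rw [nullVec, dif_pos h]
  exact h.choose_spec

/-- Summation by parts: for reversible rates the pairing is the Dirichlet form, to which the
Poincaré inequality applies. -/
lemma sum_flow_mul_of_reversible {A : Fin n → Fin n → ℝ} {π y : Fin n → ℝ}
    (hrev : ∀ i j, π i * A i j = π j * A j i) :
    ∑ j, flow A (fun i => π i * y i) j * y j =
      (∑ i, ∑ j, π i * A i j * (y i - y j) ^ 2) / 2 := by
  have e1 : ∑ j, flow A (fun i => π i * y i) j * y j =
      ∑ j, ∑ i, π j * A j i * ((y j - y i) * y j) := by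
    refine Finset.sum_congr rfl fun j _ => ?_
    rw [flow, Finset.sum_mul]
    refine Finset.sum_congr rfl fun i _ => ?_
    have := hrev i j
    linear_combination (-(y i * y j)) * this
  have e2 : ∑ j, ∑ i, π j * A j i * ((y j - y i) * y j) =
      ∑ j, ∑ i, π j * A j i * ((y i - y j) * y i) := by
    rw [Finset.sum_comm]
    refine Finset.sum_congr rfl fun j _ => Finset.sum_congr rfl fun i _ => ?_
    rw [hrev i j]
  rw [e1, eq_div_iff two_ne_zero, mul_two]
  nth_rewrite 2 [e2]
  rw [← Finset.sum_add_distrib]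
  refine Finset.sum_congr rfl fun j _ => ?_
  rw [← Finset.sum_add_distrib]
  exact Finset.sum_congr rfl fun i _ => by ring

/-- Antisymmetry turns the pairing into ∑ η_ji (π_j y_j² + π_i y_i y_j). Symmetrizing the cross
terms leaves only score differences π_j − π_i. The result is written with a symmetric matrix in the
variables √π y, whose squared norm is the left-hand sum in the Poincaré inequality. -/
lemma sum_flow_mul_of_antisymm {η : Fin n → Fin n → ℝ} {π y : Fin n → ℝ} (hπ : ∀ i, 0 < π i)
    (hη : ∀ i j, η j i = - η i j) :
    ∑ j, flow η (fun i => π i * y i) j * y j =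
      ∑ j, π j * y j ^ 2 * ∑ i, η j i +
      (∑ i, ∑ j, (√(π i) * y i) * (η i j * ((π j - π i) / (√(π i) * √(π j)))) *
        (√(π j) * y j)) / 2 := by
  have e1 : ∑ j, flow η (fun i => π i * y i) j * y j =
      ∑ j, π j * y j ^ 2 * ∑ i, η j i + ∑ j, ∑ i, η j i * (π i * y i * y j) := by
    rw [← Finset.sum_add_distrib]
    refine Finset.sum_congr rfl fun j _ => ?_
    rw [flow, Finset.sum_mul, Finset.mul_sum, ← Finset.sum_add_distrib]
    refine Finset.sum_congr rfl fun i _ => ?_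
    rw [hη j i]
    ring
  have e2 : ∑ j, ∑ i, η j i * (π i * y i * y j) = ∑ j, ∑ i, - (η j i * (π j * y i * y j)) := by
    rw [Finset.sum_comm]
    refine Finset.sum_congr rfl fun j _ => Finset.sum_congr rfl fun i _ => ?_
    rw [hη j i]; ring
  have e3 : ∀ i j, (√(π i) * y i) * (η i j * ((π j - π i) / (√(π i) * √(π j)))) *
        (√(π j) * y j) = η i j * ((π j - π i) * (y i * y j)) := by
    intro i j
    have h1 := (Real.sqrt_pos.mpr (hπ i)).ne'
    have h2 := (Real.sqrt_pos.mpr (hπ j)).ne'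
    field_simp
  rw [e1]
  congr 1
  simp only [e3]
  rw [eq_div_iff two_ne_zero, mul_two]
  nth_rewrite 2 [e2]
  rw [← Finset.sum_add_distrib]
  refine Finset.sum_congr rfl fun j _ => ?_
  rw [← Finset.sum_add_distrib]
  exact Finset.sum_congr rfl fun i _ => by ring

/-- Stability of the perturbed chain: a mass-zero vector is controlled by its net outflow. -/
lemma l2_le_l2_flow {π : Fin n → ℝ} (hπ : ∀ i, 0 < π i) {h R G b₁ b₂ : ℝ} (hh : 1 ≤ h)
    (hR : ∀ i, π i ≤ R) (hRh : ∀ i, R ≤ h * π i) (hG : 0 < G)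
    {A η : Fin n → Fin n → ℝ} (hrev : ∀ i j, π i * A i j = π j * A j i)
    (hη : ∀ i j, η j i = - η i j)
    (hgap : ∀ y : Fin n → ℝ, ∑ i, π i * y i = 0 →
      G * ∑ i, π i * y i ^ 2 ≤ (∑ i, ∑ j, π i * A i j * (y i - y j) ^ 2) / 2)
    (hb₁ : ∀ j, |∑ i, η j i| ≤ b₁)
    (hb₂ : ∀ z : Fin n → ℝ, |∑ i, ∑ j, z i * (η i j * ((π j - π i) / (√(π i) * √(π j)))) * z j| ≤
      b₂ * ∑ i, z i ^ 2)
    (hb : b₁ + b₂ / 2 ≤ G / 2) {u : Fin n → ℝ} (hu : ∑ i, u i = 0) :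
    l2 u ≤ 2 * h / G * l2 (flow (fun i j => A i j + η i j) u) := by
  rcases Nat.eq_zero_or_pos n with hn | hn
  · subst hn
    simp [l2]
  have hR0 : 0 < R := (hπ ⟨0, hn⟩).trans_le (hR _)
  have hh0 : 0 < h := by linarith
  set y : Fin n → ℝ := fun i => u i / π i with hy
  have huy : u = fun i => π i * y i := by
    ext i; rw [hy]; field_simp [(hπ i).ne']
  set F := flow (fun i j => A i j + η i j) u with hF
  set X := ∑ i, π i * y i ^ 2 with hX
  have hX0 : 0 ≤ X := Finset.sum_nonneg fun i _ => mul_nonneg (hπ i).le (sq_nonneg _)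
  -- The Dirichlet form supplies G X, and the two noise terms cost at most (b₁ + b₂/2) X, which is
  -- half of it.
  have hlow : G / 2 * X ≤ ∑ j, F j * y j := by
    have e : ∑ j, F j * y j = ∑ j, flow A (fun i => π i * y i) j * y j +
        ∑ j, flow η (fun i => π i * y i) j * y j := by
      rw [hF, flow_add_rates, ← huy, ← Finset.sum_add_distrib]
      exact Finset.sum_congr rfl fun j _ => by rw [Pi.add_apply]; ring
    rw [e, sum_flow_mul_of_reversible hrev, sum_flow_mul_of_antisymm hπ hη]
    have h1 := hgap y (by rw [← hu, huy])
    have h2 := (abs_le.mp (hb₂ (fun i => √(π i) * y i))).1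
    have h3 : ∑ i, (√(π i) * y i) ^ 2 = X := by
      refine Finset.sum_congr rfl fun i _ => ?_
      rw [mul_pow, Real.sq_sqrt (hπ i).le]
    rw [h3] at h2
    have h4 : -(b₁ * X) ≤ ∑ j, π j * y j ^ 2 * ∑ i, η j i := by
      rw [hX, Finset.mul_sum, ← Finset.sum_neg_distrib]
      refine Finset.sum_le_sum fun j _ => ?_
      have h5 := (abs_le.mp (hb₁ j)).1
      have h6 := mul_le_mul_of_nonneg_left h5 (mul_nonneg (hπ j).le (sq_nonneg (y j)))
      linarith
    have h7 := mul_le_mul_of_nonneg_right hb hX0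
    linarith
  have hCS : ∑ j, F j * y j ≤ l2 F * l2 y := sum_mul_le_l2 F y
  have hyX : R / h * l2 y ^ 2 ≤ X := by
    rw [l2_sq, Finset.mul_sum]
    refine Finset.sum_le_sum fun i _ => mul_le_mul_of_nonneg_right ?_ (sq_nonneg _)
    rw [div_le_iff₀ hh0, mul_comm]
    exact hRh i
  have huX : l2 u ≤ R * l2 y := by
    refine l2_le_of_sq_le (mul_nonneg hR0.le (l2_nonneg y)) ?_
    rw [mul_pow, l2_sq, Finset.mul_sum]
    refine Finset.sum_le_sum fun i _ => ?_
    rw [huy, mul_pow]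
    exact mul_le_mul_of_nonneg_right (pow_le_pow_left₀ (hπ i).le (hR i) 2) (sq_nonneg _)
  have hfin : R * l2 y ≤ 2 * h / G * l2 F := by
    rcases eq_or_lt_of_le (l2_nonneg y) with hz | hpos
    · rw [← hz, mul_zero]
      exact mul_nonneg (by positivity) (l2_nonneg F)
    · have h1 : G / 2 * (R / h * l2 y ^ 2) ≤ l2 F * l2 y :=
        (mul_le_mul_of_nonneg_left hyX (by positivity)).trans (hlow.trans hCS)
      have h2 : G / 2 * (R / h * l2 y) ≤ l2 F := by
        refine le_of_mul_le_mul_right ?_ hpos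
        calc _ = G / 2 * (R / h * l2 y ^ 2) := by ring
          _ ≤ _ := h1
      calc R * l2 y = 2 * h / G * (G / 2 * (R / h * l2 y)) := by field_simp
        _ ≤ _ := mul_le_mul_of_nonneg_left h2 (by positivity)
  exact huX.trans hfin

end Flow

/-! ### The deterministic leave-one-out analysis -/

section LeaveOneOut

variable {n : ℕ}

lemma btlProb_nonneg {π : Fin n → ℝ} (hπ : ∀ i, 0 < π i) (i j : Fin n) : 0 ≤ btlProb π i j :=
  (div_pos (hπ j) (add_pos (hπ i) (hπ j))).le

lemma btlProb_add {π : Fin n → ℝ} (hπ : ∀ i, 0 < π i) (i j : Fin n) :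
    btlProb π i j + btlProb π j i = 1 := by
  have := add_pos (hπ i) (hπ j)
  unfold btlProb
  rw [add_comm (π j) (π i), ← add_div, add_comm (π j) (π i), div_self this.ne']

/-- A deterministic realization of the comparison model: scores `π`, edge probabilities `q`, edge
indicators `x` and empirical probabilities `P`. -/
structure IsRealization (π : Fin n → ℝ) (q x P : Fin n → Fin n → ℝ) (h R : ℝ) : Prop where
  one_le_h : 1 ≤ h
  score_pos : ∀ i, 0 < π i
  score_le : ∀ i, π i ≤ R
  le_score : ∀ i, R ≤ h * π i
  sum_score : ∑ i, π i = 1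
  q_symm : ∀ i j, q i j = q j i
  q_diag : ∀ i, q i i = 0
  q_pos : ∀ i j, i ≠ j → 0 < q i j
  q_le : ∀ i j, q i j ≤ 1
  x_symm : ∀ i j, x i j = x j i
  x_diag : ∀ i, x i i = 0
  x_zero_or_one : ∀ i j, x i j = 0 ∨ x i j = 1
  P_nonneg : ∀ i j, 0 ≤ P i j
  P_add : ∀ i j, i ≠ j → P i j + P j i = 1

/-- Rates that agree with `B` on the pairs containing `m` and with `A` on the other pairs. -/
def looRates (A B : Fin n → Fin n → ℝ) (m i j : Fin n) : ℝ :=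
  if i = m ∨ j = m then B i j else A i j

/-- The leave-one-out score vector. -/
def looScore (π : Fin n → ℝ) (q x P : Fin n → Fin n → ℝ) (m : Fin n) : Fin n → ℝ :=
  nullVec (looRates (fun i j => x i j * P i j) (fun i j => q i j * btlProb π i j) m)

namespace IsRealization

variable {π : Fin n → ℝ} {q x P : Fin n → Fin n → ℝ} {h R : ℝ}

lemma h_pos (S : IsRealization π q x P h R) : 0 < h := lt_of_lt_of_le one_pos S.one_le_h

lemma q_nonneg (S : IsRealization π q x P h R) (i j : Fin n) : 0 ≤ q i j := by
  by_cases hij : i = j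
  · rw [hij, S.q_diag]
  · exact (S.q_pos i j hij).le

lemma x_nonneg (S : IsRealization π q x P h R) (i j : Fin n) : 0 ≤ x i j := by
  rcases S.x_zero_or_one i j with h | h <;> rw [h]; norm_num

lemma x_sq (S : IsRealization π q x P h R) (i j : Fin n) : x i j ^ 2 = x i j := by
  rcases S.x_zero_or_one i j with h | h <;> rw [h] <;> norm_num

lemma btl_pos (S : IsRealization π q x P h R) (i j : Fin n) : 0 < btlProb π i j :=
  div_pos (S.score_pos j) (add_pos (S.score_pos i) (S.score_pos j))

lemma btl_add (S : IsRealization π q x P h R) (i j : Fin n) :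
    btlProb π i j + btlProb π j i = 1 := btlProb_add S.score_pos i j

lemma btl_rev (_S : IsRealization π q x P h R) (i j : Fin n) :
    π i * btlProb π i j = π j * btlProb π j i := by
  unfold btlProb
  rw [add_comm (π j) (π i), ← mul_div_assoc, ← mul_div_assoc, mul_comm]

lemma le_btl (S : IsRealization π q x P h R) (i j : Fin n) : 1 ≤ (1 + h) * btlProb π i j := by
  have h1 := add_pos (S.score_pos i) (S.score_pos j)
  unfold btlProb
  rw [mul_div_assoc', le_div_iff₀ h1]
  have := (S.score_le i).trans (S.le_score j)
  linarith

lemma btl_le_one (S : IsRealization π q x P h R) (i j : Fin n) : btlProb π i j ≤ 1 := by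
  linarith [S.btl_add i j, S.btl_pos j i]

lemma noise_antisymm (S : IsRealization π q x P h R) (i j : Fin n) :
    x j i * (P j i - btlProb π j i) = -(x i j * (P i j - btlProb π i j)) := by
  by_cases hij : i = j
  · rw [hij, S.x_diag]; simp
  · rw [S.x_symm j i]
    have h1 := S.P_add i j hij
    have h2 := S.btl_add i j
    have : P j i - btlProb π j i = -(P i j - btlProb π i j) := by linarith
    rw [this]; ring

/-- The averaged rates at m are positive towards every other item, so the null vector exists whether
or not the observed graph is connected. -/
lemma looScore_spec (S : IsRealization π q x P h R) (m : Fin n) :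
    ∑ i, looScore π q x P m i = 1 ∧
      flow (looRates (fun i j => x i j * P i j) (fun i j => q i j * btlProb π i j) m)
        (looScore π q x P m) = 0 := by
  refine nullVec_spec (exists_flow_eq_zero (Fin.pos m) fun u hu hf =>
    eq_zero_of_flow_eq_zero_of_star ?_ m ?_ hu hf)
  · intro i j
    unfold looRates
    split_ifs
    · exact mul_nonneg (S.q_nonneg i j) (S.btl_pos i j).le
    · exact mul_nonneg (S.x_nonneg i j) (S.P_nonneg i j)
  · intro i hi
    simp only [looRates, or_true, if_true]
    exact mul_pos (S.q_pos i m hi) (S.btl_pos i m)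

/-- The entry at `m` of the leave-one-out error is controlled by its Euclidean norm. -/
lemma abs_looScore_sub_le (S : IsRealization π q x P h R) (m : Fin n) {s : ℝ} (hn : 2 ≤ n)
    (hs : 0 ≤ s) (hq : (n : ℝ) * ∑ j, q m j ^ 2 ≤ s * (∑ j, q m j) ^ 2) :
    |(looScore π q x P m - π) m| ≤ (1 + h) * √(s / n) * l2 (looScore π q x P m - π) := by
  set e := looScore π q x P m - π with he
  have hnpos : (0 : ℝ) < n := by exact_mod_cast (by omega : 0 < n)
  have hD : 0 < ∑ j, q m j := by
    have : ∃ j : Fin n, m ≠ j := by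
      by_contra! hall
      have : Fintype.card (Fin n) ≤ 1 := Fintype.card_le_one_iff.mpr fun a b =>
        (hall a).symm.trans (hall b)
      rw [Fintype.card_fin] at this; omega
    obtain ⟨j, hj⟩ := this
    exact Finset.sum_pos' (fun i _ => S.q_nonneg m i) ⟨j, Finset.mem_univ j, S.q_pos m j hj⟩
  -- At m all rates are the averaged ones, for which π is in detailed balance; so both the
  -- leave-one-out vector and π have no outflow at m, and neither does their difference.
  have hflow : ∑ i, (e m * (q m i * btlProb π m i) - e i * (q i m * btlProb π i m)) = 0 := by
    have h1 := congrFun (S.looScore_spec m).2 m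
    have h2 : flow (looRates (fun i j => x i j * P i j) (fun i j => q i j * btlProb π i j) m) π m
        = 0 := by
      refine flow_eq_zero_of_detailed_balance fun i => ?_
      simp only [looRates, true_or, or_true, if_true]
      have := S.btl_rev m i
      rw [S.q_symm m i]
      linear_combination (q i m) * this
    have h3 := congrFun (flow_sub (looRates (fun i j => x i j * P i j)
      (fun i j => q i j * btlProb π i j) m) (looScore π q x P m) π) m
    rw [Pi.sub_apply, h1, h2, Pi.zero_apply, sub_self] at h3
    rw [← h3]
    simp only [flow, looRates, true_or, or_true, if_true, ← he]
  have h1 : |e m| * ∑ i, q m i * btlProb π m i ≤ ∑ i, |e i| * q m i := by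
    have e1 : e m * ∑ i, q m i * btlProb π m i = ∑ i, e i * (q i m * btlProb π i m) := by
      rw [Finset.sum_sub_distrib, ← Finset.mul_sum] at hflow
      linarith
    have e2 : 0 ≤ ∑ i, q m i * btlProb π m i :=
      Finset.sum_nonneg fun i _ => mul_nonneg (S.q_nonneg _ _) (S.btl_pos _ _).le
    rw [← abs_of_nonneg e2, ← abs_mul, e1]
    refine (Finset.abs_sum_le_sum_abs _ _).trans (Finset.sum_le_sum fun i _ => ?_)
    rw [abs_mul, abs_of_nonneg (mul_nonneg (S.q_nonneg _ _) (S.btl_pos _ _).le), S.q_symm i m]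
    exact mul_le_mul_of_nonneg_left (mul_le_of_le_one_right (S.q_nonneg _ _) (S.btl_le_one _ _))
      (abs_nonneg _)
  have h2 : ∑ i, q m i ≤ (1 + h) * ∑ i, q m i * btlProb π m i := by
    rw [Finset.mul_sum]
    refine Finset.sum_le_sum fun i _ => ?_
    have := mul_le_mul_of_nonneg_left (S.le_btl m i) (S.q_nonneg m i)
    linarith
  have h3 : ∑ i, |e i| * q m i ≤ l2 e * (√(s / n) * ∑ j, q m j) := by
    refine (sum_mul_le_l2 (fun i => |e i|) (q m)).trans ?_
    have e1 : l2 (fun i => |e i|) = l2 e := by simp [l2]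
    rw [e1]
    refine mul_le_mul_of_nonneg_left (l2_le_of_sq_le (by positivity) ?_) (l2_nonneg e)
    rw [mul_pow, Real.sq_sqrt (by positivity), div_mul_eq_mul_div, le_div_iff₀ hnpos]
    linarith
  refine le_of_mul_le_mul_right ?_ hD
  calc |e m| * ∑ j, q m j ≤ |e m| * ((1 + h) * ∑ i, q m i * btlProb π m i) :=
        mul_le_mul_of_nonneg_left h2 (abs_nonneg _)
    _ = (1 + h) * (|e m| * ∑ i, q m i * btlProb π m i) := by ring
    _ ≤ (1 + h) * (l2 e * (√(s / n) * ∑ j, q m j)) :=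
        mul_le_mul_of_nonneg_left (h1.trans h3) (by linarith [S.one_le_h])
    _ = _ := by ring

lemma R_pos (S : IsRealization π q x P h R) (m : Fin n) : 0 < R :=
  (S.score_pos m).trans_le (S.score_le m)

/-- The difference between the empirical rates and the leave-one-out rates. -/
lemma flow_diff_apply_of_ne (m : Fin n) (A B : Fin n → Fin n → ℝ) (u : Fin n → ℝ)
    {j : Fin n} (hj : j ≠ m) :
    flow (fun i l => A i l - looRates A B m i l) u j =
      u j * (A j m - B j m) - u m * (A m j - B m j) := by
  rw [flow, Finset.sum_eq_single_of_mem m (Finset.mem_univ m)]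
  · simp [looRates]
  · intro i _ hi
    simp [looRates, hi, hj]

lemma flow_diff_apply_self (m : Fin n) (A B : Fin n → Fin n → ℝ) (u : Fin n → ℝ) :
    flow (fun i l => A i l - looRates A B m i l) u m =
      ∑ i, (u m * (A m i - B m i) - u i * (A i m - B i m)) := by
  simp [flow, looRates]

/-- Applied to π, the edge fluctuations x − q cancel by detailed balance, and only comparison noise
of order k^(−1/2) remains. The coordinate m carries a full noise sum, and each neighbour of m a
single noise term. Each group contributes 64 R² L d/k to the squared norm, and 64 + 64 ≤ 12². -/
lemma l2_flow_diff_score_le (S : IsRealization π q x P h R) (m : Fin n) {d L k : ℝ}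
    (hL : 0 ≤ L) (hk : 0 < k) (hd0 : 0 ≤ d) (hd : ∑ j, x m j ≤ d)
    (h2 : |∑ j, x m j * (P m j - btlProb π m j) * (π m + π j)| ≤ 8 * R * √(L * d / k))
    (h3 : ∀ j, |x m j * (P m j - btlProb π m j)| ≤ 4 * √(L / k)) :
    l2 (flow (fun i l => x i l * P i l - looRates (fun i j => x i j * P i j)
      (fun i j => q i j * btlProb π i j) m i l) π) ≤ 12 * R * √(L * d / k) := by
  have hR := (S.R_pos m).le
  refine l2_le_of_sq_le (by positivity) ?_
  rw [← Finset.add_sum_erase _ _ (Finset.mem_univ m)]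
  have e1 : flow (fun i l => x i l * P i l - looRates (fun i j => x i j * P i j)
      (fun i j => q i j * btlProb π i j) m i l) π m ^ 2 ≤ 64 * R ^ 2 * (L * d / k) := by
    rw [flow_diff_apply_self]
    have : ∑ i, (π m * (x m i * P m i - q m i * btlProb π m i) -
        π i * (x i m * P i m - q i m * btlProb π i m)) =
        ∑ j, x m j * (P m j - btlProb π m j) * (π m + π j) := by
      refine Finset.sum_congr rfl fun i _ => ?_
      have a1 := S.noise_antisymm m i
      have a2 := S.btl_rev m i
      rw [S.q_symm i m]
      have a3 := S.x_symm i m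
      rw [a3] at a1 ⊢
      linear_combination (-π i) * a1 + (x m i - q m i) * a2
    rw [this, ← sq_abs]
    calc _ ≤ (8 * R * √(L * d / k)) ^ 2 := pow_le_pow_left₀ (abs_nonneg _) h2 2
      _ = _ := by rw [mul_pow, Real.sq_sqrt (by positivity)]; ring
  have e2 : ∑ j ∈ Finset.univ.erase m, flow (fun i l => x i l * P i l -
      looRates (fun i j => x i j * P i j) (fun i j => q i j * btlProb π i j) m i l) π j ^ 2 ≤
      64 * R ^ 2 * (L * d / k) := by
    calc _ ≤ ∑ j ∈ Finset.univ.erase m, 64 * R ^ 2 * (L / k) * x m j := by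
          refine Finset.sum_le_sum fun j hj => ?_
          rw [flow_diff_apply_of_ne m _ _ _ (Finset.ne_of_mem_erase hj)]
          have a1 := S.noise_antisymm m j
          have a2 := S.btl_rev m j
          have a3 : π j * (x j m * P j m - q j m * btlProb π j m) -
              π m * (x m j * P m j - q m j * btlProb π m j) =
              -(x m j * (P m j - btlProb π m j) * (π m + π j)) := by
            rw [S.q_symm j m]
            have a3 := S.x_symm j m
            rw [a3] at a1 ⊢
            linear_combination (π j) * a1 - (x m j - q m j) * a2
          rw [a3, neg_sq]
          have a4 := pow_le_pow_left₀ (abs_nonneg _) (h3 j) 2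
          rw [sq_abs, mul_pow, mul_pow, S.x_sq, Real.sq_sqrt (by positivity)] at a4
          have a5 : (π m + π j) ^ 2 ≤ 4 * R ^ 2 := by
            have b1 := S.score_le m
            have b2 := S.score_le j
            have b3 := S.score_pos m
            have b4 := S.score_pos j
            nlinarith
          rcases S.x_zero_or_one m j with hx | hx
          · rw [hx]; simp
          · rw [hx] at a4 ⊢
            rw [one_mul] at a4 ⊢
            rw [mul_pow]
            calc _ ≤ 4 ^ 2 * (L / k) * (4 * R ^ 2) :=
                  mul_le_mul a4 a5 (sq_nonneg _) (by positivity)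
              _ = _ := by ring
      _ ≤ ∑ j, 64 * R ^ 2 * (L / k) * x m j :=
          Finset.sum_le_sum_of_subset_of_nonneg (Finset.subset_univ _)
            fun j _ _ => mul_nonneg (by positivity) (S.x_nonneg m j)
      _ = 64 * R ^ 2 * (L / k) * ∑ j, x m j := by rw [Finset.mul_sum]
      _ ≤ 64 * R ^ 2 * (L / k) * d := mul_le_mul_of_nonneg_left hd (by positivity)
      _ = _ := by ring
  rw [mul_pow, Real.sq_sqrt (by positivity)]
  have : 0 ≤ R ^ 2 * (L * d / k) := by positivity
  linarith

/-- There is no detailed balance for e, so the edge fluctuations stay and no factor k^(−1/2) is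
available. This is harmless, since the bound is proportional to E and will be absorbed. The
coordinate m contributes 256 L d E² and the others 6 d E², with 256 + 6 ≤ 17². -/
lemma l2_flow_diff_error_le (S : IsRealization π q x P h R) (m : Fin n) {d L E : ℝ}
    (hL : 1 ≤ L) (hE : 0 ≤ E) (hd : ∑ j, x m j ≤ d) (hD : ∑ j, q m j ≤ 2 * d)
    (e : Fin n → ℝ) (he : ∀ i, |e i| ≤ E)
    (h4 : |∑ j, (x m j - q m j) * (e m * btlProb π m j - e j * btlProb π j m)| ≤
      8 * √(L * d) * E)
    (h5 : |∑ j, x m j * (P m j - btlProb π m j) * (e m + e j)| ≤ 8 * √(L * d) * E) :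
    l2 (flow (fun i l => x i l * P i l - looRates (fun i j => x i j * P i j)
      (fun i j => q i j * btlProb π i j) m i l) e) ≤ 17 * √(L * d) * E := by
  have hd0 : 0 ≤ d := le_trans (Finset.sum_nonneg fun j _ => S.x_nonneg m j) hd
  refine l2_le_of_sq_le (by positivity) ?_
  rw [← Finset.add_sum_erase _ _ (Finset.mem_univ m)]
  have e1 : flow (fun i l => x i l * P i l - looRates (fun i j => x i j * P i j)
      (fun i j => q i j * btlProb π i j) m i l) e m ^ 2 ≤ 256 * (L * d) * E ^ 2 := by
    rw [flow_diff_apply_self]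
    have : ∑ i, (e m * (x m i * P m i - q m i * btlProb π m i) -
        e i * (x i m * P i m - q i m * btlProb π i m)) =
        ∑ j, (x m j - q m j) * (e m * btlProb π m j - e j * btlProb π j m) +
        ∑ j, x m j * (P m j - btlProb π m j) * (e m + e j) := by
      rw [← Finset.sum_add_distrib]
      refine Finset.sum_congr rfl fun i _ => ?_
      have a1 := S.noise_antisymm m i
      rw [S.q_symm i m]
      have a3 := S.x_symm i m
      rw [a3] at a1 ⊢
      linear_combination (-e i) * a1
    rw [this, ← sq_abs]
    have h6 := (abs_add_le _ _).trans (add_le_add h4 h5)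
    calc _ ≤ (8 * √(L * d) * E + 8 * √(L * d) * E) ^ 2 := pow_le_pow_left₀ (abs_nonneg _) h6 2
      _ = 256 * (√(L * d) ^ 2) * E ^ 2 := by ring
      _ = _ := by rw [Real.sq_sqrt (by positivity)]
  have e2 : ∑ j ∈ Finset.univ.erase m, flow (fun i l => x i l * P i l -
      looRates (fun i j => x i j * P i j) (fun i j => q i j * btlProb π i j) m i l) e j ^ 2 ≤
      6 * d * E ^ 2 := by
    calc _ ≤ ∑ j ∈ Finset.univ.erase m, 2 * E ^ 2 * (x m j + q m j) := by
          refine Finset.sum_le_sum fun j hj => ?_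
          have hjm := Finset.ne_of_mem_erase hj
          rw [flow_diff_apply_of_ne m _ _ _ hjm]
          have hx0 := S.x_nonneg m j
          have hq0 := S.q_nonneg m j
          have hb : ∀ i l, |x i l * P i l - q i l * btlProb π i l| ≤
              x i l * P i l + q i l * btlProb π i l := by
            intro i l
            have b1 := mul_nonneg (S.x_nonneg i l) (S.P_nonneg i l)
            have b2 := mul_nonneg (S.q_nonneg i l) (S.btl_pos i l).le
            rw [abs_le]; constructor <;> linarith
          have a1 : |e j * (x j m * P j m - q j m * btlProb π j m) -
              e m * (x m j * P m j - q m j * btlProb π m j)| ≤ E * (x m j + q m j) := by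
            refine (abs_sub _ _).trans ?_
            rw [abs_mul, abs_mul]
            have c1 := mul_le_mul (he j) (hb j m) (abs_nonneg _) hE
            have c2 := mul_le_mul (he m) (hb m j) (abs_nonneg _) hE
            rw [S.x_symm j m, S.q_symm j m] at c1 ⊢
            have c3 := S.P_add m j hjm.symm
            have c4 := S.btl_add m j
            calc _ ≤ E * (x m j * P j m + q m j * btlProb π j m) +
                  E * (x m j * P m j + q m j * btlProb π m j) := add_le_add c1 c2
              _ = E * (x m j * (P m j + P j m) + q m j * (btlProb π m j + btlProb π j m)) := by
                ring
              _ = _ := by rw [c3, c4, mul_one, mul_one]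
          rw [← sq_abs]
          refine (pow_le_pow_left₀ (abs_nonneg _) a1 2).trans ?_
          rw [mul_pow]
          have a2 : (x m j + q m j) ^ 2 ≤ 2 * (x m j + q m j) := by
            have b1 := S.x_sq m j
            have b2 := S.q_le m j
            nlinarith [sq_nonneg (x m j - q m j), mul_nonneg hq0 (sub_nonneg.mpr b2)]
          have := mul_le_mul_of_nonneg_left a2 (sq_nonneg E)
          linarith
      _ ≤ ∑ j, 2 * E ^ 2 * (x m j + q m j) :=
          Finset.sum_le_sum_of_subset_of_nonneg (Finset.subset_univ _)
            fun j _ _ => mul_nonneg (by positivity) (add_nonneg (S.x_nonneg m j) (S.q_nonneg m j))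
      _ = 2 * E ^ 2 * (∑ j, x m j + ∑ j, q m j) := by
          rw [← Finset.mul_sum, Finset.sum_add_distrib]
      _ ≤ 2 * E ^ 2 * (d + 2 * d) := mul_le_mul_of_nonneg_left (add_le_add hd hD) (by positivity)
      _ = _ := by ring
  rw [mul_pow, mul_pow, Real.sq_sqrt (by positivity)]
  have h6 : d * E ^ 2 ≤ L * d * E ^ 2 :=
    mul_le_mul_of_nonneg_right (le_mul_of_one_le_left hd0 hL) (sq_nonneg _)
  have : 0 ≤ L * d * E ^ 2 := by positivity
  nlinarith

/-- The deterministic core of the leave-one-out analysis. -/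
lemma norm_sub_score_le (S : IsRealization π q x P h R) {γ s d L k b₂ : ℝ} (hn : 2 ≤ n)
    (hs : 0 ≤ s) (hγ : 0 < γ) (hd : 0 < d) (hL : 1 ≤ L) (hk : 1 ≤ k)
    (hns : (1 + h) ^ 2 * s ≤ n)
    (hq : ∀ m, (n : ℝ) * ∑ j, q m j ^ 2 ≤ s * (∑ j, q m j) ^ 2)
    (hdeg : ∀ m, ∑ j, x m j ≤ d) (hD : ∀ m, ∑ j, q m j ≤ 2 * d)
    (hgap : ∀ y : Fin n → ℝ, ∑ i, π i * y i = 0 → γ * d * ∑ i, π i * y i ^ 2 ≤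
      (∑ i, ∑ j, π i * (x i j * btlProb π i j) * (y i - y j) ^ 2) / 2)
    (h1 : ∀ m, |∑ j, x m j * (P m j - btlProb π m j)| ≤ 4 * √(L * d))
    (h2 : ∀ m, |∑ j, x m j * (P m j - btlProb π m j) * (π m + π j)| ≤ 8 * R * √(L * d / k))
    (h3 : ∀ m j, |x m j * (P m j - btlProb π m j)| ≤ 4 * √(L / k))
    (h4 : ∀ m, |∑ j, (x m j - q m j) * ((looScore π q x P m - π) m * btlProb π m j -
      (looScore π q x P m - π) j * btlProb π j m)| ≤ 8 * √(L * d) * ‖looScore π q x P m - π‖)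
    (h5 : ∀ m, |∑ j, x m j * (P m j - btlProb π m j) *
      ((looScore π q x P m - π) m + (looScore π q x P m - π) j)| ≤
        8 * √(L * d) * ‖looScore π q x P m - π‖)
    (h6 : ∀ z : Fin n → ℝ, |∑ i, ∑ j, z i * (x i j * (P i j - btlProb π i j) *
      ((π j - π i) / (√(π i) * √(π j)))) * z j| ≤ b₂ * ∑ i, z i ^ 2)
    (hb : 4 * √(L * d) + b₂ / 2 ≤ γ * d / 2) (hsmall : 34 * h * √(L / d) ≤ γ / 8) :
    ∃ v : Fin n → ℝ, (∀ w : Fin n → ℝ, (∑ i, w i = 1 ∧ flow (fun i j => x i j * P i j) w = 0) ↔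
      w = v) ∧ ‖v - π‖ ≤ (32 * (1 + h) * h * √s + 128 * h) / γ * R * √(L / (d * k)) := by
  have hn0 : 0 < n := by omega
  have hnpos : (0 : ℝ) < n := by exact_mod_cast hn0
  have hh := S.h_pos
  have hR := S.R_pos ⟨0, hn0⟩
  have hstab : ∀ u : Fin n → ℝ, ∑ i, u i = 0 →
      l2 u ≤ 2 * h / (γ * d) * l2 (flow (fun i j => x i j * P i j) u) := by
    intro u hu
    have := l2_le_l2_flow S.score_pos S.one_le_h S.score_le S.le_score (mul_pos hγ hd)
      (A := fun i j => x i j * btlProb π i j) (η := fun i j => x i j * (P i j - btlProb π i j))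
      (fun i j => by
        rw [S.x_symm j i]
        linear_combination (x i j) * S.btl_rev i j)
      (fun i j => S.noise_antisymm i j) hgap h1 h6 hb hu
    have e : (fun i j => x i j * btlProb π i j + x i j * (P i j - btlProb π i j)) =
        (fun i j => x i j * P i j) := by
      ext i j; ring
    rwa [e] at this
  have hinj : ∀ u : Fin n → ℝ, ∑ i, u i = 0 → flow (fun i j => x i j * P i j) u = 0 → u = 0 := by
    intro u hu hf
    have h7 := hstab u hu
    rw [hf] at h7
    have h8 : l2 (0 : Fin n → ℝ) = 0 := by simp [l2]
    rw [h8, mul_zero] at h7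
    ext i
    exact abs_nonpos_iff.mp ((abs_le_l2 u i).trans h7)
  obtain ⟨v, hv1, hv2⟩ := exists_flow_eq_zero hn0 hinj
  refine ⟨v, fun w => ⟨fun ⟨hw1, hw2⟩ => ?_, fun hw => hw ▸ ⟨hv1, hv2⟩⟩, ?_⟩
  · refine sub_eq_zero.mp (hinj (w - v) ?_ ?_)
    · simp [Finset.sum_sub_distrib, hw1, hv1]
    · rw [flow_sub, hw2, hv2, sub_zero]
  set δ := ‖v - π‖ with hδ
  set η := √(L / (d * k)) with hη
  have hk0 : 0 < k := by linarith
  have hL0 : 0 < L := by linarith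
  have hη1 : √(L * d / k) = d * η := by
    rw [hη, Real.sqrt_eq_iff_mul_self_eq (by positivity) (by positivity),
      mul_mul_mul_comm, Real.mul_self_sqrt (by positivity)]
    field_simp
  have hε1 : √(L * d) = d * √(L / d) := by
    rw [Real.sqrt_eq_iff_mul_self_eq (by positivity) (by positivity),
      mul_mul_mul_comm, Real.mul_self_sqrt (by positivity)]
    field_simp
  have hη0 : 0 ≤ η := Real.sqrt_nonneg _
  -- Since v has no outflow, the outflow of v − π is minus that of π, which consists of comparison
  -- noise alone.
  have hl2 : l2 (v - π) ≤ 16 * h / γ * √n * R * η := by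
    have a1 := hstab (v - π) (by simp [Finset.sum_sub_distrib, hv1, S.sum_score])
    have a2 : l2 (flow (fun i j => x i j * P i j) (v - π)) ≤ √n * (8 * R * (d * η)) := by
      refine l2_le_of_sq_le (by positivity) ?_
      rw [mul_pow, Real.sq_sqrt hnpos.le, flow_sub, hv2, zero_sub]
      calc ∑ i, (-flow (fun i j => x i j * P i j) π) i ^ 2
          ≤ ∑ _i : Fin n, (8 * R * (d * η)) ^ 2 := by
            refine Finset.sum_le_sum fun m _ => ?_
            rw [Pi.neg_apply, neg_sq, ← sq_abs]
            refine pow_le_pow_left₀ (abs_nonneg _) ?_ 2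
            rw [← hη1]
            refine le_trans (le_of_eq ?_) (h2 m)
            congr 1
            refine Finset.sum_congr rfl fun i _ => ?_
            have b1 := S.noise_antisymm m i
            have b2 := S.btl_rev m i
            have b3 := S.x_symm i m
            beta_reduce
            rw [b3] at b1 ⊢
            linear_combination (-π i) * b1 + (x m i) * b2
        _ = _ := by
            rw [Finset.sum_const, Finset.card_univ, Fintype.card_fin, nsmul_eq_mul]
    refine a1.trans ((mul_le_mul_of_nonneg_left a2 (by positivity)).trans (le_of_eq ?_))
    field_simp
    ring
  -- With K = (h/γ) R η, the bounds ‖f‖₂ ≤ 24K + ‖e‖/8 and ‖e‖ ≤ δ + ‖f‖₂ give ‖f‖₂ ≤ (192K + δ)/7.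
  -- It is used twice, in f_m and in the bound for e_m, which explains 2/7 δ and 384/7 ≤ 64.
  have hpt : ∀ m, |(v - π) m| ≤
      (16 * (1 + h) * h * √s + 64 * h) / γ * R * η + 2 / 7 * δ := by
    intro m
    set e := looScore π q x P m - π with he
    set f := v - looScore π q x P m with hf
    have hfe : v - π = f + e := by rw [hf, he]; abel
    have hfsum : ∑ i, f i = 0 := by
      simp [hf, Finset.sum_sub_distrib, hv1, (S.looScore_spec m).1]
    have hE : ‖e‖ ≤ δ + l2 f := by
      have c1 : ‖f‖ ≤ l2 f := (pi_norm_le_iff_of_nonneg (l2_nonneg f)).mpr fun i => by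
        rw [Real.norm_eq_abs]; exact abs_le_l2 f i
      have c2 : e = (v - π) - f := by rw [hfe]; abel
      rw [c2]
      exact (norm_sub_le _ _).trans (add_le_add le_rfl c1)
    -- Both v and π + e are null vectors of their own rates, so the outflow of f is minus the change
    -- of rates applied to π + e.
    have hflowf : flow (fun i j => x i j * P i j) f =
        -(flow (fun i l => x i l * P i l - looRates (fun i j => x i j * P i j)
          (fun i j => q i j * btlProb π i j) m i l) π +
          flow (fun i l => x i l * P i l - looRates (fun i j => x i j * P i j)
          (fun i j => q i j * btlProb π i j) m i l) e) := by
      rw [← flow_add, he, add_sub_cancel, flow_sub_rates, (S.looScore_spec m).2, hf, flow_sub, hv2]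
      abel
    have hF : l2 (flow (fun i j => x i j * P i j) f) ≤
        12 * R * (d * η) + 17 * (d * √(L / d)) * ‖e‖ := by
      rw [hflowf, l2_neg, ← hη1, ← hε1]
      refine (l2_add_le _ _).trans (add_le_add ?_ ?_)
      · exact S.l2_flow_diff_score_le m hL0.le hk0 hd.le (hdeg m) (h2 m) (h3 m)
      · exact S.l2_flow_diff_error_le m hL (norm_nonneg e) (hdeg m) (hD m) e
          (fun i => norm_le_pi_norm e i) (h4 m) (h5 m)
    have hf1 : l2 f ≤ 24 * h / γ * R * η + 1 / 8 * ‖e‖ := by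
      refine (hstab f hfsum).trans ((mul_le_mul_of_nonneg_left hF (by positivity)).trans ?_)
      have c1 : 2 * h / (γ * d) * (12 * R * (d * η) + 17 * (d * √(L / d)) * ‖e‖) =
          24 * h / γ * R * η + (34 * h * √(L / d)) / γ * ‖e‖ := by
        field_simp
        ring
      rw [c1]
      refine add_le_add le_rfl (mul_le_mul_of_nonneg_right ?_ (norm_nonneg e))
      rw [div_le_iff₀ hγ]; linarith
    have hem := S.abs_looScore_sub_le m hn hs (hq m)
    rw [← he] at hem
    have hle : l2 e ≤ 16 * h / γ * √n * R * η + l2 f := by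
      have c2 : e = (v - π) + -f := by rw [hfe]; abel
      calc l2 e = l2 ((v - π) + -f) := by rw [← c2]
        _ ≤ l2 (v - π) + l2 (-f) := l2_add_le _ _
        _ ≤ _ := by rw [l2_neg]; exact add_le_add hl2 le_rfl
    have hsn : √(s / n) * √n = √s := by
      rw [← Real.sqrt_mul (by positivity), div_mul_cancel₀ _ hnpos.ne']
    have hsn1 : (1 + h) * √(s / n) ≤ 1 := by
      have : √(s / n) ≤ 1 / (1 + h) := by
        rw [Real.sqrt_le_left (by positivity), div_pow, one_pow, div_le_div_iff₀ hnpos (by positivity)]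
        linarith
      calc _ ≤ (1 + h) * (1 / (1 + h)) := mul_le_mul_of_nonneg_left this (by positivity)
        _ = 1 := by field_simp
    have hem2 : |e m| ≤ 16 * (1 + h) * h * √s / γ * R * η + l2 f := by
      calc |e m| ≤ (1 + h) * √(s / n) * (16 * h / γ * √n * R * η + l2 f) :=
            hem.trans (mul_le_mul_of_nonneg_left hle (by positivity))
        _ = (1 + h) * (√(s / n) * √n) * (16 * h / γ * R * η) + (1 + h) * √(s / n) * l2 f := by ring
        _ ≤ (1 + h) * (√(s / n) * √n) * (16 * h / γ * R * η) + 1 * l2 f :=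
            add_le_add le_rfl (mul_le_mul_of_nonneg_right hsn1 (l2_nonneg f))
        _ = _ := by rw [hsn]; ring
    have hvm : |(v - π) m| ≤ l2 f + |e m| := by
      rw [hfe, Pi.add_apply]
      exact (abs_add_le _ _).trans (add_le_add (abs_le_l2 f m) le_rfl)
    have hK : 0 ≤ h / γ * R * η := by positivity
    have c3 : (16 * (1 + h) * h * √s + 64 * h) / γ * R * η =
        16 * (1 + h) * h * √s / γ * R * η + 64 * (h / γ * R * η) := by ring
    have c4 : 24 * h / γ * R * η = 24 * (h / γ * R * η) := by ring
    rw [c4] at hf1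
    rw [c3]
    linarith
  have hK0 : 0 ≤ (16 * (1 + h) * h * √s + 64 * h) / γ * R * η := by positivity
  have hδ0 : 0 ≤ δ := norm_nonneg _
  have hfin : δ ≤ (16 * (1 + h) * h * √s + 64 * h) / γ * R * η + 2 / 7 * δ :=
    (pi_norm_le_iff_of_nonneg (by positivity)).mpr fun m => by
      rw [Real.norm_eq_abs]; exact hpt m
  have c5 : (32 * (1 + h) * h * √s + 128 * h) / γ * R * η =
      2 * ((16 * (1 + h) * h * √s + 64 * h) / γ * R * η) := by ring
  rw [c5]
  linarith

end IsRealization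

end LeaveOneOut

/-! ### The random graph and the comparisons as functions of Boolean variables -/

section Model

variable {n k : ℕ}

open Classical in
/-- The indicator of the edge `i j` of the graph `G`. -/
def edgeInd (G : SimpleGraph (Fin n)) (i j : Fin n) : ℝ := if G.Adj i j then 1 else 0

open Classical in
lemma sum_neighborFinset_eq (G : SimpleGraph (Fin n)) (i : Fin n) (f : Fin n → ℝ) :
    ∑ l ∈ G.neighborFinset i, f l = ∑ l, edgeInd G i l * f l := by
  simp only [edgeInd, ite_mul, one_mul, zero_mul]
  rw [← Finset.sum_filter]
  congr 1
  ext l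
  simp

open Classical in
lemma sum_edgeInd_eq_degree (G : SimpleGraph (Fin n)) (i : Fin n) :
    ∑ l, edgeInd G i l = G.degree i := by
  have := sum_neighborFinset_eq G i (fun _ => 1)
  simp only [mul_one, Finset.sum_const, nsmul_eq_mul, G.card_neighborFinset_eq_degree] at this
  exact this.symm

open Classical in
lemma sum_edgeInd_le_maxDegree (G : SimpleGraph (Fin n)) (i : Fin n) :
    ∑ l, edgeInd G i l ≤ G.maxDegree := by
  rw [sum_edgeInd_eq_degree]
  exact_mod_cast G.degree_le_maxDegree i

open Classical in
lemma rankMatrix_apply_of_ne (G : SimpleGraph (Fin n)) (P : Fin n → Fin n → ℝ) {i j : Fin n}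
    (hij : i ≠ j) : rankMatrix G P i j = edgeInd G i j * P i j / G.maxDegree := by
  simp only [rankMatrix, Matrix.of_apply, if_neg hij, edgeInd]
  split_ifs <;> simp

open Classical in
lemma rankMatrix_apply_self (G : SimpleGraph (Fin n)) (P : Fin n → Fin n → ℝ) (i : Fin n) :
    rankMatrix G P i i = 1 - (∑ l, edgeInd G i l * P i l) / G.maxDegree := by
  simp only [rankMatrix, Matrix.of_apply, if_true]
  rw [sum_neighborFinset_eq]
  ring

lemma edgeInd_self (G : SimpleGraph (Fin n)) (i : Fin n) : edgeInd G i i = 0 := by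
  simp [edgeInd]

lemma edgeInd_symm (G : SimpleGraph (Fin n)) (i j : Fin n) : edgeInd G i j = edgeInd G j i := by
  by_cases h : G.Adj i j
  · simp [edgeInd, h, h.symm]
  · have h' : ¬ G.Adj j i := fun hj => h hj.symm
    simp [edgeInd, h, h']

lemma edgeInd_zero_or_one (G : SimpleGraph (Fin n)) (i j : Fin n) :
    edgeInd G i j = 0 ∨ edgeInd G i j = 1 := by
  unfold edgeInd
  split_ifs <;> simp

open Classical in
lemma rankMatrix_eq (G : SimpleGraph (Fin n)) (P : Fin n → Fin n → ℝ) (i j : Fin n) :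
    rankMatrix G P i j = (if i = j then 1 - (∑ l, edgeInd G i l * P i l) / G.maxDegree else 0) +
      edgeInd G i j * P i j / G.maxDegree := by
  by_cases hij : i = j
  · subst hij
    rw [rankMatrix_apply_self, edgeInd_self]; simp
  · rw [rankMatrix_apply_of_ne _ _ hij, if_neg hij, zero_add]

lemma rankMatrix_row_sum (G : SimpleGraph (Fin n)) (P : Fin n → Fin n → ℝ) (i : Fin n) :
    ∑ j, rankMatrix G P i j = 1 := by
  simp only [rankMatrix_eq, Finset.sum_add_distrib, Finset.sum_ite_eq, Finset.mem_univ, if_true,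
    ← Finset.sum_div]
  ring

open Classical in
lemma vecMul_rankMatrix_apply (G : SimpleGraph (Fin n)) (P : Fin n → Fin n → ℝ) (u : Fin n → ℝ)
    (j : Fin n) : (u ᵥ* rankMatrix G P) j =
      u j - flow (fun a b => edgeInd G a b * P a b) u j / G.maxDegree := by
  simp only [Matrix.vecMul, dotProduct, rankMatrix_eq, mul_add, mul_ite, mul_zero,
    Finset.sum_add_distrib, Finset.sum_ite_eq', Finset.mem_univ, if_true, flow,
    Finset.sum_sub_distrib, ← Finset.mul_sum, ← mul_div_assoc, ← Finset.sum_div]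
  ring

-- Right multiplication by the rank matrix subtracts the outflow divided by d, so for d > 0 the
-- normalization plays no role.
open Classical in
lemma isStationaryDist_rankMatrix_iff (G : SimpleGraph (Fin n)) (P : Fin n → Fin n → ℝ)
    (hd : (0 : ℝ) < G.maxDegree) (u : Fin n → ℝ) :
    IsStationaryDist (rankMatrix G P) u ↔
      (∀ i, 0 ≤ u i) ∧ ∑ i, u i = 1 ∧ flow (fun a b => edgeInd G a b * P a b) u = 0 := by
  have : u ᵥ* rankMatrix G P = u ↔ flow (fun a b => edgeInd G a b * P a b) u = 0 := by
    rw [funext_iff, funext_iff]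
    refine forall_congr' fun j => ?_
    rw [vecMul_rankMatrix_apply, Pi.zero_apply, sub_eq_self, div_eq_zero_iff]
    exact or_iff_left hd.ne'
  rw [IsStationaryDist, this, stdSimplex]
  simp only [Set.mem_ofPred_eq, and_assoc]

lemma btlProb_normScore {α : Fin n → ℝ} (hα : ∀ i, 0 < α i) :
    btlProb (normScore α) = btlProb α := by
  ext i j
  have hs : 0 < ∑ l, α l := Finset.sum_pos (fun l _ => hα l) ⟨i, Finset.mem_univ i⟩
  have := add_pos (hα i) (hα j)
  unfold btlProb normScore
  field_simp

open Classical in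
/-- The Poincaré inequality for the comparison graph in terms of its spectral gap. -/
lemma poincare_rankMatrix (hn : 2 ≤ n) (G : SimpleGraph (Fin n)) {π : Fin n → ℝ}
    (hπ : ∀ i, 0 < π i) {γ : ℝ} (hγ : 0 < γ) (hd : (0 : ℝ) < G.maxDegree)
    (hgap : γ < 1 - absEig (rankMatrix G (btlProb π)) 2) {y : Fin n → ℝ}
    (hy : ∑ i, π i * y i = 0) :
    γ * G.maxDegree * ∑ i, π i * y i ^ 2 ≤
      (∑ i, ∑ j, π i * (edgeInd G i j * btlProb π i j) * (y i - y j) ^ 2) / 2 := by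
  have hbal : ∀ i j, π i * btlProb π i j = π j * btlProb π j i := by
    intro i j
    unfold btlProb
    rw [add_comm (π j) (π i), ← mul_div_assoc, ← mul_div_assoc, mul_comm]
  have hmain := poincare_of_absEig hn hπ (S := rankMatrix G (btlProb π)) ?_
    (rankMatrix_row_sum G _) hγ hgap hy
  · have e : ∀ i j, π i * rankMatrix G (btlProb π) i j * (y i - y j) ^ 2 =
        π i * (edgeInd G i j * btlProb π i j) * (y i - y j) ^ 2 / G.maxDegree := by
      intro i j
      by_cases hij : i = j
      · rw [hij]; simp
      · rw [rankMatrix_apply_of_ne _ _ hij]; ring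
    simp only [e, ← Finset.sum_div] at hmain
    rw [div_right_comm, le_div_iff₀ hd] at hmain
    linarith
  · intro i j
    by_cases hij : i = j
    · rw [hij]
    · rw [rankMatrix_apply_of_ne _ _ hij, rankMatrix_apply_of_ne _ _ (Ne.symm hij),
        edgeInd_symm G j i, ← mul_div_assoc, ← mul_div_assoc]
      congr 1
      linear_combination (edgeInd G i j) * hbal i j

lemma empProb_nonneg (z : ItemPair n → Fin k → Bool) (i j : Fin n) : 0 ≤ empProb z i j := by
  unfold empProb
  split_ifs <;> positivity

/-- The pair `{m, j}`. -/
def pairOf (m : Fin n) (j : {j : Fin n // j ≠ m}) : ItemPair n :=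
  if h : m < j.1 then ⟨(m, j.1), h⟩ else ⟨(j.1, m), lt_of_le_of_ne (not_lt.mp h) j.2⟩

lemma pairOf_of_lt {m : Fin n} {j : {j : Fin n // j ≠ m}} (h : m < j.1) :
    pairOf m j = ⟨(m, j.1), h⟩ := dif_pos h

lemma pairOf_of_gt {m : Fin n} {j : {j : Fin n // j ≠ m}} (h : j.1 < m) :
    pairOf m j = ⟨(j.1, m), h⟩ := dif_neg (not_lt.mpr h.le)

lemma pairOf_injective (m : Fin n) : Function.Injective (pairOf m) := by
  intro j j' h
  rcases lt_or_gt_of_ne j.2 with h1 | h1 <;> rcases lt_or_gt_of_ne j'.2 with h2 | h2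
  · rw [pairOf_of_gt h1, pairOf_of_gt h2] at h
    exact Subtype.ext (congrArg (fun e : ItemPair n => e.1.1) h)
  · rw [pairOf_of_gt h1, pairOf_of_lt h2] at h
    have := congrArg (fun e : ItemPair n => e.1.1) h
    exact absurd this j.2
  · rw [pairOf_of_lt h1, pairOf_of_gt h2] at h
    have := congrArg (fun e : ItemPair n => e.1.2) h
    exact absurd this j.2
  · rw [pairOf_of_lt h1, pairOf_of_lt h2] at h
    exact Subtype.ext (congrArg (fun e : ItemPair n => e.1.2) h)

lemma mem_pairOf (m : Fin n) (j : {j : Fin n // j ≠ m}) :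
    (pairOf m j).1.1 = m ∨ (pairOf m j).1.2 = m := by
  unfold pairOf
  split_ifs <;> simp

/-- The orientation of the pair `{m, j}`. -/
def pairSign (m j : Fin n) : ℝ := if m < j then 1 else -1

lemma pairSign_sq (m j : Fin n) : pairSign m j ^ 2 = 1 := by
  unfold pairSign
  split_ifs <;> norm_num

lemma edgeInd_obsGraph_of_lt (x : ItemPair n → Bool) {i j : Fin n} (h : i < j) :
    edgeInd (obsGraph x) i j = if x ⟨(i, j), h⟩ = true then 1 else 0 := by
  have : (obsGraph x).Adj i j ↔ x ⟨(i, j), h⟩ = true := by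
    simp only [obsGraph, SimpleGraph.fromRel_adj]
    constructor
    · rintro ⟨_, ⟨_, h2⟩ | ⟨h1, _⟩⟩
      · exact h2
      · exact absurd h1 (not_lt.mpr h.le)
    · intro hx
      exact ⟨h.ne, Or.inl ⟨h, hx⟩⟩
  simp only [edgeInd, this]

lemma edgeInd_obsGraph (x : ItemPair n → Bool) (m : Fin n) (j : {j : Fin n // j ≠ m}) :
    edgeInd (obsGraph x) m j = if x (pairOf m j) = true then 1 else 0 := by
  rcases lt_or_gt_of_ne j.2 with h | h
  · rw [edgeInd_symm, pairOf_of_gt h, edgeInd_obsGraph_of_lt x h]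
  · rw [pairOf_of_lt h, edgeInd_obsGraph_of_lt x h]

lemma card_filter_true_eq_sum (z : Fin k → Bool) :
    ((Finset.univ.filter (fun t => z t = true)).card : ℝ) =
      ∑ t, (if z t = true then (1 : ℝ) else 0) := by
  simp

lemma card_filter_false_eq (z : Fin k → Bool) :
    ((Finset.univ.filter (fun t => z t = false)).card : ℝ) =
      k - ∑ t, (if z t = true then (1 : ℝ) else 0) := by
  have h1 : ((Finset.univ.filter (fun t => z t = false)).card : ℝ) =
      ∑ t, (if z t = false then (1 : ℝ) else 0) := by simp
  have h2 : ∑ t, (if z t = false then (1 : ℝ) else 0) +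
      ∑ t, (if z t = true then (1 : ℝ) else 0) = k := by
    rw [← Finset.sum_add_distrib]
    have : ∀ t, ((if z t = false then (1 : ℝ) else 0) + if z t = true then 1 else 0) = 1 := by
      intro t; cases z t <;> simp
    simp [this]
  rw [h1]; linarith

lemma empProb_of_lt (z : ItemPair n → Fin k → Bool) {i j : Fin n} (h : i < j) :
    empProb z i j = (∑ t, (if z ⟨(i, j), h⟩ t = true then (1 : ℝ) else 0)) / k := by
  rw [empProb, dif_pos h, card_filter_true_eq_sum]

lemma empProb_of_gt (z : ItemPair n → Fin k → Bool) (hk : 0 < k) {i j : Fin n} (h : j < i) :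
    empProb z i j = 1 - (∑ t, (if z ⟨(j, i), h⟩ t = true then (1 : ℝ) else 0)) / k := by
  have hk' : (k : ℝ) ≠ 0 := by exact_mod_cast hk.ne'
  rw [empProb, dif_neg (not_lt.mpr h.le), dif_pos h, card_filter_false_eq, sub_div, div_self hk']

lemma empProb_add (z : ItemPair n → Fin k → Bool) (hk : 0 < k) {i j : Fin n} (hij : i ≠ j) :
    empProb z i j + empProb z j i = 1 := by
  rcases lt_or_gt_of_ne hij with h | h
  · rw [empProb_of_lt z h, empProb_of_gt z hk h]; ring
  · rw [empProb_of_lt z h, empProb_of_gt z hk h]; ring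

/-- The index type of all the Boolean variables of the model. -/
abbrev ModelIndex (n k : ℕ) : Type := ItemPair n ⊕ (ItemPair n × Fin k)

/-- The success probabilities of the variables of the model. -/
def modelProb (k : ℕ) (q : Fin n → Fin n → ℝ) (π : Fin n → ℝ) : ModelIndex n k → ℝ :=
  Sum.elim (fun e => q e.1.1 e.1.2) (fun et => btlProb π et.1.1.1 et.1.1.2)

/-- The edge indicators as a function of the outcome. -/
def edgeOf (ω : ModelIndex n k → Bool) : Fin n → Fin n → ℝ :=
  edgeInd (obsGraph fun e => ω (Sum.inl e))

/-- The empirical probabilities as a function of the outcome. -/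
def empOf (ω : ModelIndex n k → Bool) : Fin n → Fin n → ℝ :=
  empProb fun e t => ω (Sum.inr (e, t))

lemma edgeOf_sub_eq_centred {q : Fin n → Fin n → ℝ} (hq : ∀ i j, q i j = q j i) (π : Fin n → ℝ)
    (ω : ModelIndex n k → Bool) (m : Fin n) (j : {j : Fin n // j ≠ m}) :
    edgeOf ω m j - q m j = centred (modelProb k q π) (Sum.inl (pairOf m j)) ω := by
  rw [edgeOf, edgeInd_obsGraph, centred]
  congr 1
  simp only [modelProb, Sum.elim_inl]
  rcases lt_or_gt_of_ne j.2 with h | h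
  · rw [pairOf_of_gt h, hq]
  · rw [pairOf_of_lt h]

lemma modelProb_edge {q : Fin n → Fin n → ℝ} (hq : ∀ i j, q i j = q j i) (π : Fin n → ℝ)
    (m : Fin n) (j : {j : Fin n // j ≠ m}) :
    modelProb k q π (Sum.inl (pairOf m j)) = q m j := by
  simp only [modelProb, Sum.elim_inl]
  rcases lt_or_gt_of_ne j.2 with h | h
  · rw [pairOf_of_gt h, hq]
  · rw [pairOf_of_lt h]

lemma empOf_sub_eq_of_lt (q : Fin n → Fin n → ℝ) (π : Fin n → ℝ) (hk : 0 < k)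
    (ω : ModelIndex n k → Bool) (e : ItemPair n) :
    empOf ω e.1.1 e.1.2 - btlProb π e.1.1 e.1.2 =
      (∑ t, centred (modelProb k q π) (Sum.inr (e, t)) ω) / k := by
  have hk' : (k : ℝ) ≠ 0 := by exact_mod_cast hk.ne'
  rw [empOf, empProb_of_lt _ e.2]
  simp only [centred, modelProb, Sum.elim_inr, Finset.sum_sub_distrib, Finset.sum_const,
    Finset.card_univ, Fintype.card_fin, nsmul_eq_mul]
  rw [sub_div, mul_div_cancel_left₀ _ hk']

lemma empOf_sub_eq_centred (q : Fin n → Fin n → ℝ) {π : Fin n → ℝ} (hπ : ∀ i, 0 < π i)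
    (hk : 0 < k) (ω : ModelIndex n k → Bool) (m : Fin n) (j : {j : Fin n // j ≠ m}) :
    empOf ω m j - btlProb π m j =
      pairSign m j * ((∑ t, centred (modelProb k q π) (Sum.inr (pairOf m j, t)) ω) / k) := by
  rw [← empOf_sub_eq_of_lt q π hk ω (pairOf m j)]
  rcases lt_or_gt_of_ne j.2 with h | h
  · rw [pairOf_of_gt h, pairSign, if_neg (not_lt.mpr h.le)]
    have h1 : empOf ω m j + empOf ω j m = 1 := empProb_add _ hk (Ne.symm j.2)
    have h2 : btlProb π m j + btlProb π j m = 1 := btlProb_add hπ m j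
    simp only
    linarith
  · rw [pairOf_of_lt h, pairSign, if_pos h, one_mul]

/-- The variables of the pairs that contain `m`. -/
def touching (k : ℕ) (m : Fin n) : Set (ModelIndex n k) :=
  {i | Sum.elim (fun e : ItemPair n => e.1.1 = m ∨ e.1.2 = m)
    (fun et : ItemPair n × Fin k => et.1.1.1 = m ∨ et.1.1.2 = m) i}

lemma Unaffected.mono {I β : Type*} [DecidableEq I] {T T' : Set I} {f : (I → Bool) → β}
    (hf : Unaffected T f) (h : T' ⊆ T) : Unaffected T' f := fun ω i hi b => hf ω i (h hi) b

lemma edgeOf_unaffected_inr (i j : Fin n) :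
    Unaffected (Set.range Sum.inr : Set (ModelIndex n k)) (fun ω => edgeOf ω i j) := by
  rintro ω _ ⟨et, rfl⟩ b
  simp [edgeOf]

lemma edgeOf_unaffected_touching {m i j : Fin n} (hi : i ≠ m) (hj : j ≠ m) :
    Unaffected (touching k m) (fun ω => edgeOf ω i j) := by
  rintro ω (e | et) he b
  · by_cases hij : i = j
    · rw [hij]; simp [edgeOf, edgeInd_self]
    · have hne : ∀ e' : ItemPair n, e'.1.1 ≠ m → e'.1.2 ≠ m →
          Function.update ω (Sum.inl e) b (Sum.inl e') = ω (Sum.inl e') := by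
        intro e' h1 h2
        refine Function.update_of_ne ?_ _ _
        rintro h
        cases Sum.inl_injective h
        simp only [touching, Set.mem_ofPred_eq, Sum.elim_inl] at he
        exact he.elim h1 h2
      simp only [edgeOf]
      rcases lt_or_gt_of_ne hij with h | h
      · rw [edgeInd_obsGraph_of_lt _ h, edgeInd_obsGraph_of_lt _ h, hne _ hi hj]
      · rw [edgeInd_symm, edgeInd_obsGraph_of_lt _ h, edgeInd_symm, edgeInd_obsGraph_of_lt _ h,
          hne _ hj hi]
  · exact edgeOf_unaffected_inr i j ω _ ⟨et, rfl⟩ b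

lemma empOf_unaffected_touching {m i j : Fin n} (hi : i ≠ m) (hj : j ≠ m) :
    Unaffected (touching k m) (fun ω => empOf ω i j) := by
  rintro ω (e | et) he b
  · simp [empOf]
  · have hne : ∀ (e' : ItemPair n) (t : Fin k), e'.1.1 ≠ m → e'.1.2 ≠ m →
        Function.update ω (Sum.inr et) b (Sum.inr (e', t)) = ω (Sum.inr (e', t)) := by
      intro e' t h1 h2
      refine Function.update_of_ne ?_ _ _
      rintro h
      cases Sum.inr_injective h
      simp only [touching, Set.mem_ofPred_eq, Sum.elim_inr] at he
      exact he.elim h1 h2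
    simp only [empOf, empProb]
    split_ifs with h1 h2
    · simp only [hne ⟨(i, j), h1⟩ _ hi hj]
    · simp only [hne ⟨(j, i), h2⟩ _ hj hi]
    · rfl

/-- On pairs containing m the rates are deterministic, so no edge or comparison at m enters. This is
the independence that the concentration bounds need. -/
lemma looScore_unaffected (π : Fin n → ℝ) (q : Fin n → Fin n → ℝ) (m : Fin n) :
    Unaffected (touching k m) (fun ω => looScore π q (edgeOf ω) (empOf ω) m) := by
  intro ω i hi b
  simp only [looScore]
  congr 1
  ext a c
  simp only [looRates]
  split_ifs with h
  · rfl
  · rw [not_or] at h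
    have h1 := edgeOf_unaffected_touching h.1 h.2 ω i hi b
    have h2 := empOf_unaffected_touching h.1 h.2 ω i hi b
    simp only at h1 h2
    rw [h1, h2]

end Model

/-! ### Tail bounds for edges, comparisons and the skew noise matrix -/

section Tails

variable {n k : ℕ}

lemma sum_eq_sum_ne (m : Fin n) (f : Fin n → ℝ) (hf : f m = 0) :
    ∑ j, f j = ∑ j : {j : Fin n // j ≠ m}, f j := by
  rw [← Finset.sum_erase _ hf]
  exact Finset.sum_subtype _ (by simp) f

lemma modelProb_nonneg {q : Fin n → Fin n → ℝ} (hq : ∀ i j, 0 ≤ q i j) {π : Fin n → ℝ}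
    (hπ : ∀ i, 0 < π i) (i : ModelIndex n k) : 0 ≤ modelProb k q π i := by
  rcases i with e | et
  · exact hq _ _
  · exact (div_pos (hπ _) (add_pos (hπ _) (hπ _))).le

lemma modelProb_le_one {q : Fin n → Fin n → ℝ} (hq : ∀ i j, q i j ≤ 1) {π : Fin n → ℝ}
    (hπ : ∀ i, 0 < π i) (i : ModelIndex n k) : modelProb k q π i ≤ 1 := by
  rcases i with e | et
  · exact hq _ _
  · simp only [modelProb, Sum.elim_inr, btlProb]
    rw [div_le_one (add_pos (hπ _) (hπ _))]
    linarith [hπ et.1.1.1]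

/-- Fluctuation of a weighted degree with weights that do not depend on the edges at `m`. -/
lemma edge_tail {q : Fin n → Fin n → ℝ} {π : Fin n → ℝ} (hπ : ∀ i, 0 < π i)
    (hqs : ∀ i j, q i j = q j i) (hq0 : ∀ i j, 0 ≤ q i j) (hq1 : ∀ i j, q i j ≤ 1)
    (hqd : ∀ i, q i i = 0) (m : Fin n) (c : Fin n → (ModelIndex n k → Bool) → ℝ)
    (B : (ModelIndex n k → Bool) → ℝ) {t : ℝ} (ht : 0 < t)
    (hc : ∀ j, Unaffected (touching k m) (c j)) (hB : Unaffected (touching k m) B)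
    (hcB : ∀ j ω, |c j ω| ≤ B ω) (htD : t ≤ ∑ j, q m j) :
    bernProb (modelProb k q π) (fun ω => 2 * √(t * (B ω ^ 2 * ∑ j, q m j)) <
      |∑ j, (edgeOf ω m j - q m j) * c j ω|) ≤ 2 * Real.exp (-t) := by
  have hsum : ∑ j : {j : Fin n // j ≠ m}, modelProb k q π (Sum.inl (pairOf m j)) = ∑ j, q m j := by
    rw [sum_eq_sum_ne m (fun j => q m j) (hqd m)]
    exact Finset.sum_congr rfl fun j _ => modelProb_edge hqs π m j
  have hsub : (fun j : {j : Fin n // j ≠ m} => (Sum.inl (pairOf m j) : ModelIndex n k)) ''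
      ((Finset.univ : Finset {j : Fin n // j ≠ m}) : Set {j : Fin n // j ≠ m}) ⊆ touching k m := by
    rintro _ ⟨j, _, rfl⟩
    exact mem_pairOf m j
  have hmain := bernProb_bernstein (modelProb_nonneg hq0 hπ) (modelProb_le_one hq1 hπ)
    (Finset.univ : Finset {j : Fin n // j ≠ m})
    (fun j => (Sum.inl (pairOf m j) : ModelIndex n k))
    (fun a _ b _ hab => pairOf_injective m (Sum.inl_injective hab))
    (fun j ω => c j ω) B ht.le (fun j _ => (hc j).mono hsub) (hB.mono hsub)
    (fun j _ ω => hcB j ω) (fun ω => (abs_nonneg _).trans (hcB m ω)) (by rw [hsum]; exact htD) ht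
  rw [hsum] at hmain
  refine le_trans (le_of_eq ?_) hmain
  congr 1
  ext ω
  rw [sum_eq_sum_ne m (fun j => (edgeOf ω m j - q m j) * c j ω)
    (by rw [hqd, edgeOf, edgeInd_self]; simp)]
  have : ∀ j : {j : Fin n // j ≠ m}, (edgeOf ω m j - q m j) * c j ω =
      c j ω * centred (modelProb k q π) (Sum.inl (pairOf m j)) ω := fun j => by
    rw [edgeOf_sub_eq_centred hqs π ω m j, mul_comm]
  simp only [this]

/-- Fluctuation of a weighted sum of the comparison noise at `m`, with weights that do not depend
on the comparisons at `m`. -/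
lemma noise_tail {q : Fin n → Fin n → ℝ} {π : Fin n → ℝ} (hπ : ∀ i, 0 < π i)
    (hq0 : ∀ i j, 0 ≤ q i j) (hq1 : ∀ i j, q i j ≤ 1)
    (hk : 0 < k) (m : Fin n) (u : Fin n → (ModelIndex n k → Bool) → ℝ) {t : ℝ} (ht : 0 ≤ t)
    (hu : ∀ j, Unaffected (touching k m) (u j)) :
    bernProb (modelProb k q π) (fun ω => 2 * √(t * ((∑ j, edgeOf ω m j * u j ω ^ 2) / k / 2)) <
      |∑ j, edgeOf ω m j * (empOf ω m j - btlProb π m j) * u j ω|) ≤ 2 * Real.exp (-t) := by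
  have hk' : (k : ℝ) ≠ 0 := by exact_mod_cast hk.ne'
  set ι : {j : Fin n // j ≠ m} × Fin k → ModelIndex n k := fun jt => Sum.inr (pairOf m jt.1, jt.2)
    with hι
  have hsub : ι '' ((Finset.univ : Finset ({j : Fin n // j ≠ m} × Fin k)) : Set _) ⊆
      touching k m := by
    rintro _ ⟨j, _, rfl⟩
    exact mem_pairOf m j.1
  -- Only comparison variables are averaged here, so the edge indicators at m may appear in the
  -- coefficients: this amounts to conditioning on the graph.
  have hsub2 : ι '' ((Finset.univ : Finset ({j : Fin n // j ≠ m} × Fin k)) : Set _) ⊆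
      Set.range Sum.inr := by
    rintro _ ⟨j, _, rfl⟩
    exact ⟨_, rfl⟩
  have hinj : Function.Injective ι := by
    rintro ⟨a, t⟩ ⟨b, t'⟩ hab
    have h := Sum.inr_injective hab
    rw [Prod.mk.injEq] at h
    exact Prod.ext (pairOf_injective m h.1) h.2
  have hmain := bernProb_hoeffding (modelProb_nonneg hq0 hπ) (modelProb_le_one hq1 hπ)
    (Finset.univ : Finset ({j : Fin n // j ≠ m} × Fin k)) ι hinj.injOn
    (fun jt ω => pairSign m jt.1 * edgeOf ω m jt.1 * u jt.1 ω / k) ht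
    (fun jt _ ω i hi b => by
      have h1 := edgeOf_unaffected_inr m jt.1.1 ω i (hsub2 hi) b
      have h2 := hu jt.1 ω i (hsub hi) b
      simp only at h1
      simp only [h1, h2])
  refine le_trans (le_of_eq ?_) hmain
  congr 1
  ext ω
  have hx2 : ∀ j, edgeOf ω m j ^ 2 = edgeOf ω m j := fun j => by
    rcases edgeInd_zero_or_one (obsGraph fun e => ω (Sum.inl e)) m j with h | h <;>
      rw [edgeOf, h] <;> norm_num
  have e1 : (∑ j, edgeOf ω m j * u j ω ^ 2) / k =
      ∑ jt : {j : Fin n // j ≠ m} × Fin k,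
        (pairSign m jt.1 * edgeOf ω m jt.1 * u jt.1 ω / k) ^ 2 := by
    rw [sum_eq_sum_ne m _ (by rw [edgeOf, edgeInd_self]; simp), Fintype.sum_prod_type,
      Finset.sum_div]
    refine Finset.sum_congr rfl fun j _ => ?_
    simp only [div_pow, mul_pow, pairSign_sq, hx2, one_mul, Finset.sum_const, Finset.card_univ,
      Fintype.card_fin, nsmul_eq_mul]
    field_simp
  have e2 : ∑ j, edgeOf ω m j * (empOf ω m j - btlProb π m j) * u j ω =
      ∑ jt : {j : Fin n // j ≠ m} × Fin k,
        pairSign m jt.1 * edgeOf ω m jt.1 * u jt.1 ω / k *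
          centred (modelProb k q π) (ι jt) ω := by
    rw [sum_eq_sum_ne m _ (by rw [edgeOf, edgeInd_self]; simp), Fintype.sum_prod_type]
    refine Finset.sum_congr rfl fun j _ => ?_
    rw [empOf_sub_eq_centred q hπ hk]
    simp only [← Finset.mul_sum]
    ring
  rw [e1, e2]

/-- A sum over ordered pairs as a sum over unordered pairs. -/
lemma sum_sum_eq_sum_itemPair (G : Fin n → Fin n → ℝ) (hG : ∀ i, G i i = 0) :
    ∑ i, ∑ j, G i j = ∑ e : ItemPair n, (G e.1.1 e.1.2 + G e.1.2 e.1.1) := by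
  have h1 : ∑ e : ItemPair n, (G e.1.1 e.1.2 + G e.1.2 e.1.1) =
      ∑ e : Fin n × Fin n, if e.1 < e.2 then G e.1 e.2 + G e.2 e.1 else 0 := by
    rw [← Finset.sum_filter]
    exact (Finset.sum_subtype (Finset.univ.filter fun e : Fin n × Fin n => e.1 < e.2)
      (by simp) (fun e : Fin n × Fin n => G e.1 e.2 + G e.2 e.1)).symm
  rw [h1, Fintype.sum_prod_type]
  have h2 : ∀ i j, G i j = (if i < j then G i j else 0) + (if j < i then G i j else 0) := by
    intro i j
    rcases lt_trichotomy i j with h | h | h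
    · simp [h, h.le]
    · subst h; simp [hG]
    · simp [h, h.le]
  have h3 : ∑ i, ∑ j, (if j < i then G i j else 0) = ∑ i, ∑ j, (if i < j then G j i else 0) :=
    Finset.sum_comm
  calc ∑ i, ∑ j, G i j
      = ∑ i, ∑ j, (if i < j then G i j else 0) + ∑ i, ∑ j, (if j < i then G i j else 0) := by
        rw [← Finset.sum_add_distrib]
        refine Finset.sum_congr rfl fun i _ => ?_
        rw [← Finset.sum_add_distrib]
        exact Finset.sum_congr rfl fun j _ => h2 i j
    _ = _ := by
        rw [h3, ← Finset.sum_add_distrib]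
        refine Finset.sum_congr rfl fun i _ => ?_
        rw [← Finset.sum_add_distrib]
        refine Finset.sum_congr rfl fun j _ => ?_
        split_ifs <;> simp

/-- The symmetric matrix unit of a pair. -/
def pairMatrix (e : ItemPair n) : Matrix (Fin n) (Fin n) ℝ :=
  Matrix.single e.1.1 e.1.2 1 + Matrix.single e.1.2 e.1.1 1

lemma pairMatrix_transpose (e : ItemPair n) : (pairMatrix e)ᵀ = pairMatrix e := by
  rw [pairMatrix, Matrix.transpose_add, Matrix.transpose_single, Matrix.transpose_single, add_comm]

lemma pairMatrix_mul_self (e : ItemPair n) : pairMatrix e * pairMatrix e =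
    Matrix.diagonal (fun l => (if l = e.1.1 then 1 else 0) + if l = e.1.2 then (1 : ℝ) else 0) := by
  have h := e.2.ne
  rw [pairMatrix, Matrix.add_mul, Matrix.mul_add, Matrix.mul_add,
    Matrix.single_mul_single_of_ne _ _ _ _ h.symm, Matrix.single_mul_single_same,
    Matrix.single_mul_single_same, Matrix.single_mul_single_of_ne _ _ _ _ h]
  ext a b
  simp only [zero_add, add_zero, mul_one, Matrix.add_apply, Matrix.single_apply,
    Matrix.diagonal_apply]
  by_cases hab : a = b
  · subst hab
    simp [eq_comm]
  · rw [if_neg hab, if_neg, if_neg, add_zero]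
    · rintro ⟨rfl, rfl⟩; exact hab rfl
    · rintro ⟨rfl, rfl⟩; exact hab rfl

lemma pairMatrix_quadForm (e : ItemPair n) (z : Fin n → ℝ) :
    ∑ i, ∑ l, z i * pairMatrix e i l * z l = 2 * (z e.1.1 * z e.1.2) := by
  simp only [pairMatrix, Matrix.add_apply, Matrix.single_apply, mul_add, add_mul,
    Finset.sum_add_distrib]
  have : ∀ a b : Fin n, ∑ i, ∑ l, z i * (if a = i ∧ b = l then (1 : ℝ) else 0) * z l =
      z a * z b := by
    intro a b
    rw [Finset.sum_eq_single_of_mem a (Finset.mem_univ a), Finset.sum_eq_single_of_mem b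
      (Finset.mem_univ b)]
    · simp
    · intro l _ hl; simp [Ne.symm hl]
    · intro i _ hi; simp [Ne.symm hi]
  rw [this, this]; ring

lemma quadForm_sum {J : Type*} [Fintype J] (c : J → ℝ) (A : J → Matrix (Fin n) (Fin n) ℝ)
    (z : Fin n → ℝ) : ∑ i, ∑ l, z i * (∑ j, c j • A j) i l * z l =
      ∑ j, c j * ∑ i, ∑ l, z i * A j i l * z l := by
  simp only [Matrix.sum_apply, Matrix.smul_apply, smul_eq_mul, Finset.mul_sum, Finset.sum_mul]
  have : ∀ i, ∑ l, ∑ j, z i * (c j * A j i l) * z l = ∑ j, ∑ l, c j * (z i * A j i l * z l) := by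
    intro i
    rw [Finset.sum_comm]
    exact Finset.sum_congr rfl fun j _ => Finset.sum_congr rfl fun l _ => by ring
  simp only [this]
  exact Finset.sum_comm

/-- The asymmetry factor of a pair. -/
def skew (π : Fin n → ℝ) (i j : Fin n) : ℝ := (π j - π i) / (√(π i) * √(π j))

/-- The squared difference is at most the square of the larger score, so the quotient is at most the
ratio of the larger to the smaller score. -/
lemma skew_sq_le {π : Fin n → ℝ} (hπ : ∀ i, 0 < π i) {h : ℝ}
    (hπh : ∀ i j, π i ≤ h * π j) (i j : Fin n) : skew π i j ^ 2 ≤ h := by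
  rw [skew, div_pow, mul_pow, Real.sq_sqrt (hπ i).le, Real.sq_sqrt (hπ j).le,
    div_le_iff₀ (mul_pos (hπ i) (hπ j))]
  have hi := hπ i
  have hj := hπ j
  rcases le_total (π i) (π j) with hle | hle
  · have h1 : (π j - π i) ^ 2 ≤ π j * π j := by nlinarith
    have h2 := mul_le_mul_of_nonneg_left (hπh j i) hj.le
    linarith
  · have h1 : (π j - π i) ^ 2 ≤ π i * π i := by nlinarith
    have h2 := mul_le_mul_of_nonneg_left (hπh i j) hi.le
    linarith

open Classical in
/-- Spectral bound for the skew part of the comparison noise. -/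
lemma skew_noise_tail {q : Fin n → Fin n → ℝ} {π : Fin n → ℝ} (hπ : ∀ i, 0 < π i)
    (hq0 : ∀ i j, 0 ≤ q i j) (hq1 : ∀ i j, q i j ≤ 1) (hk : 0 < k) {h : ℝ} (hh : 1 ≤ h)
    (hπh : ∀ i j, π i ≤ h * π j) {r : ℕ} (hr : r ≠ 0) :
    bernProb (modelProb k q π) (fun ω => ∃ z : Fin n → ℝ,
      √(Real.exp 9 * (r * h) * (obsGraph fun e => ω (Sum.inl e)).maxDegree) * ∑ i, z i ^ 2 <
      |∑ i, ∑ j, z i * (edgeOf ω i j * (empOf ω i j - btlProb π i j) *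
        ((π j - π i) / (√(π i) * √(π j)))) * z j|) ≤ n * Real.exp (-9 * r) := by
  have hkpos : (0 : ℝ) < k := by exact_mod_cast hk
  have hk1 : (1 : ℝ) ≤ k := by exact_mod_cast hk
  have hh0 : 0 < h := by linarith
  set d : (ModelIndex n k → Bool) → ℝ := fun ω => (obsGraph fun e => ω (Sum.inl e)).maxDegree
    with hd
  have hd0 : ∀ ω, 0 ≤ d ω := fun ω => Nat.cast_nonneg _
  -- `bernProb_quadForm_tail` needs a deterministic variance bound, while the maximum degree d is
  -- random. It depends only on the edges, so dividing by √d is allowed and makes the bound equal to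
  -- h; the factor √d is restored at the end.
  set a : ItemPair n → (ModelIndex n k → Bool) → ℝ := fun e ω =>
    edgeOf ω e.1.1 e.1.2 * skew π e.1.1 e.1.2 / k / √(d ω) with ha
  have hxsq : ∀ (ω : ModelIndex n k → Bool) i j, edgeOf ω i j ^ 2 = edgeOf ω i j := fun ω i j => by
    rcases edgeInd_zero_or_one (obsGraph fun e => ω (Sum.inl e)) i j with h | h <;>
      rw [edgeOf, h] <;> norm_num
  have hx0 : ∀ (ω : ModelIndex n k → Bool) i j, 0 ≤ edgeOf ω i j := fun ω i j => by rw [← hxsq]; exact sq_nonneg _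
  have hasq : ∀ e ω, (k : ℝ) * a e ω ^ 2 ≤ edgeOf ω e.1.1 e.1.2 * (h / d ω) := by
    intro e ω
    rw [ha]
    simp only [div_pow, mul_pow, hxsq, Real.sq_sqrt (hd0 ω)]
    have h1 := skew_sq_le hπ hπh e.1.1 e.1.2
    calc (k : ℝ) * (edgeOf ω e.1.1 e.1.2 * skew π e.1.1 e.1.2 ^ 2 / k ^ 2 / d ω)
        = edgeOf ω e.1.1 e.1.2 * (skew π e.1.1 e.1.2 ^ 2 / d ω) / k := by field_simp
      _ ≤ edgeOf ω e.1.1 e.1.2 * (skew π e.1.1 e.1.2 ^ 2 / d ω) :=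
          div_le_self (mul_nonneg (hx0 _ _ _) (div_nonneg (sq_nonneg _) (hd0 ω))) hk1
      _ ≤ _ := mul_le_mul_of_nonneg_left (div_le_div_of_nonneg_right h1 (hd0 ω)) (hx0 _ _ _)
  have hmain := bernProb_quadForm_tail (n := Fin n) (modelProb_nonneg (k := k) hq0 hπ)
    (modelProb_le_one hq1 hπ)
    (Finset.univ : Finset (ItemPair n × Fin k)) (Sum.inr : _ → ModelIndex n k)
    Sum.inr_injective.injOn (fun et ω => a et.1 ω • pairMatrix et.1)
    (fun et _ ω i hi b => by
      obtain ⟨et', _, rfl⟩ := hi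
      simp [ha, hd, edgeOf])
    (fun et _ ω => by rw [Matrix.transpose_smul, pairMatrix_transpose])
    (fun ω l => ∑ e : ItemPair n, (k : ℝ) * a e ω ^ 2 *
      ((if l = e.1.1 then 1 else 0) + if l = e.1.2 then (1 : ℝ) else 0)) hh0
    (fun ω => by
      simp only [Matrix.smul_mul, Matrix.mul_smul, smul_smul, pairMatrix_mul_self]
      rw [Fintype.sum_prod_type]
      ext i j
      simp only [Matrix.sum_apply, Matrix.smul_apply, Matrix.diagonal_apply, smul_eq_mul]
      split_ifs with hij
      · refine Finset.sum_congr rfl fun e _ => ?_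
        rw [Finset.sum_eq_card_nsmul (b := a e ω * a e ω *
            ((if i = e.1.1 then 1 else 0) + if i = e.1.2 then (1 : ℝ) else 0)) (fun _ _ => rfl),
          Finset.card_univ, Fintype.card_fin, nsmul_eq_mul]
        ring
      · simp)
    (fun ω l => by
      calc ∑ e : ItemPair n, (k : ℝ) * a e ω ^ 2 *
            ((if l = e.1.1 then 1 else 0) + if l = e.1.2 then (1 : ℝ) else 0)
          ≤ ∑ e : ItemPair n, edgeOf ω e.1.1 e.1.2 * (h / d ω) *
            ((if l = e.1.1 then 1 else 0) + if l = e.1.2 then (1 : ℝ) else 0) :=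
            Finset.sum_le_sum fun e _ => mul_le_mul_of_nonneg_right (hasq e ω)
              (by positivity)
        _ = ∑ i, ∑ j, (if l = i then edgeOf ω i j * (h / d ω) else 0) := by
            rw [sum_sum_eq_sum_itemPair _ (fun i => by rw [edgeOf, edgeInd_self]; simp)]
            refine Finset.sum_congr rfl fun e _ => ?_
            have : edgeOf ω e.1.2 e.1.1 = edgeOf ω e.1.1 e.1.2 := edgeInd_symm _ _ _
            rw [this]
            split_ifs <;> ring
        _ = (∑ j, edgeOf ω l j) * (h / d ω) := by
            rw [Finset.sum_eq_single_of_mem l (Finset.mem_univ l)]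
            · simp [Finset.sum_mul]
            · intro i _ hi
              simp [Ne.symm hi]
        _ ≤ d ω * (h / d ω) := mul_le_mul_of_nonneg_right (sum_edgeInd_le_maxDegree _ l)
            (div_nonneg hh0.le (hd0 ω))
        _ ≤ h := by
            rcases eq_or_lt_of_le (hd0 ω) with hz | hz
            · rw [← hz, zero_mul]; exact hh0.le
            · rw [mul_div_cancel₀ _ hz.ne']) hr
  rw [Fintype.card_fin] at hmain
  refine le_trans (bernProb_mono (modelProb_nonneg hq0 hπ) (modelProb_le_one hq1 hπ) ?_) hmain
  rintro ω ⟨z, hz⟩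
  refine ⟨z, ?_⟩
  have hquad : ∑ i, ∑ j, z i * (edgeOf ω i j * (empOf ω i j - btlProb π i j) *
        ((π j - π i) / (√(π i) * √(π j)))) * z j =
      √(d ω) * ∑ i, ∑ l, z i * (∑ et : ItemPair n × Fin k,
        centred (modelProb k q π) (Sum.inr et) ω • (a et.1 ω • pairMatrix et.1)) i l * z l := by
    have e1 : ∑ i, ∑ l, z i * (∑ et : ItemPair n × Fin k,
        centred (modelProb k q π) (Sum.inr et) ω • (a et.1 ω • pairMatrix et.1)) i l * z l =
        ∑ et : ItemPair n × Fin k, centred (modelProb k q π) (Sum.inr et) ω * a et.1 ω *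
          (2 * (z et.1.1.1 * z et.1.1.2)) := by
      rw [quadForm_sum]
      refine Finset.sum_congr rfl fun et _ => ?_
      rw [← pairMatrix_quadForm, mul_assoc]
      congr 1
      rw [Finset.mul_sum]
      refine Finset.sum_congr rfl fun i _ => ?_
      rw [Finset.mul_sum]
      refine Finset.sum_congr rfl fun l _ => ?_
      rw [Matrix.smul_apply, smul_eq_mul]; ring
    rw [e1, sum_sum_eq_sum_itemPair _ (fun i => by rw [edgeOf, edgeInd_self]; simp),
      Fintype.sum_prod_type, Finset.mul_sum]
    refine Finset.sum_congr rfl fun e _ => ?_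
    have h1 := empOf_sub_eq_of_lt q π hk ω e
    have h2 : edgeOf ω e.1.2 e.1.1 = edgeOf ω e.1.1 e.1.2 := edgeInd_symm _ _ _
    have h3 : empOf ω e.1.2 e.1.1 - btlProb π e.1.2 e.1.1 =
        -(empOf ω e.1.1 e.1.2 - btlProb π e.1.1 e.1.2) := by
      have c1 : empOf ω e.1.1 e.1.2 + empOf ω e.1.2 e.1.1 = 1 := empProb_add _ hk e.2.ne
      have c2 : btlProb π e.1.1 e.1.2 + btlProb π e.1.2 e.1.1 = 1 := btlProb_add hπ _ _
      linarith
    -- When d = 0 the quotient is 0 by convention, but then there are no edges and both sides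
    -- vanish.
    have hxd : edgeOf ω e.1.1 e.1.2 = √(d ω) * (edgeOf ω e.1.1 e.1.2 / √(d ω)) := by
      rcases eq_or_lt_of_le (hd0 ω) with hz | hz
      · have : edgeOf ω e.1.1 e.1.2 ≤ d ω :=
          (Finset.single_le_sum (f := fun j => edgeOf ω e.1.1 j) (fun j _ => hx0 ω _ j)
            (Finset.mem_univ e.1.2)).trans (sum_edgeInd_le_maxDegree _ _)
        rw [← hz, le_antisymm (this.trans_eq hz.symm) (hx0 _ _ _)]; simp
      · rw [mul_div_cancel₀ _ (Real.sqrt_pos.mpr hz).ne']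
    dsimp only
    rw [← Finset.sum_mul, ← Finset.sum_mul, h2, h3, h1, ha]
    simp only [skew]
    have h4 : (π e.1.1 - π e.1.2) / (√(π e.1.2) * √(π e.1.1)) =
        -((π e.1.2 - π e.1.1) / (√(π e.1.1) * √(π e.1.2))) := by
      rw [mul_comm (√(π e.1.2)), ← neg_div, neg_sub]
    rw [h4]
    generalize (π e.1.2 - π e.1.1) / (√(π e.1.1) * √(π e.1.2)) = κ
    generalize ∑ t, centred (modelProb k q π) (Sum.inr (e, t)) ω = T
    calc _ = edgeOf ω e.1.1 e.1.2 * (2 * (T / k * κ * (z e.1.1 * z e.1.2))) := by ring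
      _ = √(d ω) * (edgeOf ω e.1.1 e.1.2 / √(d ω)) *
          (2 * (T / k * κ * (z e.1.1 * z e.1.2))) := by rw [← hxd]
      _ = _ := by ring
  have hlt : √(Real.exp 9 * (r * h) * d ω) * ∑ i, z i ^ 2 <
      |∑ i, ∑ j, z i * (edgeOf ω i j * (empOf ω i j - btlProb π i j) *
        ((π j - π i) / (√(π i) * √(π j)))) * z j| := hz
  rw [hquad, abs_mul, abs_of_nonneg (Real.sqrt_nonneg (d ω)), Real.sqrt_mul (by positivity),
    mul_comm (√(Real.exp 9 * (r * h))), mul_assoc] at hlt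
  exact lt_of_mul_lt_mul_left hlt (Real.sqrt_nonneg _)

end Tails

/-! ### Typical outcomes satisfy the deterministic hypotheses -/

section Main

variable {n k : ℕ}

/-- The error of the leave-one-out score vector. -/
def looError (π : Fin n → ℝ) (q : Fin n → Fin n → ℝ) (m : Fin n) (ω : ModelIndex n k → Bool) :
    Fin n → ℝ := looScore π q (edgeOf ω) (empOf ω) m - π

/-- The comparison noise at `m` with weights `u` is of the typical size. -/
def NoiseBound (π : Fin n → ℝ) (t : ℝ) (m : Fin n) (u : Fin n → ℝ) (ω : ModelIndex n k → Bool) :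
    Prop :=
  |∑ j, edgeOf ω m j * (empOf ω m j - btlProb π m j) * u j| ≤
    2 * √(t * ((∑ j, edgeOf ω m j * u j ^ 2) / k / 2))

/-- The edge fluctuation at `m` with weights `u` bounded by `B` is of the typical size. -/
def EdgeBound (q : Fin n → Fin n → ℝ) (t : ℝ) (m : Fin n) (u : Fin n → ℝ) (B : ℝ)
    (ω : ModelIndex n k → Bool) : Prop :=
  |∑ j, (edgeOf ω m j - q m j) * u j| ≤ 2 * √(t * (B ^ 2 * ∑ j, q m j))

/-- The typical behaviour of the variables at `m`. -/
structure IsTypicalAt (π : Fin n → ℝ) (q : Fin n → Fin n → ℝ) (t : ℝ) (m : Fin n)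
    (ω : ModelIndex n k → Bool) : Prop where
  degree : EdgeBound q t m (fun _ => 1) 1 ω
  edge : EdgeBound q t m (fun j => looError π q m ω m * btlProb π m j -
    looError π q m ω j * btlProb π j m) ‖looError π q m ω‖ ω
  noise_one : NoiseBound π t m (fun _ => 1) ω
  noise_score : NoiseBound π t m (fun j => π m + π j) ω
  noise_error : NoiseBound π t m (fun j => looError π q m ω m + looError π q m ω j) ω
  noise_single : ∀ j, NoiseBound π t m (Pi.single j 1) ω

open Classical in
/-- The skew part of the comparison noise is of the typical size. -/
def SkewBound (π : Fin n → ℝ) (h : ℝ) (r : ℕ) (ω : ModelIndex n k → Bool) : Prop :=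
  ∀ z : Fin n → ℝ, |∑ i, ∑ j, z i * (edgeOf ω i j * (empOf ω i j - btlProb π i j) *
    ((π j - π i) / (√(π i) * √(π j)))) * z j| ≤
      √(Real.exp 9 * (r * h) * (obsGraph fun e => ω (Sum.inl e)).maxDegree) * ∑ i, z i ^ 2

lemma NoiseBound.le {π : Fin n → ℝ} {L d : ℝ} {m : Fin n} {u : Fin n → ℝ}
    {ω : ModelIndex n k → Bool} (hN : NoiseBound π (8 * L) m u ω) (hk : 0 < k) (hL : 0 ≤ L)
    {U : ℝ} (hU : 0 ≤ U) (hu : ∑ j, edgeOf ω m j * u j ^ 2 ≤ U ^ 2 * d) :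
    |∑ j, edgeOf ω m j * (empOf ω m j - btlProb π m j) * u j| ≤ 4 * U * √(L * d / k) := by
  have hkpos : (0 : ℝ) < k := by exact_mod_cast hk
  refine hN.trans ?_
  have h1 : 4 * U * √(L * d / k) = 2 * √((2 * U) ^ 2 * (L * d / k)) := by
    rw [Real.sqrt_mul (sq_nonneg _), Real.sqrt_sq (by positivity)]; ring
  rw [h1]
  refine mul_le_mul_of_nonneg_left (Real.sqrt_le_sqrt ?_) (by norm_num)
  have h2 := div_le_div_of_nonneg_right hu hkpos.le
  calc 8 * L * ((∑ j, edgeOf ω m j * u j ^ 2) / k / 2)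
      ≤ 8 * L * (U ^ 2 * d / k / 2) :=
        mul_le_mul_of_nonneg_left (div_le_div_of_nonneg_right h2 (by norm_num)) (by positivity)
    _ = _ := by ring

lemma isRealization_of_outcome {h : ℝ} (hh : 1 ≤ h) {α : Fin n → ℝ} (hα : ∀ i, 0 < α i)
    (hαh : ∀ i j, α i ≤ h * α j) {q : Fin n → Fin n → ℝ} (hqs : ∀ i j, q i j = q j i)
    (hqd : ∀ i, q i i = 0) (hqp : ∀ i j, i ≠ j → 0 < q i j) (hq1 : ∀ i j, q i j ≤ 1)
    (hn : 0 < n) (hk : 0 < k) (ω : ModelIndex n k → Bool) :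
    IsRealization (normScore α) q (edgeOf ω) (empOf ω) h ‖normScore α‖ := by
  have hs : 0 < ∑ l, α l := Finset.sum_pos (fun l _ => hα l) ⟨⟨0, hn⟩, Finset.mem_univ _⟩
  have hpos : ∀ i, 0 < normScore α i := fun i => div_pos (hα i) hs
  exact
    { one_le_h := hh
      score_pos := hpos
      score_le := fun i => (le_abs_self _).trans (norm_le_pi_norm (normScore α) i)
      le_score := fun i => by
        refine (pi_norm_le_iff_of_nonneg (mul_nonneg (by linarith) (hpos i).le)).mpr fun j => ?_
        rw [Real.norm_eq_abs, abs_of_pos (hpos j), normScore, normScore, ← mul_div_assoc]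
        exact div_le_div_of_nonneg_right (hαh j i) hs.le
      sum_score := by
        simp only [normScore]
        rw [← Finset.sum_div, div_self hs.ne']
      q_symm := hqs
      q_diag := hqd
      q_pos := hqp
      q_le := hq1
      x_symm := edgeInd_symm _
      x_diag := edgeInd_self _
      x_zero_or_one := edgeInd_zero_or_one _
      P_nonneg := empProb_nonneg _
      P_add := fun i j hij => empProb_add _ hk hij }

lemma score_range {h : ℝ} {α : Fin n → ℝ} (hα : ∀ i, 0 < α i)
    (hαh : ∀ i j, α i ≤ h * α j) (i j : Fin n) :
    0 < normScore α i ∧ normScore α i ≤ h * normScore α j := by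
  have hs : 0 < ∑ l, α l := Finset.sum_pos (fun l _ => hα l) ⟨i, Finset.mem_univ _⟩
  refine ⟨div_pos (hα i) hs, ?_⟩
  rw [normScore, normScore, ← mul_div_assoc]
  exact div_le_div_of_nonneg_right (hαh i j) hs.le

/-- On a typical outcome the stationary distribution is unique and close to the true scores. -/
lemma stationary_of_typical {h s γ K L p : ℝ} (hh : 1 ≤ h) (hs : 0 ≤ s) (hγ : 0 < γ) (hγ1 : γ < 1)
    (hK1 : 10000 * h / γ ≤ K)
    (hK2 : 2 * (32 * (1 + h) * h * √s + 128 * h) * h / γ ≤ K) (hL : 1 ≤ L)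
    (hnp : K ^ 2 * L ≤ n * p) (hp : 0 < p) (hn : 2 ≤ n) (hns : (1 + h) ^ 2 * s ≤ n) (hk : 1 ≤ k)
    {α : Fin n → ℝ} (hα : ∀ i, 0 < α i) (hαh : ∀ i j, α i ≤ h * α j)
    {q : Fin n → Fin n → ℝ} (hqs : ∀ i j, q i j = q j i)
    (hqd : ∀ i, q i i = 0) (hqp : ∀ i j, i ≠ j → p ≤ q i j) (hq1 : ∀ i j, q i j ≤ 1)
    (hq : ∀ m, (n : ℝ) * ∑ j, q m j ^ 2 ≤ s * (∑ j, q m j) ^ 2)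
    {r : ℕ} (hr : (r : ℝ) ≤ 2 * L) {ω : ModelIndex n k → Bool}
    (htyp : ∀ m, IsTypicalAt (normScore α) q (8 * L) m ω) (hskew : SkewBound (normScore α) h r ω)
    (hgap : γ < 1 - absEig (rankMatrix (obsGraph fun e => ω (Sum.inl e)) (btlProb α)) 2) :
    ∃ v : Fin n → ℝ, (∀ w : Fin n → ℝ,
        IsStationaryDist (rankMatrix (obsGraph fun e => ω (Sum.inl e))
          (empProb fun e t => ω (Sum.inr (e, t)))) w ↔ w = v) ∧
      ‖v - normScore α‖ / ‖normScore α‖ ≤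
        2 * (32 * (1 + h) * h * √s + 128 * h) / γ * √(L / (n * p * k)) := by
  classical
  have hn0 : 0 < n := by omega
  have hh0 : 0 < h := by linarith
  have hL0 : 0 < L := by linarith
  have hnR : (2 : ℝ) ≤ n := by exact_mod_cast hn
  have hk0 : 0 < k := hk
  have hkR : (1 : ℝ) ≤ k := by exact_mod_cast hk
  have S := isRealization_of_outcome hh hα hαh hqs hqd
    (fun i j hij => hp.trans_le (hqp i j hij)) hq1 hn0 hk0 ω
  set π := normScore α with hπ
  set R := ‖π‖ with hR
  have hRpos : 0 < R := S.R_pos ⟨0, hn0⟩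
  set d : ℝ := (((obsGraph fun e => ω (Sum.inl e)).maxDegree : ℕ) : ℝ) with hd
  have hdeg : ∀ m, ∑ j, edgeOf ω m j ≤ d := fun m => by
    have := sum_edgeInd_le_maxDegree (obsGraph fun e => ω (Sum.inl e)) m
    exact this
  have hKh : 10000 * h ≤ γ * K := by
    rw [div_le_iff₀ hγ] at hK1; linarith
  have hK0 : 10000 ≤ K := by
    have h1 : 10000 ≤ 10000 * h / γ := by
      rw [le_div_iff₀ hγ]; nlinarith
    linarith
  have hDlow : ∀ m, n * p / 2 ≤ ∑ j, q m j := by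
    intro m
    calc n * p / 2 ≤ (n - 1) * p := by nlinarith
      _ = ∑ j ∈ Finset.univ.erase m, p := by
          rw [Finset.sum_const, Finset.card_erase_of_mem (Finset.mem_univ m), Finset.card_univ,
            Fintype.card_fin, nsmul_eq_mul, Nat.cast_sub (by omega)]
          simp
      _ ≤ ∑ j ∈ Finset.univ.erase m, q m j :=
          Finset.sum_le_sum fun j hj => hqp m j (Finset.ne_of_mem_erase hj).symm
      _ ≤ ∑ j, q m j := Finset.sum_le_sum_of_subset_of_nonneg (Finset.subset_univ _)
          fun j _ _ => S.q_nonneg m j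
  have hKL : 10000 * 10000 * L ≤ n * p := by
    refine le_trans ?_ hnp
    exact mul_le_mul_of_nonneg_right (by nlinarith) hL0.le
  -- Degree concentration shows that each degree is at least half its mean; together with the lower
  -- bound np/2 on the means this yields d ≥ np/4. No upper bound on d is needed.
  have hDd : ∀ m, ∑ j, q m j ≤ 2 * d := by
    intro m
    have h1 := (htyp m).degree
    simp only [EdgeBound, mul_one, one_pow, one_mul, Finset.sum_sub_distrib] at h1
    have h2 : 2 * √(8 * L * ∑ j, q m j) ≤ (∑ j, q m j) / 2 := by
      have hD0 : 128 * L ≤ ∑ j, q m j := by linarith [hDlow m]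
      have : √(8 * L * ∑ j, q m j) ≤ (∑ j, q m j) / 4 := by
        rw [Real.sqrt_le_left (by linarith)]
        nlinarith
      linarith
    have h3 := (abs_le.mp h1).1
    have h4 := hdeg m
    linarith
  have hdnp : n * p / 4 ≤ d := by
    have h1 := hDlow ⟨0, hn0⟩
    have h2 := hDd ⟨0, hn0⟩
    linarith
  have hd0 : 0 < d := by linarith
  have hLd : √(L / d) ≤ 2 / K := by
    rw [Real.sqrt_le_left (by positivity), div_pow, div_le_div_iff₀ hd0 (by positivity)]
    linarith
  have hLd2 : √(L * d) ≤ 2 / K * d := by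
    rw [Real.sqrt_le_left (by positivity)]
    have h1 : K ^ 2 * L ≤ 4 * d := by linarith
    have h2 : L ≤ 4 * d / K ^ 2 := by rw [le_div_iff₀ (by positivity)]; linarith
    calc L * d ≤ 4 * d / K ^ 2 * d := mul_le_mul_of_nonneg_right h2 hd0.le
      _ = _ := by ring
  have hsq : √(L * d / k) ≤ √(L * d) := Real.sqrt_le_sqrt (div_le_self (by positivity) hkR)
  have hγK : h * (2 / K) ≤ γ / 5000 := by
    rw [mul_div_assoc', div_le_iff₀ (by linarith)]
    linarith
  -- Chosen so that 8192 · 2 = 128², the factor 2 coming from r ≤ 2L.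
  have he9 : Real.exp 9 ≤ 8192 := by
    have h1 : Real.exp 9 = Real.exp 1 ^ 9 := by rw [← Real.exp_nat_mul]; norm_num
    rw [h1]
    calc Real.exp 1 ^ 9 ≤ 2.7182818286 ^ 9 :=
          pow_le_pow_left₀ (Real.exp_pos 1).le Real.exp_one_lt_d9.le 9
      _ ≤ 8192 := by norm_num
  have hb₂ : √(Real.exp 9 * (r * h) * d) ≤ 128 * h * √(L * d) := by
    have h1 : 128 * h * √(L * d) = √((128 * h) ^ 2 * (L * d)) := by
      rw [Real.sqrt_mul (sq_nonneg _), Real.sqrt_sq (by positivity)]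
    rw [h1]
    refine Real.sqrt_le_sqrt ?_
    have h2 : Real.exp 9 * (r * h) ≤ 8192 * (2 * L * h) :=
      mul_le_mul he9 (mul_le_mul_of_nonneg_right hr hh0.le) (by positivity) (by norm_num)
    have h3 : h ≤ h ^ 2 := by nlinarith
    calc Real.exp 9 * (r * h) * d ≤ 8192 * (2 * L * h) * d :=
          mul_le_mul_of_nonneg_right h2 hd0.le
      _ = 16384 * (L * d) * h := by ring
      _ ≤ 16384 * (L * d) * h ^ 2 := mul_le_mul_of_nonneg_left h3 (by positivity)
      _ = _ := by ring
  have hxnn : ∀ m j, 0 ≤ edgeOf ω m j := S.x_nonneg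
  have hsumsq : ∀ (m : Fin n) (u : Fin n → ℝ) (U : ℝ), (∀ j, |u j| ≤ U) →
      ∑ j, edgeOf ω m j * u j ^ 2 ≤ U ^ 2 * d := by
    intro m u U hu
    calc ∑ j, edgeOf ω m j * u j ^ 2 ≤ ∑ j, edgeOf ω m j * U ^ 2 := by
          refine Finset.sum_le_sum fun j _ => mul_le_mul_of_nonneg_left ?_ (hxnn m j)
          exact sq_le_sq.mpr ((hu j).trans (le_abs_self U))
      _ = U ^ 2 * ∑ j, edgeOf ω m j := by rw [← Finset.sum_mul, mul_comm]
      _ ≤ _ := mul_le_mul_of_nonneg_left (hdeg m) (sq_nonneg U)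
  have hgap' : ∀ y : Fin n → ℝ, ∑ i, π i * y i = 0 → γ * d * ∑ i, π i * y i ^ 2 ≤
      (∑ i, ∑ j, π i * (edgeOf ω i j * btlProb π i j) * (y i - y j) ^ 2) / 2 := by
    intro y hy
    have := poincare_rankMatrix hn (obsGraph fun e => ω (Sum.inl e)) S.score_pos hγ
      hd0 (by rw [hπ, btlProb_normScore hα]; exact hgap) hy
    exact this
  obtain ⟨v, hv1, hv2⟩ := S.norm_sub_score_le (γ := γ) (s := s) (d := d) (L := L) (k := k)
    (b₂ := √(Real.exp 9 * (r * h) * d)) hn hs hγ hd0 hL hkR hns hq hdeg hDd hgap'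
    (fun m => by
      have h1 := (htyp m).noise_one.le hk0 hL0.le zero_le_one
        (hsumsq m _ 1 (fun j => by simp))
      simp only [mul_one] at h1
      linarith)
    (fun m => by
      have h1 := (htyp m).noise_score.le hk0 hL0.le (U := 2 * R) (by positivity)
        (hsumsq m _ (2 * R) (fun j => by
          rw [abs_of_pos (add_pos (S.score_pos m) (S.score_pos j))]
          linarith [S.score_le m, S.score_le j]))
      linarith)
    (fun m j => by
      have h1 := (htyp m).noise_single j |>.le hk0 hL0.le (d := 1) (U := 1) zero_le_one (by
        rw [Finset.sum_eq_single_of_mem j (Finset.mem_univ j)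
          (fun i _ hi => by simp [Pi.single_eq_of_ne hi])]
        rcases S.x_zero_or_one m j with hx | hx <;> rw [hx] <;> simp)
      rw [Finset.sum_eq_single_of_mem j (Finset.mem_univ j)
          (fun i _ hi => by simp [Pi.single_eq_of_ne hi])] at h1
      simpa using h1)
    (fun m => by
      have h1 := (htyp m).edge
      simp only [EdgeBound, looError] at h1
      refine h1.trans ?_
      set E := ‖looScore π q (edgeOf ω) (empOf ω) m - π‖
      have hE : 0 ≤ E := norm_nonneg _
      have h2 : 8 * √(L * d) * E = 2 * √((4 * E) ^ 2 * (L * d)) := by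
        rw [Real.sqrt_mul (sq_nonneg _), Real.sqrt_sq (by positivity)]; ring
      rw [h2]
      refine mul_le_mul_of_nonneg_left (Real.sqrt_le_sqrt ?_) (by norm_num)
      calc 8 * L * (E ^ 2 * ∑ j, q m j) ≤ 8 * L * (E ^ 2 * (2 * d)) :=
            mul_le_mul_of_nonneg_left (mul_le_mul_of_nonneg_left (hDd m) (sq_nonneg E))
              (by positivity)
        _ = _ := by ring)
    (fun m => by
      have h1 := (htyp m).noise_error
      simp only [looError] at h1
      set e := looScore π q (edgeOf ω) (empOf ω) m - π
      have h2 := h1.le hk0 hL0.le (U := 2 * ‖e‖) (by positivity)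
        (hsumsq m _ (2 * ‖e‖) (fun j => by
          have c1 := norm_le_pi_norm e m
          have c2 := norm_le_pi_norm e j
          rw [Real.norm_eq_abs] at c1 c2
          linarith [abs_add_le (e m) (e j)]))
      have h3 := mul_le_mul_of_nonneg_left hsq (by positivity : 0 ≤ 8 * ‖e‖)
      linarith)
    hskew
    (by
      have h1 : 4 * √(L * d) + √(Real.exp 9 * (r * h) * d) / 2 ≤ 68 * h * √(L * d) := by
        have := Real.sqrt_nonneg (L * d)
        nlinarith
      have h2 : 68 * h * √(L * d) ≤ 68 * h * (2 / K * d) :=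
        mul_le_mul_of_nonneg_left hLd2 (by positivity)
      have h3 := mul_le_mul_of_nonneg_right hγK hd0.le
      have h4 : 0 < γ * d := by positivity
      linarith)
    (by
      have h1 : 34 * h * √(L / d) ≤ 34 * h * (2 / K) :=
        mul_le_mul_of_nonneg_left hLd (by positivity)
      linarith)
  set c := 32 * (1 + h) * h * √s + 128 * h with hc
  have hc0 : 0 < c := by positivity
  have hLdk : √(L / (d * k)) ≤ √(L / d) := by
    refine Real.sqrt_le_sqrt (div_le_div_of_nonneg_left hL0.le hd0 ?_)
    exact le_mul_of_one_le_right hd0.le hkR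
  -- The second lower bound on K makes the sup-norm error at most R/h, and every score is at least
  -- R/h.
  have hvpos : ∀ i, 0 ≤ v i := by
    intro i
    have h1 : |v i - π i| ≤ c / γ * R * √(L / (d * k)) := by
      have := (norm_le_pi_norm (v - π) i).trans hv2
      rwa [Real.norm_eq_abs, Pi.sub_apply] at this
    have h2 : c / γ * R * √(L / (d * k)) ≤ c / γ * R * (2 / K) :=
      mul_le_mul_of_nonneg_left (hLdk.trans hLd) (by positivity)
    have h3 : c / γ * R * (2 / K) * h ≤ R := by
      have : c / γ * R * (2 / K) * h = R * ((2 * c * h / γ) / K) := by ring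
      rw [this]
      exact mul_le_of_le_one_right hRpos.le ((div_le_one (by linarith)).mpr hK2)
    have h4 := S.le_score i
    have h5 : c / γ * R * (2 / K) ≤ π i := by
      refine le_of_mul_le_mul_right ?_ hh0
      linarith
    have h6 := (abs_le.mp h1).1
    linarith
  refine ⟨v, fun w => ?_, ?_⟩
  · have hiff := isStationaryDist_rankMatrix_iff (obsGraph fun e => ω (Sum.inl e))
      (empProb fun e t => ω (Sum.inr (e, t))) hd0 w
    refine hiff.trans ⟨fun hw => (hv1 w).mp hw.2, fun hw => ?_⟩
    exact ⟨fun i => by rw [hw]; exact hvpos i, (hv1 w).mpr hw⟩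
  · rw [div_le_iff₀ hRpos]
    refine hv2.trans ?_
    have h1 : √(L / (d * k)) ≤ 2 * √(L / (n * p * k)) := by
      have hnp0 : (0 : ℝ) < n * p := by positivity
      have h2 : 2 * √(L / (n * p * k)) = √(2 ^ 2 * (L / (n * p * k))) := by
        rw [Real.sqrt_mul (sq_nonneg _), Real.sqrt_sq (by norm_num)]
      rw [h2]
      refine Real.sqrt_le_sqrt ?_
      rw [mul_div_assoc', div_le_div_iff₀ (by positivity) (by positivity)]
      have h3 : n * p * k ≤ 4 * d * k := mul_le_mul_of_nonneg_right (by linarith) (by positivity)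
      have := mul_le_mul_of_nonneg_left h3 hL0.le
      linarith
    calc c / γ * R * √(L / (d * k)) ≤ c / γ * R * (2 * √(L / (n * p * k))) :=
          mul_le_mul_of_nonneg_left h1 (by positivity)
      _ = _ := by ring

end Main

/-! ### Probability of a typical outcome -/

section Probability

variable {n k : ℕ}

lemma looError_unaffected (π : Fin n → ℝ) (q : Fin n → Fin n → ℝ) (m : Fin n) :
    Unaffected (touching k m) (looError π q m) := by
  intro ω i hi b
  have := looScore_unaffected π q m ω i hi b
  simp only at this
  simp only [looError, this]

/-- Five two-sided bounds, and one two-sided bound for each single pair {m, j}, each fail with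
probability at most 2 exp(−t). -/
lemma prob_not_typicalAt_le {q : Fin n → Fin n → ℝ} {π : Fin n → ℝ} (hπ : ∀ i, 0 < π i)
    (hqs : ∀ i j, q i j = q j i) (hq0 : ∀ i j, 0 ≤ q i j) (hq1 : ∀ i j, q i j ≤ 1)
    (hqd : ∀ i, q i i = 0) (hk : 0 < k) (m : Fin n) {t : ℝ} (ht : 0 < t)
    (htD : t ≤ ∑ j, q m j) :
    bernProb (modelProb k q π) (fun ω => ¬ IsTypicalAt π q t m ω) ≤
      (10 + 2 * n) * Real.exp (-t) := by
  have h0 := modelProb_nonneg (k := k) hq0 hπ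
  have h1 := modelProb_le_one (k := k) hq1 hπ
  have hN : ∀ u : Fin n → (ModelIndex n k → Bool) → ℝ, (∀ j, Unaffected (touching k m) (u j)) →
      bernProb (modelProb k q π) (fun ω => ¬ NoiseBound π t m (fun j => u j ω) ω) ≤
        2 * Real.exp (-t) := by
    intro u hu
    simp only [NoiseBound, not_le]
    exact noise_tail hπ hq0 hq1 hk m u ht.le hu
  have hE : ∀ (c : Fin n → (ModelIndex n k → Bool) → ℝ) (B : (ModelIndex n k → Bool) → ℝ),
      (∀ j, Unaffected (touching k m) (c j)) → Unaffected (touching k m) B →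
      (∀ j ω, |c j ω| ≤ B ω) →
      bernProb (modelProb k q π) (fun ω => ¬ EdgeBound q t m (fun j => c j ω) (B ω) ω) ≤
        2 * Real.exp (-t) := by
    intro c B hc hB hcB
    simp only [EdgeBound, not_le]
    exact edge_tail hπ hqs hq0 hq1 hqd m c B ht hc hB hcB htD
  have he := looError_unaffected (k := k) π q m
  have b1 := hE (fun _ _ => 1) (fun _ => 1) (fun _ _ _ _ _ => rfl) (fun _ _ _ _ => rfl)
    (fun _ _ => by simp)
  have b2 := hE (fun j ω => looError π q m ω m * btlProb π m j - looError π q m ω j * btlProb π j m)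
    (fun ω => ‖looError π q m ω‖)
    (fun j ω i hi b => by simp only [he ω i hi b]) (fun ω i hi b => by simp only [he ω i hi b])
    (fun j ω => by
      have c1 := norm_le_pi_norm (looError π q m ω) m
      have c2 := norm_le_pi_norm (looError π q m ω) j
      rw [Real.norm_eq_abs] at c1 c2
      have c3 := btlProb_nonneg hπ m j
      have c4 := btlProb_nonneg hπ j m
      refine (abs_sub _ _).trans ?_
      rw [abs_mul, abs_mul, abs_of_nonneg c3, abs_of_nonneg c4]
      have c5 := mul_le_mul_of_nonneg_right c1 c3
      have c6 := mul_le_mul_of_nonneg_right c2 c4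
      calc _ ≤ ‖looError π q m ω‖ * btlProb π m j + ‖looError π q m ω‖ * btlProb π j m :=
            add_le_add c5 c6
        _ = _ := by rw [← mul_add, btlProb_add hπ, mul_one])
  have b3 := hN (fun _ _ => 1) (fun _ _ _ _ _ => rfl)
  have b4 := hN (fun j _ => π m + π j) (fun _ _ _ _ _ => rfl)
  have b5 := hN (fun j ω => looError π q m ω m + looError π q m ω j)
    (fun j ω i hi b => by simp only [he ω i hi b])
  have b6 : bernProb (modelProb k q π)
      (fun ω => ∃ l, ¬ NoiseBound π t m (Pi.single l 1) ω) ≤ n * (2 * Real.exp (-t)) := by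
    refine (bernProb_exists h0 h1 _).trans ?_
    calc _ ≤ ∑ _l : Fin n, 2 * Real.exp (-t) := Finset.sum_le_sum fun l _ =>
          hN (fun j _ => (Pi.single l (1 : ℝ) : Fin n → ℝ) j) (fun _ _ _ _ _ => rfl)
      _ = _ := by rw [Finset.sum_const, Finset.card_univ, Fintype.card_fin, nsmul_eq_mul]
  refine (bernProb_mono h0 h1 (fun ω hω => ?_)).trans
    ((bernProb_or h0 h1 _ _).trans ((add_le_add b1 ((bernProb_or h0 h1 _ _).trans
    (add_le_add b2 ((bernProb_or h0 h1 _ _).trans (add_le_add b3 ((bernProb_or h0 h1 _ _).trans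
    (add_le_add b4 ((bernProb_or h0 h1 _ _).trans (add_le_add b5 b6))))))))).trans ?_))
  · by_contra hc
    simp only [not_or, not_not, not_exists] at hc
    obtain ⟨a1, a2, a3, a4, a5, a6⟩ := hc
    exact hω ⟨a1, a2, a3, a4, a5, a6⟩
  · linarith

end Probability

end

/-! ### Choice of constants and union bound -/

theorem theorem3p1 (h s : ℝ) (hh : 1 ≤ h) (hs : 1 < s) :
    ∃ c₁ c₂ : ℝ, 0 < c₁ ∧ 0 < c₂ ∧
      ∀ γ : ℝ, 0 < γ → γ < 1 →
        ∃ c₀ : ℝ, 10240 * h ^ 2 / γ ^ 2 ≤ c₀ ∧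
          ∃ (C : ℝ) (N : ℕ), ∀ (n : ℕ), N ≤ n →
            ∀ (k : ℕ), 5 ≤ k →
            ∀ (p : ℝ), 0 < p → p ≤ 1 → c₀ * Real.log n ≤ n * p →
            ∀ (q : Fin n → Fin n → ℝ), (∀ i j, q i j = q j i) →
              (∀ i j, i ≠ j → p ≤ q i j ∧ q i j ≤ 1) →
              (∀ i, (n : ℝ) * ∑ j ∈ Finset.univ.erase i, q i j ^ 2
                ≤ s * (∑ j ∈ Finset.univ.erase i, q i j) ^ 2) →
            ∀ (α : Fin n → ℝ), (∀ i, 0 < α i) → (∀ i j, α i ≤ h * α j) →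
            ∀ (Ω : Type*) [MeasurableSpace Ω] (μ : Measure Ω) [IsProbabilityMeasure μ]
              (X : ItemPair n → Ω → Bool) (Z : ItemPair n → Fin k → Ω → Bool),
              IsSemiRandomBTL μ q α X Z →
              μ.real {ω | 1 - absEig (rankMatrix (obsGraph (fun e => X e ω)) (btlProb α)) 2 ≤ γ}
                ≤ 1 / (n : ℝ) ^ 5 →
              1 - C / (n : ℝ) ^ 5 ≤
                μ.real {ω | ∃ v : Fin n → ℝ,
                  (∀ w : Fin n → ℝ,
                    IsStationaryDist (rankMatrix (obsGraph (fun e => X e ω))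
                      (empProb (fun e m => Z e m ω))) w ↔ w = v) ∧
                  ‖v - normScore α‖ / ‖normScore α‖
                    ≤ (c₁ / γ + c₂) * Real.sqrt (Real.log n / (n * p * k))} := by
  have hh0 : 0 < h := by linarith
  set c : ℝ := 32 * (1 + h) * h * √s + 128 * h with hc
  have hc0 : 0 < c := by positivity
  -- The deterministic bound is c/γ in terms of √(log n/(dk)), and d ≥ np/4 doubles it; the constant
  -- c₂ = 1 is pure slack.
  refine ⟨2 * c, 1, by positivity, one_pos, fun γ hγ hγ1 => ?_⟩
  set K : ℝ := (10000 * h + 2 * c * h) / γ with hK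
  have hK1 : 10000 * h / γ ≤ K :=
    div_le_div_of_nonneg_right (le_add_of_nonneg_right (by positivity)) hγ.le
  have hK2 : 2 * c * h / γ ≤ K :=
    div_le_div_of_nonneg_right (le_add_of_nonneg_left (by positivity)) hγ.le
  -- From n ≥ 3 follows log n ≥ 1, and n ≥ (1+h)² s gives (1+h)√(s/n) ≤ 1. The value 14 = 1 + 10 + 2
  -- + 1 comes from the union bound.
  refine ⟨K ^ 2, ?_, 14, max 3 ⌈(1 + h) ^ 2 * s⌉₊, ?_⟩
  · calc 10240 * h ^ 2 / γ ^ 2 ≤ (10000 * h / γ) ^ 2 := by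
          rw [div_pow]
          refine div_le_div_of_nonneg_right ?_ (by positivity)
          nlinarith [sq_nonneg h]
      _ ≤ K ^ 2 := pow_le_pow_left₀ (by positivity) hK1 2
  intro n hn k hk p hp _ hnp q hqs hqp hq α hα hαh Ω _ μ _ X Z hmodel hgapprob
  have hn3 : 3 ≤ n := (le_max_left _ _).trans hn
  have hns : (1 + h) ^ 2 * s ≤ n := (Nat.le_ceil _).trans
    (by exact_mod_cast (le_max_right _ _).trans hn)
  have hnR : (3 : ℝ) ≤ n := by exact_mod_cast hn3
  have hn0 : (0 : ℝ) < n := by linarith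
  have hk0 : 0 < k := by omega
  set L := Real.log n with hLdef
  have hL : 1 ≤ L := by
    rw [hLdef, Real.le_log_iff_exp_le hn0]
    linarith [Real.exp_one_lt_d9]
  have hexp : ∀ a : ℕ, Real.exp (-(a * L)) = 1 / (n : ℝ) ^ a := by
    intro a
    rw [Real.exp_neg, Real.exp_nat_mul, hLdef, Real.exp_log hn0, one_div]
  -- The diagonal of q is arbitrary in the hypotheses; setting it to zero lets sums run over all j.
  set q' : Fin n → Fin n → ℝ := fun i j => if i = j then 0 else q i j with hq'
  have hq's : ∀ i j, q' i j = q' j i := fun i j => by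
    simp only [hq', hqs i j, eq_comm]
  have hq'd : ∀ i, q' i i = 0 := fun i => by simp [hq']
  have hq'p : ∀ i j, i ≠ j → p ≤ q' i j := fun i j hij => by
    simp only [hq', if_neg hij]; exact (hqp i j hij).1
  have hq'1 : ∀ i j, q' i j ≤ 1 := fun i j => by
    by_cases hij : i = j
    · simp [hq', hij]
    · simp only [hq', if_neg hij]; exact (hqp i j hij).2
  have hq'0 : ∀ i j, 0 ≤ q' i j := fun i j => by
    by_cases hij : i = j
    · simp [hq', hij]
    · exact hp.le.trans (hq'p i j hij)
  have hsum1 : ∀ i, ∑ j, q' i j = ∑ j ∈ Finset.univ.erase i, q i j := by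
    intro i
    rw [← Finset.sum_erase Finset.univ (hq'd i)]
    exact Finset.sum_congr rfl fun j hj => if_neg (Finset.ne_of_mem_erase hj).symm
  have hsum2 : ∀ i, ∑ j, q' i j ^ 2 = ∑ j ∈ Finset.univ.erase i, q i j ^ 2 := by
    intro i
    rw [← Finset.sum_erase (f := fun j => q' i j ^ 2) Finset.univ
      (show q' i i ^ 2 = 0 by rw [hq'd]; norm_num)]
    refine Finset.sum_congr rfl fun j hj => ?_
    simp only [hq', if_neg (Finset.ne_of_mem_erase hj).symm]
  have hq'q : ∀ m, (n : ℝ) * ∑ j, q' m j ^ 2 ≤ s * (∑ j, q' m j) ^ 2 := fun m => by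
    rw [hsum1, hsum2]; exact hq m
  have hπpos : ∀ i, 0 < normScore α i := fun i => (score_range hα hαh i i).1
  have hπh : ∀ i j, normScore α i ≤ h * normScore α j := fun i j => (score_range hα hαh i j).2
  have hD : ∀ m, 8 * L ≤ ∑ j, q' m j := by
    intro m
    have hK8 : 16 * L ≤ K ^ 2 * L := by
      have h1 : 10000 ≤ 10000 * h / γ := by
        rw [le_div_iff₀ hγ]; nlinarith
      have h2 : 10000 ≤ K := h1.trans hK1
      exact mul_le_mul_of_nonneg_right (by nlinarith) (by linarith)
    calc 8 * L ≤ n * p / 2 := by linarith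
      _ ≤ (n - 1) * p := by nlinarith
      _ = ∑ j ∈ Finset.univ.erase m, p := by
          rw [Finset.sum_const, Finset.card_erase_of_mem (Finset.mem_univ m), Finset.card_univ,
            Fintype.card_fin, nsmul_eq_mul, Nat.cast_sub (by omega)]
          simp
      _ ≤ ∑ j ∈ Finset.univ.erase m, q' m j :=
          Finset.sum_le_sum fun j hj => hq'p m j (Finset.ne_of_mem_erase hj).symm
      _ = ∑ j, q' m j := Finset.sum_erase _ (hq'd m)
  set Y : ModelIndex n k → Ω → Bool :=
    Sum.elim X (fun em : ItemPair n × Fin k => Z em.1 em.2) with hY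
  have hYm : ∀ i, Measurable (Y i) := by
    rintro (e | et)
    · exact hmodel.measurable_edge e
    · exact hmodel.measurable_outcome et.1 et.2
  have hw : ∀ i, μ.real {ω | Y i ω = true} = modelProb k q' (normScore α) i := by
    rintro (e | et)
    · refine (hmodel.edge_law e).trans ?_
      simp only [modelProb, Sum.elim_inl, hq', if_neg e.2.ne]
    · refine (hmodel.outcome_law et.1 et.2).trans ?_
      simp only [modelProb, Sum.elim_inr, btlProb_normScore hα]
  have htransfer := measureReal_eq_bernProb μ Y hYm hmodel.indep
    (modelProb k q' (normScore α)) hw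
  have h0 := modelProb_nonneg (k := k) hq'0 hπpos
  have h1 := modelProb_le_one (k := k) hq'1 hπpos
  set gapFail : (ModelIndex n k → Bool) → Prop := fun ω =>
    1 - absEig (rankMatrix (obsGraph fun e => ω (Sum.inl e)) (btlProb α)) 2 ≤ γ with hgapFail
  -- A moment order of about log n makes n exp(−9r) at most n^(−8), while r ≤ 2L keeps the spectral
  -- bound of order √(d log n).
  set r := ⌈L⌉₊ with hr
  have hr0 : r ≠ 0 := (Nat.ceil_pos.mpr (by linarith)).ne'
  have hr2 : (r : ℝ) ≤ 2 * L := by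
    have := Nat.ceil_lt_add_one (show 0 ≤ L by linarith)
    linarith
  have hb1 : bernProb (modelProb k q' (normScore α)) gapFail ≤ 1 / (n : ℝ) ^ 5 := by
    rw [← htransfer gapFail]
    exact hgapprob
  -- The level t = 8 log n pays for the union over m and over the single pairs, of order n² events,
  -- and still leaves a probability of order n^(−6).
  have hb2 : bernProb (modelProb k q' (normScore α))
      (fun ω => ∃ m, ¬ IsTypicalAt (normScore α) q' (8 * L) m ω) ≤
      n * ((10 + 2 * n) * (1 / (n : ℝ) ^ 8)) := by
    refine (bernProb_exists h0 h1 _).trans ?_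
    calc _ ≤ ∑ _m : Fin n, (10 + 2 * n) * Real.exp (-(8 * L)) := Finset.sum_le_sum fun m _ =>
          prob_not_typicalAt_le hπpos hq's hq'0 hq'1 hq'd hk0 m (by linarith) (hD m)
      _ = _ := by
          have := hexp 8
          push_cast at this
          rw [Finset.sum_const, Finset.card_univ, Fintype.card_fin, nsmul_eq_mul, this]
  have hb3 : bernProb (modelProb k q' (normScore α))
      (fun ω => ¬ SkewBound (normScore α) h r ω) ≤ n * (1 / (n : ℝ) ^ 9) := by
    simp only [SkewBound, not_forall, not_le]
    refine (skew_noise_tail hπpos hq'0 hq'1 hk0 hh hπh hr0).trans ?_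
    have := hexp 9
    push_cast at this
    rw [← this]
    refine mul_le_mul_of_nonneg_left (Real.exp_le_exp.mpr ?_) hn0.le
    have := Nat.le_ceil L
    linarith
  have hbad : bernProb (modelProb k q' (normScore α)) (fun ω => gapFail ω ∨
      ((∃ m, ¬ IsTypicalAt (normScore α) q' (8 * L) m ω) ∨ ¬ SkewBound (normScore α) h r ω)) ≤
      14 / (n : ℝ) ^ 5 := by
    refine ((bernProb_or h0 h1 _ _).trans (add_le_add hb1 ((bernProb_or h0 h1 _ _).trans
      (add_le_add hb2 hb3)))).trans ?_
    have e : (1 : ℝ) / n ^ 5 + (n * ((10 + 2 * n) * (1 / n ^ 8)) + n * (1 / n ^ 9)) =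
        (n ^ 3 + 10 * n + 2 * n ^ 2 + 1) / n ^ 8 := by
      field_simp
      ring
    rw [e, div_le_div_iff₀ (by positivity) (by positivity)]
    have e2 : (14 : ℝ) * n ^ 8 = (14 * n ^ 3) * n ^ 5 := by ring
    rw [e2]
    refine mul_le_mul_of_nonneg_right ?_ (by positivity)
    nlinarith [sq_nonneg (n : ℝ), mul_nonneg hn0.le (sq_nonneg (n : ℝ))]
  have hsucc : bernProb (modelProb k q' (normScore α)) (fun ω => ¬ (gapFail ω ∨
      ((∃ m, ¬ IsTypicalAt (normScore α) q' (8 * L) m ω) ∨ ¬ SkewBound (normScore α) h r ω))) ≤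
      bernProb (modelProb k q' (normScore α)) (fun ω => ∃ v : Fin n → ℝ,
        (∀ w : Fin n → ℝ, IsStationaryDist (rankMatrix (obsGraph fun e => ω (Sum.inl e))
          (empProb fun e t => ω (Sum.inr (e, t)))) w ↔ w = v) ∧
        ‖v - normScore α‖ / ‖normScore α‖ ≤ (2 * c / γ + 1) * √(L / (n * p * k))) := by
    refine bernProb_mono h0 h1 fun ω hω => ?_
    simp only [not_or, not_exists, not_not, hgapFail, not_le] at hω
    obtain ⟨g1, g2, g3⟩ := hω
    obtain ⟨v, hv1, hv2⟩ := stationary_of_typical hh (by linarith) hγ hγ1 hK1 hK2 hL hnp hp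
      (by omega) hns (by omega) hα hαh hq's hq'd hq'p hq'1 hq'q hr2 g2 g3 g1
    refine ⟨v, hv1, hv2.trans (mul_le_mul_of_nonneg_right ?_ (Real.sqrt_nonneg _))⟩
    linarith
  rw [bernProb_not] at hsucc
  have hfin := htransfer (fun ω => ∃ v : Fin n → ℝ,
        (∀ w : Fin n → ℝ, IsStationaryDist (rankMatrix (obsGraph fun e => ω (Sum.inl e))
          (empProb fun e t => ω (Sum.inr (e, t)))) w ↔ w = v) ∧
        ‖v - normScore α‖ / ‖normScore α‖ ≤ (2 * c / γ + 1) * √(L / (n * p * k)))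
  refine le_trans ?_ (hsucc.trans hfin.ge)
  linarith
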